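/- Let $H$ be a complex separable Hilbert space, $\mathcal M\subseteq\mathcal B(H)$ a von Neumann algebra with a normal faithful semifinite trace $\tau$. For $p\in[1,\infty)$ and $X\in\mathcal M$ put $\|X\|_p=\tau(|X|^p)^{1/p}\in[0,\infty]$ and $\mathcal L_p(\mathcal M,\tau)=L_p(\mathcal M,\tau)\cap\mathcal M=\{X\in\mathcal M:\|X\|_p<\infty\}$. Let $A_1,\dots,A_n,B_1,\dots,B_n\in\mathcal M$ be contractions (not necessarily commuting), $V_j=B_j-A_j$ and $X_j(s)=A_j+sV_j$ for $s\in[0,1]$. Let $\epsilon>0$ and let $f$ be holomorphic on $\mathbb D^n_{1+\epsilon}=\{z\in\mathbb C^n:|z_j|<1+\epsilon,\ 1\le j\le n\}$. Then $f$ has an absolutely convergent expansion $$f(z)=\sum_{k_1,\dots,k_n\ge0}c_{k_1,\dots,k_n}z_1^{k_1}\cdots z_n^{k_n},\qquad z\in\mathbb D^n_{1+\epsilon},$$ and the series $$f(X_1(s),\dots,X_n(s)):=\sum_{k_1,\dots,k_n\ge0}c_{k_1,\dots,k_n}X_1(s)^{k_1}\cdots X_n(s)^{k_n}$$ converges absolutely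 in operator norm for every $s\in[0,1]$. Write $F(s)=f(X_1(s),\dots,X_n(s))$. Let $m\ge1$ be an integer. (1) $F$ is $m$ times differentiable on $[0,1]$ in the operator norm (one-sidedly at the endpoints), and $t\mapsto F^{(m)}(t)$ is continuous on $[0,1]$ in the operator norm. (2) For $1\le k\le m$, $1\le j_1<\dots<j_k\le n$ and integers $i_1,\dots,i_k\ge1$ with $i_1+\dots+i_k=m$, let $$D_f^{j_1^{i_1},\dots,j_k^{i_k}}(t)=\sum_{k_1,\dots,k_n\ge0}c_{k_1,\dots,k_n}\,Y_1Y_2\cdots Y_n,$$ where $Y_{j_l}=\frac{d^{i_l}}{ds^{i_l}}\big|_{s=t}X_{j_l}(s)^{k_{j_l}}$ for $1\le l\le k$, and $Y_q=X_q(t)^{k_q}$ for $q\notin\{j_1,\dots,j_k\}$. This series converges absolutely in operator norm for every $t\in[0,1]$, and $$F^{(m)}(t)=\sum_{k=1}^m\ \sum_{1\le j_1<\dots<j_k\le n}\ \sum_{\substack{i_1,\dots,i_k\ge1\\ i_1+\dots+i_k=m}}\frac{m!}{i_1!\cdots i_k!}\,D_f^{j_1^{i_1},\dots,j_k^{i_k}}(t),\qquad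 t\in[0,1].$$ (3) Let $r\in[1,\infty)$ and suppose $V_j\in\mathcal L_r(\mathcal M,\tau)$ for $1\le j\le n$. Put $p=r/m$ if $r>m$ and $p=1$ if $r\le m$. Then the $m$-th derivative exists in $\|\cdot\|_p$: for every $t\in[0,1]$, $F^{(m)}(t)\in\mathcal L_p(\mathcal M,\tau)$ and $$\Big\|\tfrac{F^{(m-1)}(s)-F^{(m-1)}(t)}{s-t}-F^{(m)}(t)\Big\|_p\to0\quad\text{as } s\to t,\ s\in[0,1]\setminus\{t\};$$ and $t\mapsto F^{(m)}(t)$ is continuous on $[0,1]$ in $\|\cdot\|_p$. -/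

import Mathlib

open scoped ENNReal Topology Nat

noncomputable section

/-- A normal faithful semifinite trace `τ : M₊ → [0, ∞]` on a von Neumann algebra `M` of bounded
operators on `H`. The order is the usual order of self-adjoint operators (`x ≤ y` iff `y - x` is
a positive operator). The function is total for convenience; only its values on the positive
elements of `M` matter. -/
structure NFSTrace {H : Type*} [NormedAddCommGroup H] [InnerProductSpace ℂ H] [CompleteSpace H]
    (M : VonNeumannAlgebra H) where
  toFun : (H →L[ℂ] H) → ℝ≥0∞
  map_add : ∀ x ∈ M, ∀ y ∈ M, 0 ≤ x → 0 ≤ y → toFun (x + y) = toFun x + toFun y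
  map_smul : ∀ a : ℝ, 0 ≤ a → ∀ x ∈ M, 0 ≤ x → toFun (a • x) = ENNReal.ofReal a * toFun x
  tracial : ∀ x ∈ M, toFun (star x * x) = toFun (x * star x)
  faithful : ∀ x ∈ M, 0 ≤ x → toFun x = 0 → x = 0
  normal : ∀ (D : Set (H →L[ℂ] H)) (x : H →L[ℂ] H), D.Nonempty → DirectedOn (· ≤ ·) D →
    (∀ y ∈ D, y ∈ M ∧ 0 ≤ y) → x ∈ M → IsLUB D x → toFun x = ⨆ y ∈ D, toFun y
  semifinite : ∀ x ∈ M, 0 ≤ x → x ≠ 0 →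
    ∃ y ∈ M, 0 ≤ y ∧ y ≤ x ∧ y ≠ 0 ∧ toFun y < ∞

section

variable {H : Type*} [NormedAddCommGroup H] [InnerProductSpace ℂ H] [CompleteSpace H]

/-- `‖x‖_p = τ(|x|^p)^(1/p)`, as an extended nonnegative real, for `x` in `M`. -/
def NFSTrace.lpNorm {M : VonNeumannAlgebra H} (τ : NFSTrace M) (p : ℝ) (x : H →L[ℂ] H) : ℝ≥0∞ :=
  (τ.toFun (CFC.abs x ^ p)) ^ (1 / p)

/-- Membership in `𝓛_p(M, τ) = L_p(M, τ) ∩ M`. -/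
def NFSTrace.MemLp {M : VonNeumannAlgebra H} (τ : NFSTrace M) (p : ℝ) (x : H →L[ℂ] H) : Prop :=
  x ∈ M ∧ τ.lpNorm p x < ∞

/-- `F'` is the derivative at `t`, in `‖·‖_p`, of the function `F` on `[0, 1]`: `F'` belongs to
`𝓛_p(M, τ)` and the difference quotients of `F` at `t` converge to `F'` in `‖·‖_p`. -/
def NFSTrace.HasLpDerivAt {M : VonNeumannAlgebra H} (τ : NFSTrace M) (p : ℝ)
    (F : ℝ → H →L[ℂ] H) (F' : H →L[ℂ] H) (t : ℝ) : Prop :=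
  τ.MemLp p F' ∧
    Filter.Tendsto (fun s : ℝ => τ.lpNorm p ((s - t)⁻¹ • (F s - F t) - F'))
      (𝓝[Set.Icc 0 1 \ {t}] t) (𝓝 0)

/-- Continuity of `G` on `[0, 1]` with respect to `‖·‖_p`. -/
def NFSTrace.LpContinuous {M : VonNeumannAlgebra H} (τ : NFSTrace M) (p : ℝ)
    (G : ℝ → H →L[ℂ] H) : Prop :=
  ∀ t ∈ Set.Icc (0 : ℝ) 1,
    Filter.Tendsto (fun s : ℝ => τ.lpNorm p (G s - G t)) (𝓝[Set.Icc 0 1] t) (𝓝 0)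

/-- The open polydisc of radius `ρ` centred at `0` in `ℂⁿ`. -/
def polydisc (n : ℕ) (ρ : ℝ) : Set (Fin n → ℂ) := {z | ∀ j, ‖z j‖ < ρ}

/-- `f(z) = ∑_κ c_κ z₁^κ₁ ⋯ z_n^κ_n`, absolutely convergent, at every point of the polydisc. -/
def HasPowerSeriesOnPolydisc {n : ℕ} (f : (Fin n → ℂ) → ℂ) (c : (Fin n → ℕ) → ℂ) (ρ : ℝ) : Prop :=
  ∀ z ∈ polydisc n ρ, HasSum (fun κ : Fin n → ℕ => c κ * ∏ j, z j ^ κ j) (f z)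

/-- The ordered monomial `X₁^κ₁ X₂^κ₂ ⋯ X_n^κ_n`. -/
def opMonomial {n : ℕ} (X : Fin n → H →L[ℂ] H) (κ : Fin n → ℕ) : H →L[ℂ] H :=
  ((List.finRange n).map fun j => X j ^ κ j).prod

/-- The multivariate operator function `∑_κ c_κ X₁^κ₁ ⋯ X_n^κ_n` (convergence in operator norm). -/
def opFun {n : ℕ} (c : (Fin n → ℕ) → ℂ) (X : Fin n → H →L[ℂ] H) : H →L[ℂ] H :=
  ∑' κ : Fin n → ℕ, c κ • opMonomial X κ

/-- The linear path `X_j(s) = A_j + s (B_j - A_j)`. -/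
def linPath {n : ℕ} (A B : Fin n → H →L[ℂ] H) (s : ℝ) : Fin n → H →L[ℂ] H :=
  fun j => A j + s • (B j - A j)

/-- The ordered product, over the positions `q = 1, …, n`, whose factor at a position `q = j_l` is
the `i_l`-th derivative at `t` of `s ↦ X_q(s)^κ_q`, and whose factor at every other position `q` is
`X_q(t)^κ_q`. -/
def derivMonomial {n k : ℕ} (A B : Fin n → H →L[ℂ] H) (j : Fin k → Fin n) (i : Fin k → ℕ)
    (t : ℝ) (κ : Fin n → ℕ) : H →L[ℂ] H :=
  open Classical in
  ((List.finRange n).map fun q =>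
    if h : ∃ l, j l = q then
      iteratedDeriv (i h.choose) (fun s : ℝ => linPath A B s q ^ κ q) t
    else linPath A B t q ^ κ q).prod

/-- `D_f^{j₁^i₁, …, j_k^i_k}(t)`, for `f` with power series coefficients `c`. -/
def derivSeries {n k : ℕ} (c : (Fin n → ℕ) → ℂ) (A B : Fin n → H →L[ℂ] H)
    (j : Fin k → Fin n) (i : Fin k → ℕ) (t : ℝ) : H →L[ℂ] H :=
  ∑' κ : Fin n → ℕ, c κ • derivMonomial A B j i t κ

/-- All tuples `j₁ < ⋯ < j_k` of indices in `{1, …, n}`. -/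
def increasingTuples (k n : ℕ) : Finset (Fin k → Fin n) :=
  open Classical in Finset.univ.filter fun j => StrictMono j

/-- All tuples `(i₁, …, i_k)` of integers `≥ 1` with `i₁ + ⋯ + i_k = m`. -/
def compositionTuples (k m : ℕ) : Finset (Fin k → ℕ) :=
  (Finset.Nat.antidiagonalTuple k m).filter fun i => ∀ l, 1 ≤ i l

end

end

/-!
The operator function is a power series in the ordered monomials `X₁(s)^κ₁ ⋯ X_n(s)^κ_n`, and each
derivative of such a monomial, of order `m`, is a sum of products in which exactly `m` factors
`X_j(s)` are replaced by `V_j`. Its norm is at most `(v |κ|) ^ m ρ ^ |κ|` with `v` a bound for the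
`V_j` and `ρ` one for the `X_j(s)` (`bound_iteratedDeriv_opMonomial`). The coefficients are
summable against these numbers for `ρ < 1 + ε`, so the series can be differentiated termwise on a
neighbourhood of `[0, 1]` (`hasDerivAt_termwiseDeriv`). The formula for the derivatives is the
Leibniz rule for ordered products (`iteratedDeriv_list_prod`), where the multi-indices of weight `m`
are sorted by their supports `j₁ < ⋯ < j_k` (`sum_increasingTuples_compositionTuples`).

For the `L_p` statements, products with `m` factors from `𝓛_r` lie in `𝓛_{r/m}` by Hölder's
inequality. The sets `NFSTrace.gradedBall τ r k R` record this: they are closed and convex, orders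
`k` add up and bounds `R` multiply under products, and the termwise derivatives of order `m` lie in
one such set of order `m`, uniformly along the path. The derivative of order `m + 1` lies in a set of
order `m + 1`, hence of order `m`, so by the mean value theorem for closed convex sets the
derivative of order `m` is Lipschitz in `‖·‖_{r/m}`, and the difference quotients converge at a
linear rate (`hasLpDerivAt_termwiseDeriv`). If `r ≤ m`, then `V_j ∈ 𝓛_r ⊆ 𝓛_m`, and `r` may be
replaced by `m`.

The noncommutative Minkowski and Hölder inequalities are proved from the axioms of a trace, without
interpolation. The Cauchy–Schwarz inequality for the linear extension of `τ` gives, by pairing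
neighbouring factors repeatedly, Hölder's inequality for `2 ^ k` equal exponents
(`NFSTrace.norm_tr_le_one_of_mem_wordSet`); dyadic approximation, together with the convexity of
`s ↦ τ (b ^ s)`, gives real exponents (`NFSTrace.norm_tr_mul_rpow_le`). Cutting off `|x|` near `0`
and testing against powers of the cut-off operator gives the converse
(`NFSTrace.lpNorm_le_of_dualBound`), and normality of `τ` makes the `p`-norms lower semicontinuous
for the operator norm (`NFSTrace.lpNorm_le_of_tendsto`), which removes the cut-off.

The power series of `f` comes from Cauchy's formula on the torus of any radius `R < 1 + ε`; the
coefficients do not depend on `R` because a power series vanishing near `0` is zero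
(`exists_hasPowerSeriesOnPolydisc`).
-/

open Filter

noncomputable section

variable {H : Type*} [NormedAddCommGroup H] [InnerProductSpace ℂ H] [CompleteSpace H]

/-! ### Functional calculus inside a von Neumann algebra -/

namespace VonNeumannAlgebra

variable {M : VonNeumannAlgebra H} {x : H →L[ℂ] H}

lemma cfc_mem (hx : x ∈ M) (f : ℝ → ℝ) : cfc f x ∈ M := by
  rw [← M.commutant_commutant, mem_commutant_iff]
  intro g hg
  exact (Commute.cfc_real (show Commute x g from mem_commutant_iff.1 hg x hx) f).symm.eq

lemma rpow_mem (hx : x ∈ M) (h0 : 0 ≤ x) (s : ℝ) : x ^ s ∈ M := by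
  rw [CFC.rpow_eq_cfc_real h0]
  exact cfc_mem hx _

lemma abs_mem (hx : x ∈ M) : CFC.abs x ∈ M := by
  rw [CFC.abs, CFC.sqrt_eq_rpow]
  exact rpow_mem (mul_mem (star_mem hx) hx) (star_mul_self_nonneg x) _

lemma smul_mem (c : ℂ) (hx : x ∈ M) : c • x ∈ M :=
  M.toStarSubalgebra.smul_mem hx c

lemma real_smul_mem (c : ℝ) (hx : x ∈ M) : c • x ∈ M := by
  have := smul_mem (c : ℂ) hx
  simpa using this

lemma isClosed (M : VonNeumannAlgebra H) : IsClosed (M : Set (H →L[ℂ] H)) := by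
  rw [← M.centralizer_centralizer]
  exact Set.isClosed_centralizer _

end VonNeumannAlgebra

/-- The spectrum of a positive operator lies in `[0, ‖x‖]`. -/
lemma mem_Icc_of_mem_spectrum {x : H →L[ℂ] H} (hx : 0 ≤ x) {t : ℝ} (ht : t ∈ spectrum ℝ x) :
    t ∈ Set.Icc 0 ‖x‖ := by
  have h0 := spectrum_nonneg_of_nonneg hx ht
  refine ⟨h0, ?_⟩
  have := spectrum.norm_le_norm_mul_of_mem ht
  have h1 : ‖(1 : H →L[ℂ] H)‖ ≤ 1 := ContinuousLinearMap.norm_id_le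
  calc t ≤ ‖t‖ := le_abs_self t
    _ ≤ ‖x‖ * ‖(1 : H →L[ℂ] H)‖ := this
    _ ≤ ‖x‖ * 1 := by gcongr
    _ = ‖x‖ := mul_one _

lemma continuousOn_rpow_const_nonneg {s : ℝ} (hs : 0 ≤ s) (S : Set ℝ) :
    ContinuousOn (fun t : ℝ => t ^ s) S :=
  (Real.continuous_rpow_const hs).continuousOn

lemma star_mul_self_mul_le {a x : H →L[ℂ] H} {C : ℝ} (ha : ‖a‖ ≤ C) :
    star (a * x) * (a * x) ≤ (C ^ 2) • (star x * x) := by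
  have h1 : star a * a ≤ algebraMap ℝ (H →L[ℂ] H) (C ^ 2) := by
    refine (CStarAlgebra.star_mul_le_algebraMap_norm_sq).trans ?_
    rw [Algebra.algebraMap_eq_smul_one, Algebra.algebraMap_eq_smul_one]
    exact smul_le_smul_of_nonneg_right (by gcongr) zero_le_one
  have h2 := star_left_conjugate_le_conjugate h1 x
  rw [star_mul, Algebra.algebraMap_eq_smul_one] at *
  calc star x * star a * (a * x) = star x * (star a * a) * x := by noncomm_ring
    _ ≤ _ := h2
    _ = _ := by simp

lemma rpow_add_of_nonneg {b : H →L[ℂ] H} (hb : 0 ≤ b) {s t : ℝ} (hs : 0 ≤ s) (ht : 0 ≤ t) :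
    b ^ s * b ^ t = b ^ (s + t) := by
  rw [CFC.rpow_eq_cfc_real hb, CFC.rpow_eq_cfc_real hb, CFC.rpow_eq_cfc_real hb,
    ← cfc_mul _ _ b (continuousOn_rpow_const_nonneg hs _) (continuousOn_rpow_const_nonneg ht _)]
  refine cfc_congr fun u hu => ?_
  exact (Real.rpow_add_of_nonneg (mem_Icc_of_mem_spectrum hb hu).1 hs ht).symm

lemma norm_cfc_le_of_nonneg {x : H →L[ℂ] H} (hx : 0 ≤ x) {f : ℝ → ℝ} {C : ℝ} (hC : 0 ≤ C)
    (hf : ∀ t, 0 ≤ t → t ≤ ‖x‖ → |f t| ≤ C) : ‖cfc f x‖ ≤ C :=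
  norm_cfc_le hC fun t ht =>
    hf t (mem_Icc_of_mem_spectrum hx ht).1 (mem_Icc_of_mem_spectrum hx ht).2

/-! ### Elementary properties of the trace -/

namespace NFSTrace

variable {M : VonNeumannAlgebra H} (τ : NFSTrace M) {x y : H →L[ℂ] H}

lemma toFun_zero : τ.toFun 0 = 0 := by
  have := τ.map_smul 0 le_rfl 0 (zero_mem M) le_rfl
  simpa using this

lemma toFun_mono (hx : x ∈ M) (hy : y ∈ M) (h0 : 0 ≤ x) (h : x ≤ y) :
    τ.toFun x ≤ τ.toFun y := by
  have := τ.map_add x hx (y - x) (sub_mem hy hx) h0 (sub_nonneg.2 h)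
  rw [add_sub_cancel] at this
  rw [this]
  exact le_self_add

lemma toFun_le_of_le_smul (hx : x ∈ M) (hy : y ∈ M) (h0 : 0 ≤ x) (hy0 : 0 ≤ y) {C : ℝ}
    (hC : 0 ≤ C) (h : x ≤ C • y) : τ.toFun x ≤ ENNReal.ofReal C * τ.toFun y := by
  rw [← τ.map_smul C hC y hy hy0]
  exact τ.toFun_mono hx (VonNeumannAlgebra.real_smul_mem C hy) h0 h

lemma toFun_sum {ι : Type*} (s : Finset ι) (a : ι → H →L[ℂ] H) (ha : ∀ i ∈ s, a i ∈ M)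
    (h0 : ∀ i ∈ s, 0 ≤ a i) : τ.toFun (∑ i ∈ s, a i) = ∑ i ∈ s, τ.toFun (a i) := by
  classical
  induction s using Finset.induction_on with
  | empty => simp [τ.toFun_zero]
  | insert i s hi ih =>
    rw [Finset.sum_insert hi, Finset.sum_insert hi, τ.map_add _ (ha _ (by simp)) _
      (sum_mem fun j hj => ha j (by simp [hj])) (h0 _ (by simp))
      (Finset.sum_nonneg fun j hj => h0 j (by simp [hj])),
      ih (fun j hj => ha j (by simp [hj])) (fun j hj => h0 j (by simp [hj]))]

lemma toFun_cfc_mono (hx : x ∈ M) (hx0 : 0 ≤ x) {f g : ℝ → ℝ} (hf : Continuous f)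
    (hg : Continuous g) (h0 : ∀ t, 0 ≤ t → t ≤ ‖x‖ → 0 ≤ f t)
    (h : ∀ t, 0 ≤ t → t ≤ ‖x‖ → f t ≤ g t) :
    τ.toFun (cfc f x) ≤ τ.toFun (cfc g x) := by
  refine τ.toFun_mono (VonNeumannAlgebra.cfc_mem hx f) (VonNeumannAlgebra.cfc_mem hx g)
    (cfc_nonneg fun t ht => ?_) (cfc_mono (fun t ht => ?_) hf.continuousOn hg.continuousOn)
  · exact h0 t (mem_Icc_of_mem_spectrum hx0 ht).1 (mem_Icc_of_mem_spectrum hx0 ht).2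
  · exact h t (mem_Icc_of_mem_spectrum hx0 ht).1 (mem_Icc_of_mem_spectrum hx0 ht).2

lemma toFun_const_mul_cfc (hx : x ∈ M) {g : ℝ → ℝ} (hg : Continuous g)
    {C : ℝ} (hC : 0 ≤ C) (h0 : 0 ≤ cfc g x) :
    τ.toFun (cfc (fun t => C * g t) x) = ENNReal.ofReal C * τ.toFun (cfc g x) := by
  rw [← τ.map_smul C hC _ (VonNeumannAlgebra.cfc_mem hx g) h0, cfc_const_mul _ _ _ hg.continuousOn]

/-! ### The linear extension of the trace -/

/-- The trace extends to a linear functional: there is a functional, defined on all operators for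
convenience, which takes the value `τ a` at every positive `a` of finite trace. -/
lemma exists_linear_extension :
    ∃ ℓ : (H →L[ℂ] H) →ₗ[ℂ] ℂ, ∀ a ∈ M, 0 ≤ a → τ.toFun a < ∞ → ℓ a = ((τ.toFun a).toReal : ℂ) := by
  classical
  let P := {a : H →L[ℂ] H // a ∈ M ∧ 0 ≤ a ∧ τ.toFun a < ∞}
  let ev : (P →₀ ℂ) →ₗ[ℂ] (H →L[ℂ] H) := Finsupp.linearCombination ℂ (fun a : P => a.1)
  let g : (P →₀ ℂ) →ₗ[ℂ] ℂ :=
    Finsupp.linearCombination ℂ (fun a : P => ((τ.toFun a.1).toReal : ℂ))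
  -- A real relation between positive elements gives the same relation between their traces:
  -- move the negative coefficients to the other side and use additivity on the cone.
  have key : ∀ (s : Finset P) (r : P → ℝ), ∑ a ∈ s, r a • a.1 = 0 →
      ∑ a ∈ s, r a * (τ.toFun a.1).toReal = 0 := by
    intro s r h
    have h1 : ∑ a ∈ s, (max (r a) 0) • a.1 = ∑ a ∈ s, (max (-r a) 0) • a.1 := by
      rw [← sub_eq_zero, ← Finset.sum_sub_distrib]
      refine Eq.trans ?_ h
      refine Finset.sum_congr rfl fun a _ => ?_
      rw [← sub_smul, max_zero_sub_max_neg_zero_eq_self]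
    have h2 : ∀ q : P → ℝ, (∀ a, 0 ≤ q a) → (τ.toFun (∑ a ∈ s, q a • a.1)).toReal =
        ∑ a ∈ s, q a * (τ.toFun a.1).toReal := by
      intro q hq
      rw [τ.toFun_sum s _ (fun a _ => VonNeumannAlgebra.real_smul_mem _ a.2.1)
        (fun a _ => smul_nonneg (hq a) a.2.2.1), ENNReal.toReal_sum]
      · refine Finset.sum_congr rfl fun a _ => ?_
        rw [τ.map_smul _ (hq a) _ a.2.1 a.2.2.1, ENNReal.toReal_mul, ENNReal.toReal_ofReal (hq a)]
      · intro a _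
        rw [τ.map_smul _ (hq a) _ a.2.1 a.2.2.1]
        exact ENNReal.mul_ne_top ENNReal.ofReal_ne_top a.2.2.2.ne
    have h3 := congrArg (fun z => (τ.toFun z).toReal) h1
    rw [h2 _ fun a => le_max_right _ _, h2 _ fun a => le_max_right _ _, ← sub_eq_zero,
      ← Finset.sum_sub_distrib] at h3
    rw [← h3]
    refine Finset.sum_congr rfl fun a _ => ?_
    rw [← sub_mul, max_zero_sub_max_neg_zero_eq_self]
  have hker : g ∈ (LinearMap.ker ev).dualAnnihilator := by
    rw [Submodule.mem_dualAnnihilator]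
    intro w hw
    rw [LinearMap.mem_ker] at hw
    have hw' : ∑ a ∈ w.support, w a • a.1 = 0 := by
      simpa [ev, Finsupp.linearCombination_apply, Finsupp.sum] using hw
    have hstar : ∑ a ∈ w.support, (starRingEnd ℂ (w a)) • a.1 = 0 := by
      have := congrArg star hw'
      rw [star_sum, star_zero] at this
      refine Eq.trans ?_ this
      refine Finset.sum_congr rfl fun a _ => ?_
      rw [star_smul, (IsSelfAdjoint.of_nonneg a.2.2.1).star_eq]
      rfl
    have hre : ∑ a ∈ w.support, (w a).re • a.1 = 0 := by
      have h4 : ∑ a ∈ w.support, ((2 : ℂ)⁻¹ * (w a + starRingEnd ℂ (w a))) • a.1 = 0 := by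
        simp_rw [mul_smul, add_smul]
        rw [← Finset.smul_sum, Finset.sum_add_distrib, hw', hstar]
        simp
      refine Eq.trans ?_ h4
      refine Finset.sum_congr rfl fun a _ => ?_
      rw [Complex.add_conj]
      have : (2 : ℂ)⁻¹ * ((2 * (w a).re : ℝ) : ℂ) = ((w a).re : ℂ) := by push_cast; ring
      rw [this]
      simp
    have him : ∑ a ∈ w.support, (w a).im • a.1 = 0 := by
      have h4 : ∑ a ∈ w.support,
          ((2 * Complex.I : ℂ)⁻¹ * (w a - starRingEnd ℂ (w a))) • a.1 = 0 := by
        simp_rw [mul_smul, sub_smul]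
        rw [← Finset.smul_sum, Finset.sum_sub_distrib, hw', hstar]
        simp
      refine Eq.trans ?_ h4
      refine Finset.sum_congr rfl fun a _ => ?_
      rw [Complex.sub_conj]
      have : (2 * Complex.I : ℂ)⁻¹ * (((2 * (w a).im : ℝ) : ℂ) * Complex.I) = ((w a).im : ℂ) := by
        push_cast
        field_simp
      rw [this]
      simp
    have h5 := key _ _ hre
    have h6 := key _ _ him
    have : g w = ((∑ a ∈ w.support, (w a).re * (τ.toFun a.1).toReal : ℝ) : ℂ) +
        ((∑ a ∈ w.support, (w a).im * (τ.toFun a.1).toReal : ℝ) : ℂ) * Complex.I := by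
      simp only [g, Finsupp.linearCombination_apply, Finsupp.sum]
      push_cast
      rw [Finset.sum_mul, ← Finset.sum_add_distrib]
      refine Finset.sum_congr rfl fun a _ => ?_
      rw [smul_eq_mul]
      conv_lhs => rw [← Complex.re_add_im (w a)]
      ring
    rw [this, h5, h6]
    simp
  rw [← LinearMap.range_dualMap_eq_dualAnnihilator_ker] at hker
  obtain ⟨ℓ, hℓ⟩ := hker
  refine ⟨ℓ, fun a ha h0 hfin => ?_⟩
  have := LinearMap.congr_fun hℓ (Finsupp.single (⟨a, ha, h0, hfin⟩ : P) 1)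
  simpa [ev, g] using this

/-- A linear functional extending the trace. Its values matter only on the span of the positive
elements of finite trace. -/
def tr : (H →L[ℂ] H) →ₗ[ℂ] ℂ := τ.exists_linear_extension.choose

lemma tr_eq (hx : x ∈ M) (h0 : 0 ≤ x) (hfin : τ.toFun x < ∞) :
    τ.tr x = ((τ.toFun x).toReal : ℂ) :=
  τ.exists_linear_extension.choose_spec x hx h0 hfin

end NFSTrace

namespace NFSTrace

variable {M : VonNeumannAlgebra H} (τ : NFSTrace M) {x y : H →L[ℂ] H}

/-! ### The Hilbert–Schmidt ideal -/

/-- The two-sided ideal of those `x` in `M` with `τ (x* x) < ∞`. -/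
def HS (x : H →L[ℂ] H) : Prop := x ∈ M ∧ τ.toFun (star x * x) < ∞

variable {τ}

lemma HS.star (hx : τ.HS x) : τ.HS (star x) :=
  ⟨star_mem hx.1, by rw [star_star, ← τ.tracial x hx.1]; exact hx.2⟩

lemma toFun_star_mul_self_mul_le {a : H →L[ℂ] H} (ha : a ∈ M) (hx : x ∈ M) {C : ℝ}
    (hC : ‖a‖ ≤ C) : τ.toFun (Star.star (a * x) * (a * x)) ≤
      ENNReal.ofReal (C ^ 2) * τ.toFun (Star.star x * x) :=
  τ.toFun_le_of_le_smul (mul_mem (star_mem (mul_mem ha hx)) (mul_mem ha hx))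
    (mul_mem (star_mem hx) hx) (star_mul_self_nonneg _) (star_mul_self_nonneg _) (sq_nonneg C)
    (star_mul_self_mul_le hC)

lemma HS.mul_left {a : H →L[ℂ] H} (ha : a ∈ M) (hx : τ.HS x) : τ.HS (a * x) :=
  ⟨mul_mem ha hx.1, (toFun_star_mul_self_mul_le ha hx.1 le_rfl).trans_lt
    (ENNReal.mul_lt_top ENNReal.ofReal_lt_top hx.2)⟩

lemma HS.mul_right {a : H →L[ℂ] H} (ha : a ∈ M) (hx : τ.HS x) : τ.HS (x * a) := by
  have := (hx.star.mul_left (star_mem ha)).star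
  simpa using this

lemma toFun_star_mul_self_add_le (hx : x ∈ M) (hy : y ∈ M) :
    τ.toFun (Star.star (x + y) * (x + y)) ≤
      2 * (τ.toFun (Star.star x * x) + τ.toFun (Star.star y * y)) := by
  have hxx := mul_mem (star_mem hx) hx
  have hyy := mul_mem (star_mem hy) hy
  have h := τ.toFun_le_of_le_smul (mul_mem (star_mem (add_mem hx hy)) (add_mem hx hy))
    (add_mem hxx hyy) (star_mul_self_nonneg _)
    (add_nonneg (star_mul_self_nonneg x) (star_mul_self_nonneg y)) (C := 2) (by norm_num) (by
      -- the parallelogram law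
      have h1 : (2 : ℝ) • (Star.star x * x + Star.star y * y) - Star.star (x + y) * (x + y) =
          Star.star (x - y) * (x - y) := by
        rw [two_smul, star_add, star_sub]; noncomm_ring
      rw [← sub_nonneg, h1]
      exact star_mul_self_nonneg _)
  rw [τ.map_add _ hxx _ hyy (star_mul_self_nonneg x) (star_mul_self_nonneg y)] at h
  simpa using h

lemma HS.add (hx : τ.HS x) (hy : τ.HS y) : τ.HS (x + y) :=
  ⟨add_mem hx.1 hy.1, (toFun_star_mul_self_add_le hx.1 hy.1).trans_lt
    (ENNReal.mul_lt_top (by simp) (ENNReal.add_lt_top.2 ⟨hx.2, hy.2⟩))⟩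

lemma HS.smul (c : ℂ) (hx : τ.HS x) : τ.HS (c • x) := by
  have := hx.mul_left (VonNeumannAlgebra.smul_mem c (one_mem M))
  simpa using this

lemma HS.sub (hx : τ.HS x) (hy : τ.HS y) : τ.HS (x - y) := by
  have := hx.add (hy.smul (-1))
  simpa [sub_eq_add_neg] using this

lemma HS.tr_star_mul_self (hx : τ.HS x) :
    τ.tr (Star.star x * x) = ((τ.toFun (Star.star x * x)).toReal : ℂ) :=
  τ.tr_eq (mul_mem (star_mem hx.1) hx.1) (star_mul_self_nonneg x) hx.2

lemma HS.tr_mul_star_self (hx : τ.HS x) :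
    τ.tr (x * Star.star x) = ((τ.toFun (Star.star x * x)).toReal : ℂ) := by
  have := hx.star.tr_star_mul_self
  rwa [star_star, ← τ.tracial x hx.1] at this

/-- Polarization of the trace of `y* x`. -/
lemma HS.four_mul_tr_star_mul (hx : τ.HS x) (hy : τ.HS y) :
    4 * τ.tr (Star.star y * x) =
      (τ.toFun (Star.star (x + y) * (x + y))).toReal -
      (τ.toFun (Star.star (x - y) * (x - y))).toReal +
      Complex.I * (τ.toFun (Star.star (x + Complex.I • y) * (x + Complex.I • y))).toReal -
      Complex.I * (τ.toFun (Star.star (x - Complex.I • y) * (x - Complex.I • y))).toReal := by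
  rw [← (hx.add hy).tr_star_mul_self, ← (hx.sub hy).tr_star_mul_self,
    ← (hx.add (hy.smul Complex.I)).tr_star_mul_self,
    ← (hx.sub (hy.smul Complex.I)).tr_star_mul_self]
  have key : (4 : ℂ) • (Star.star y * x) = Star.star (x + y) * (x + y) - Star.star (x - y) * (x - y) +
      Complex.I • (Star.star (x + Complex.I • y) * (x + Complex.I • y)) -
      Complex.I • (Star.star (x - Complex.I • y) * (x - Complex.I • y)) := by
    simp only [star_add, star_sub, star_smul, Complex.star_def, Complex.conj_I, add_mul, mul_add,
      sub_mul, mul_sub, smul_mul_assoc, mul_smul_comm, smul_add, smul_sub, smul_smul, neg_smul,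
      smul_neg, neg_mul, Complex.I_mul_I, one_smul]
    module
  have := congrArg τ.tr key
  simpa only [_root_.map_add, map_sub, _root_.map_smul, smul_eq_mul] using this

lemma HS.four_mul_tr_mul_star (hx : τ.HS x) (hy : τ.HS y) :
    4 * τ.tr (x * Star.star y) =
      (τ.toFun (Star.star (x + y) * (x + y))).toReal -
      (τ.toFun (Star.star (x - y) * (x - y))).toReal +
      Complex.I * (τ.toFun (Star.star (x + Complex.I • y) * (x + Complex.I • y))).toReal -
      Complex.I * (τ.toFun (Star.star (x - Complex.I • y) * (x - Complex.I • y))).toReal := by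
  rw [← (hx.add hy).tr_mul_star_self, ← (hx.sub hy).tr_mul_star_self,
    ← (hx.add (hy.smul Complex.I)).tr_mul_star_self,
    ← (hx.sub (hy.smul Complex.I)).tr_mul_star_self]
  have key : (4 : ℂ) • (x * Star.star y) = (x + y) * Star.star (x + y) - (x - y) * Star.star (x - y) +
      Complex.I • ((x + Complex.I • y) * Star.star (x + Complex.I • y)) -
      Complex.I • ((x - Complex.I • y) * Star.star (x - Complex.I • y)) := by
    simp only [star_add, star_sub, star_smul, Complex.star_def, Complex.conj_I, add_mul, mul_add,
      sub_mul, mul_sub, smul_mul_assoc, mul_smul_comm, smul_add, smul_sub, smul_smul, neg_smul,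
      smul_neg, mul_neg, Complex.I_mul_I, one_smul]
    module
  have := congrArg τ.tr key
  simpa only [_root_.map_add, map_sub, _root_.map_smul, smul_eq_mul] using this

lemma HS.tr_mul_comm (hx : τ.HS x) (hy : τ.HS y) : τ.tr (x * y) = τ.tr (y * x) := by
  have h1 := hy.four_mul_tr_star_mul hx.star
  rw [← hy.four_mul_tr_mul_star hx.star, star_star] at h1
  exact mul_left_cancel₀ (by norm_num) h1

/-- The Cauchy–Schwarz inequality, in normalized form. -/
lemma HS.norm_tr_star_mul_le_one (hx : τ.HS x) (hy : τ.HS y)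
    (hx1 : τ.toFun (Star.star x * x) ≤ 1) (hy1 : τ.toFun (Star.star y * y) ≤ 1) :
    ‖τ.tr (Star.star y * x)‖ ≤ 1 := by
  set w := τ.tr (Star.star y * x) with hw
  obtain ⟨c, hc, hcw⟩ : ∃ c : ℂ, ‖c‖ = 1 ∧ c * w = ‖w‖ := by
    by_cases h0 : w = 0
    · exact ⟨1, by simp, by simp [h0]⟩
    · refine ⟨(‖w‖ : ℂ) / w, by simp [h0], by field_simp⟩
  have hcx := hx.smul c
  have hcx1 : τ.toFun (Star.star (c • x) * (c • x)) ≤ 1 := by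
    rw [star_smul, smul_mul_smul_comm, Complex.star_def, ← Complex.normSq_eq_conj_mul_self,
      Complex.normSq_eq_norm_sq, hc]
    simpa using hx1
  have h4 := hcx.four_mul_tr_star_mul hy
  rw [mul_smul_comm, _root_.map_smul, ← hw, smul_eq_mul, hcw] at h4
  have hre := congrArg Complex.re h4
  simp only [Complex.mul_re, Complex.sub_re, Complex.add_re, Complex.ofReal_re, Complex.ofReal_im,
    Complex.I_re, Complex.I_im, Complex.re_ofNat, Complex.im_ofNat] at hre
  have h5 : (τ.toFun (Star.star (c • x + y) * (c • x + y))).toReal ≤ 4 := by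
    refine ENNReal.toReal_le_of_le_ofReal (by norm_num) ?_
    refine (toFun_star_mul_self_add_le hcx.1 hy.1).trans ?_
    calc _ ≤ (2 : ℝ≥0∞) * (1 + 1) := by gcongr
      _ = ENNReal.ofReal 4 := by
        rw [show (4 : ℝ) = 2 * (1 + 1) by norm_num]; norm_num
  have h6 : 0 ≤ (τ.toFun (Star.star (c • x - y) * (c • x - y))).toReal := ENNReal.toReal_nonneg
  nlinarith

lemma HS.norm_tr_mul_le_one (hx : τ.HS x) (hy : τ.HS y)
    (hx1 : τ.toFun (Star.star x * x) ≤ 1) (hy1 : τ.toFun (Star.star y * y) ≤ 1) :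
    ‖τ.tr (x * y)‖ ≤ 1 := by
  have := hy.norm_tr_star_mul_le_one hx.star hy1 (by rwa [star_star, ← τ.tracial x hx.1])
  rwa [star_star] at this

end NFSTrace

/-! ### Words in bounded operators and letters of a given set -/

/-- The products `a₀ s₁ a₁ s₂ ⋯ s_k a_k` with contractions `a_i` in `M` and exactly `k` factors
`s_i` from `S`. -/
def wordSet (M : VonNeumannAlgebra H) (S : Set (H →L[ℂ] H)) : ℕ → Set (H →L[ℂ] H)
  | 0 => {a | a ∈ M ∧ ‖a‖ ≤ 1}
  | k + 1 => {x | ∃ w ∈ wordSet M S k, ∃ s ∈ S, ∃ a ∈ M, ‖a‖ ≤ 1 ∧ x = w * s * a}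

section wordSet

variable {M : VonNeumannAlgebra H} {S S' : Set (H →L[ℂ] H)} {x y : H →L[ℂ] H}

lemma norm_one_le_one {H : Type*} [NormedAddCommGroup H] [InnerProductSpace ℂ H] :
    ‖(1 : H →L[ℂ] H)‖ ≤ 1 := ContinuousLinearMap.norm_id_le

lemma norm_mul_le_one (hx : ‖x‖ ≤ 1) (hy : ‖y‖ ≤ 1) : ‖x * y‖ ≤ 1 :=
  (norm_mul_le x y).trans (mul_le_one₀ hx (norm_nonneg _) hy)

lemma mul_contraction_mem_wordSet {k : ℕ} (hx : x ∈ wordSet M S k) {a : H →L[ℂ] H} (ha : a ∈ M)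
    (ha1 : ‖a‖ ≤ 1) : x * a ∈ wordSet M S k := by
  cases k with
  | zero => exact ⟨mul_mem hx.1 ha, norm_mul_le_one hx.2 ha1⟩
  | succ k =>
    obtain ⟨w, hw, s, hs, b, hb, hb1, rfl⟩ := hx
    exact ⟨w, hw, s, hs, b * a, mul_mem hb ha, norm_mul_le_one hb1 ha1, by rw [mul_assoc]⟩

lemma mul_mem_wordSet {j k : ℕ} (hx : x ∈ wordSet M S j) (hy : y ∈ wordSet M S k) :
    x * y ∈ wordSet M S (j + k) := by
  induction k generalizing y with
  | zero => exact mul_contraction_mem_wordSet hx hy.1 hy.2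
  | succ k ih =>
    obtain ⟨w, hw, s, hs, a, ha, ha1, rfl⟩ := hy
    exact ⟨x * w, ih hw, s, hs, a, ha, ha1, by simp only [mul_assoc]⟩

lemma contraction_mem_wordSet (hx : x ∈ M) (h1 : ‖x‖ ≤ 1) : x ∈ wordSet M S 0 := ⟨hx, h1⟩

lemma mem_wordSet_one (hx : x ∈ S) : x ∈ wordSet M S 1 :=
  ⟨1, ⟨one_mem M, norm_one_le_one⟩, x, hx, 1, one_mem M, norm_one_le_one, by simp⟩

lemma pow_mem_wordSet {k : ℕ} (hx : x ∈ wordSet M S k) (n : ℕ) : x ^ n ∈ wordSet M S (n * k) := by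
  induction n with
  | zero => simpa using contraction_mem_wordSet (one_mem M) norm_one_le_one
  | succ n ih =>
    rw [pow_succ, add_mul, one_mul]
    exact mul_mem_wordSet ih hx

lemma wordSet_two_mul_subset (h : ∀ s ∈ S, ∀ a ∈ M, ‖a‖ ≤ 1 → ∀ t ∈ S, s * a * t ∈ S') (k : ℕ) :
    wordSet M S (2 * k) ⊆ wordSet M S' k := by
  induction k with
  | zero => exact fun x hx => hx
  | succ k ih =>
    rintro x ⟨w, ⟨w', hw', s, hs, a, ha, ha1, rfl⟩, t, ht, b, hb, hb1, rfl⟩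
    exact ⟨w', ih hw', s * a * t, h s hs a ha ha1 t ht, b, hb, hb1, by simp only [mul_assoc]⟩

end wordSet

namespace NFSTrace

variable {M : VonNeumannAlgebra H} {τ : NFSTrace M} {x y : H →L[ℂ] H}

/-! ### Hölder's inequality for the trace of a product of `2 ^ k` factors -/

lemma HS.toFun_star_mul_mul_lt_top (hx : τ.HS x) {p : H →L[ℂ] H} (hp : p ∈ M) (hp0 : 0 ≤ p) :
    τ.toFun (Star.star x * p * x) < ∞ := by
  have h1 : p ≤ ‖p‖ • (1 : H →L[ℂ] H) := by
    rw [← Algebra.algebraMap_eq_smul_one]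
    exact (IsSelfAdjoint.of_nonneg hp0).le_algebraMap_norm_self
  have h2 := star_left_conjugate_le_conjugate h1 x
  rw [mul_smul_comm, smul_mul_assoc, mul_one] at h2
  exact (τ.toFun_le_of_le_smul (mul_mem (mul_mem (star_mem hx.1) hp) hx.1)
    (mul_mem (star_mem hx.1) hx.1) (star_left_conjugate_nonneg hp0 x) (star_mul_self_nonneg x)
    (norm_nonneg p) h2).trans_lt (ENNReal.mul_lt_top ENNReal.ofReal_lt_top hx.2)

lemma star_mul_mul_pow_succ (z t : H →L[ℂ] H) (n : ℕ) :
    (star t * z * t) ^ (n + 1) = star t * ((z * (t * star t)) ^ n * z * t) := by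
  induction n with
  | zero => simp [mul_assoc]
  | succ n ih =>
    rw [pow_succ, ih, pow_succ (z * (t * star t)) n]
    simp only [mul_assoc]

lemma HS.tr_star_mul_mul_pow (ht : τ.HS x) {z : H →L[ℂ] H} (hz : z ∈ M) {n : ℕ} (hn : n ≠ 0) :
    τ.tr ((Star.star x * z * x) ^ n) = τ.tr ((z * (x * Star.star x)) ^ n) := by
  obtain ⟨n, rfl⟩ := Nat.exists_eq_succ_of_ne_zero hn
  have hm : (z * (x * Star.star x)) ^ n * z ∈ M :=
    mul_mem (pow_mem (mul_mem hz (mul_mem ht.1 (star_mem ht.1))) n) hz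
  rw [Nat.succ_eq_add_one, star_mul_mul_pow_succ, ht.star.tr_mul_comm (ht.mul_left hm), pow_succ]
  simp only [mul_assoc]

lemma HS.toFun_star_mul_mul_pow_lt_top (ht : τ.HS x) {z : H →L[ℂ] H} (hz : z ∈ M) (hz0 : 0 ≤ z)
    {n : ℕ} (hn : n ≠ 0) : τ.toFun ((Star.star x * z * x) ^ n) < ∞ := by
  obtain ⟨n, rfl⟩ := Nat.exists_eq_succ_of_ne_zero hn
  have hm : (z * (x * Star.star x)) ^ n * z ∈ M :=
    mul_mem (pow_mem (mul_mem hz (mul_mem ht.1 (star_mem ht.1))) n) hz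
  -- with `s = z^(1/2)`, the middle factor is `s (s x x* s)^n s`, which is positive
  have h0 : 0 ≤ (z * (x * Star.star x)) ^ n * z := by
    set s := CFC.sqrt z
    have hs : s * s = z := CFC.sqrt_mul_sqrt_self z
    have hss : Star.star s = s := (IsSelfAdjoint.of_nonneg (CFC.sqrt_nonneg z)).star_eq
    have h1 : (z * (x * Star.star x)) ^ n * z = s * (s * (x * Star.star x) * s) ^ n * s := by
      have : ∀ n : ℕ, (z * (x * Star.star x)) ^ n * s = s * (s * (x * Star.star x) * s) ^ n := by
        intro n
        induction n with
        | zero => simp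
        | succ n ih =>
          rw [pow_succ', mul_assoc, ih, pow_succ', ← hs]
          simp only [mul_assoc]
      rw [← this, mul_assoc, hs]
    rw [h1]
    have h2 : 0 ≤ s * (x * Star.star x) * s := by
      have := star_left_conjugate_nonneg (mul_star_self_nonneg x) s
      rwa [hss] at this
    have h3 := star_left_conjugate_nonneg (CStarAlgebra.pow_nonneg h2 n) s
    rwa [hss] at h3
  rw [Nat.succ_eq_add_one, star_mul_mul_pow_succ, ← mul_assoc]
  exact ht.toFun_star_mul_mul_lt_top hm h0

/-- The letters of level `k`: the Hilbert–Schmidt operators `β` with `τ (|β| ^ 2 ^ (k + 1)) ≤ 1`. -/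
def letters (τ : NFSTrace M) (k : ℕ) : Set (H →L[ℂ] H) :=
  {β | τ.HS β ∧ τ.toFun ((Star.star β * β) ^ 2 ^ k) ≤ 1}

lemma HS.toFun_mul_star_pow (hx : τ.HS x) {n : ℕ} (hn : n ≠ 0) :
    τ.toFun ((x * Star.star x) ^ n) = τ.toFun ((Star.star x * x) ^ n) := by
  have h1 := hx.toFun_star_mul_mul_pow_lt_top (one_mem M) zero_le_one hn
  have h2 := hx.star.toFun_star_mul_mul_pow_lt_top (one_mem M) zero_le_one hn
  have h3 := hx.tr_star_mul_mul_pow (one_mem M) hn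
  simp only [mul_one, one_mul, star_star] at h1 h2 h3
  rw [τ.tr_eq (pow_mem (mul_mem (star_mem hx.1) hx.1) n)
    (CStarAlgebra.pow_nonneg (star_mul_self_nonneg x) n) h1,
    τ.tr_eq (pow_mem (mul_mem hx.1 (star_mem hx.1)) n)
    (CStarAlgebra.pow_nonneg (mul_star_self_nonneg x) n) h2] at h3
  exact ((ENNReal.toReal_eq_toReal_iff' h1.ne h2.ne).1 (by exact_mod_cast h3)).symm

lemma star_mul_self_mem_letters {k : ℕ} (hx : x ∈ τ.letters (k + 1)) :
    Star.star x * x ∈ τ.letters k := by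
  refine ⟨hx.1.mul_left (star_mem hx.1.1), ?_⟩
  rw [star_mul, star_star, ← sq, ← pow_mul, ← pow_succ']
  exact hx.2

lemma mul_star_self_mem_letters {k : ℕ} (hx : x ∈ τ.letters (k + 1)) :
    x * Star.star x ∈ τ.letters k := by
  refine ⟨hx.1.mul_right (star_mem hx.1.1), ?_⟩
  rw [star_mul, star_star, ← sq, ← pow_mul, ← pow_succ', hx.1.toFun_mul_star_pow (by positivity)]
  exact hx.2

/-- Hölder's inequality with `2 ^ (k + 1)` equal exponents. In the inductive step neighbouring
letters are paired; the pair `s a t` is a letter of the lower level because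
`τ (|s a t| ^ 2 ^ (k + 1))` is the trace of the word `(a* (s* s) a (t t*)) ^ 2 ^ k`. -/
theorem norm_tr_le_one_of_mem_wordSet (k : ℕ) {x : H →L[ℂ] H}
    (hx : x ∈ wordSet M (τ.letters k) (2 ^ (k + 1))) : ‖τ.tr x‖ ≤ 1 := by
  induction k generalizing x with
  | zero =>
    obtain ⟨w, ⟨w₀, hw₀, s, hs, a, ha, ha1, rfl⟩, t, ht, b, hb, hb1, rfl⟩ := hx
    have hcontr : ∀ {c z : H →L[ℂ] H}, c ∈ M → ‖c‖ ≤ 1 → z ∈ M →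
        τ.toFun (Star.star z * z) ≤ 1 → τ.toFun (Star.star (c * z) * (c * z)) ≤ 1 := by
      intro c z hc hc1 hz hz1
      refine (toFun_star_mul_self_mul_le hc hz hc1).trans ?_
      simpa using hz1
    have hs2 : τ.toFun (Star.star s * s) ≤ 1 := by simpa using hs.2
    have ht2 : τ.toFun (Star.star t * t) ≤ 1 := by simpa using ht.2
    have htb : τ.toFun (Star.star (t * b) * (t * b)) ≤ 1 := by
      have h1 := hcontr (star_mem hb) (by rwa [norm_star]) (star_mem ht.1.1)
        (by rwa [star_star, ← τ.tracial t ht.1.1])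
      rw [← star_mul, star_star, ← τ.tracial _ (mul_mem ht.1.1 hb)] at h1
      exact h1
    have h2 : w₀ * s * a * t * b = (w₀ * s) * (a * (t * b)) := by simp only [mul_assoc]
    rw [h2]
    exact (hs.1.mul_left hw₀.1).norm_tr_mul_le_one ((ht.1.mul_right hb).mul_left ha)
      (hcontr hw₀.1 hw₀.2 hs.1.1 hs2) (hcontr ha ha1 (mul_mem ht.1.1 hb) htb)
  | succ k ih =>
    rw [pow_succ'] at hx
    refine ih (wordSet_two_mul_subset (fun s hs a ha ha1 t ht => ?_) _ hx)
    have hsat : τ.HS (s * a * t) := ht.1.mul_left (mul_mem hs.1.1 ha)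
    refine ⟨hsat, ?_⟩
    set z := Star.star a * (Star.star s * s) * a with hz
    have hzM : z ∈ M := mul_mem (mul_mem (star_mem ha) (mul_mem (star_mem hs.1.1) hs.1.1)) ha
    have hz0 : 0 ≤ z := star_left_conjugate_nonneg (star_mul_self_nonneg s) a
    have hpow : (2 : ℕ) ^ k ≠ 0 := by positivity
    have h1 : Star.star (s * a * t) * (s * a * t) = Star.star t * z * t := by
      simp only [hz, star_mul, mul_assoc]
    have hfin := ht.1.toFun_star_mul_mul_pow_lt_top hzM hz0 hpow
    have hword : (z * (t * Star.star t)) ^ 2 ^ k ∈ wordSet M (τ.letters k) (2 ^ (k + 1)) := by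
      have h2 : z * (t * Star.star t) ∈ wordSet M (τ.letters k) 2 := by
        have h3 := mul_mem_wordSet (contraction_mem_wordSet (star_mem ha) (by rwa [norm_star]))
          (mem_wordSet_one (M := M) (star_mul_self_mem_letters hs))
        have h4 := mul_mem_wordSet (mul_contraction_mem_wordSet h3 ha ha1)
          (mem_wordSet_one (M := M) (mul_star_self_mem_letters ht))
        exact h4
      rw [pow_succ]
      exact pow_mem_wordSet h2 _
    have h5 := ih hword
    rw [← ht.1.tr_star_mul_mul_pow hzM hpow, τ.tr_eq
      (pow_mem (mul_mem (mul_mem (star_mem ht.1.1) hzM) ht.1.1) _)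
      (CStarAlgebra.pow_nonneg (star_left_conjugate_nonneg hz0 t) _) hfin, Complex.norm_real,
      Real.norm_of_nonneg ENNReal.toReal_nonneg] at h5
    rw [h1]
    rw [← ENNReal.ofReal_toReal hfin.ne]
    exact ENNReal.ofReal_le_one.2 h5

end NFSTrace

namespace NFSTrace

variable {M : VonNeumannAlgebra H} (τ : NFSTrace M) {b x y : H →L[ℂ] H}

/-! ### Hölder's inequality for the trace with real exponents -/

/-- The positive elements of `M` all of whose powers with positive exponent have finite trace. -/
def FiniteMoments (b : H →L[ℂ] H) : Prop :=
  b ∈ M ∧ 0 ≤ b ∧ ∀ s : ℝ, 0 < s → τ.toFun (b ^ s) < ∞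

/-- The real number `τ (b ^ s)`. -/
def moment (b : H →L[ℂ] H) (s : ℝ) : ℝ := (τ.toFun (b ^ s)).toReal

variable {τ}

lemma moment_nonneg (b : H →L[ℂ] H) (s : ℝ) : 0 ≤ τ.moment b s := ENNReal.toReal_nonneg

lemma FiniteMoments.convexOn_moment (hb : τ.FiniteMoments b) :
    ConvexOn ℝ (Set.Ioi 0) (τ.moment b) := by
  obtain ⟨hM, h0, hfin⟩ := hb
  refine ⟨convex_Ioi 0, fun s hs t ht c d hc hd hcd => ?_⟩
  have hs' : (0 : ℝ) < s := hs
  have ht' : (0 : ℝ) < t := ht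
  have hcfc : ∀ r : ℝ, b ^ r = cfc (fun u : ℝ => u ^ r) b := fun r => CFC.rpow_eq_cfc_real h0
  have hst : 0 ≤ c * s + d * t := by positivity
  have hcs : ContinuousOn (fun u : ℝ => c * u ^ s) (spectrum ℝ b) :=
    continuousOn_const.mul (continuousOn_rpow_const_nonneg hs'.le _)
  have hdt : ContinuousOn (fun u : ℝ => d * u ^ t) (spectrum ℝ b) :=
    continuousOn_const.mul (continuousOn_rpow_const_nonneg ht'.le _)
  have hle : b ^ (c * s + d * t) ≤ c • b ^ s + d • b ^ t := by
    rw [hcfc, hcfc, hcfc,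
      ← cfc_const_mul c _ _ (continuousOn_rpow_const_nonneg hs'.le _),
      ← cfc_const_mul d _ _ (continuousOn_rpow_const_nonneg ht'.le _),
      ← cfc_add (a := b) (fun u => c * u ^ s) (fun u => d * u ^ t) hcs hdt]
    refine cfc_mono (fun u hu => ?_) (continuousOn_rpow_const_nonneg hst _) (hcs.add hdt)
    have hu0 := (mem_Icc_of_mem_spectrum h0 hu).1
    have := Real.geom_mean_le_arith_mean2_weighted hc hd (Real.rpow_nonneg hu0 s)
      (Real.rpow_nonneg hu0 t) hcd
    refine le_trans (le_of_eq ?_) this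
    rw [← Real.rpow_mul hu0, ← Real.rpow_mul hu0, mul_comm s c, mul_comm t d]
    exact Real.rpow_add_of_nonneg hu0 (by positivity) (by positivity)
  have hsM := VonNeumannAlgebra.rpow_mem hM h0 s
  have htM := VonNeumannAlgebra.rpow_mem hM h0 t
  have h1 := τ.toFun_mono (VonNeumannAlgebra.rpow_mem hM h0 _)
    (add_mem (VonNeumannAlgebra.real_smul_mem c hsM) (VonNeumannAlgebra.real_smul_mem d htM))
    CFC.rpow_nonneg hle
  rw [τ.map_add _ (VonNeumannAlgebra.real_smul_mem c hsM) _
    (VonNeumannAlgebra.real_smul_mem d htM) (smul_nonneg hc CFC.rpow_nonneg)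
    (smul_nonneg hd CFC.rpow_nonneg), τ.map_smul c hc _ hsM CFC.rpow_nonneg,
    τ.map_smul d hd _ htM CFC.rpow_nonneg] at h1
  have e1 : ENNReal.ofReal c * τ.toFun (b ^ s) ≠ ∞ :=
    ENNReal.mul_ne_top ENNReal.ofReal_ne_top (hfin s hs').ne
  have e2 : ENNReal.ofReal d * τ.toFun (b ^ t) ≠ ∞ :=
    ENNReal.mul_ne_top ENNReal.ofReal_ne_top (hfin t ht').ne
  have h2 := ENNReal.toReal_mono (ENNReal.add_ne_top.2 ⟨e1, e2⟩) h1
  rw [ENNReal.toReal_add e1 e2, ENNReal.toReal_mul, ENNReal.toReal_mul,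
    ENNReal.toReal_ofReal hc, ENNReal.toReal_ofReal hd] at h2
  exact h2

lemma FiniteMoments.continuousAt_moment (hb : τ.FiniteMoments b) {s : ℝ} (hs : 0 < s) :
    ContinuousAt (τ.moment b) s :=
  (hb.convexOn_moment.continuousOn isOpen_Ioi).continuousAt (Ioi_mem_nhds hs)

/-- A power `b ^ θ` as a multiple of a word in `l` letters, each of them a multiple of
`b ^ (θ / l)`. For `θ = l = 0` the scalar is `1`. -/
lemma FiniteMoments.exists_wordSet (hb : τ.FiniteMoments b) {θ : ℝ} (hθ : 0 ≤ θ) {l : ℕ}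
    (h0 : l = 0 ↔ θ = 0) (k : ℕ) {η : ℝ} (hη : 0 < η) :
    ∃ w ∈ wordSet M (τ.letters k) l, b ^ θ =
      (τ.moment b (θ * (2 ^ (k + 1) : ℕ) / l) + η) ^ ((l : ℝ) / (2 ^ (k + 1) : ℕ)) • w := by
  obtain ⟨hM, hb0, hfin⟩ := hb
  rcases Nat.eq_zero_or_pos l with hl | hl
  · have hθ0 := h0.1 hl
    subst hl hθ0
    refine ⟨1, contraction_mem_wordSet (one_mem M) norm_one_le_one, ?_⟩
    rw [CFC.rpow_zero b hb0]
    simp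
  have hl0 : (0 : ℝ) < l := by exact_mod_cast hl
  have hθ0 : 0 < θ := lt_of_le_of_ne hθ fun h => hl.ne' (h0.2 h.symm)
  set D : ℕ := 2 ^ (k + 1) with hD
  have hD0 : (0 : ℝ) < D := by positivity
  set T := τ.moment b (θ * D / l) with hT
  have hTη : 0 < T + η := add_pos_of_nonneg_of_pos (moment_nonneg _ _) hη
  set N : ℝ := (T + η) ^ (1 / (D : ℝ)) with hN
  have hN0 : 0 < N := Real.rpow_pos_of_pos hTη _
  set β := b ^ (θ / l) with hβ
  have hβ0 : 0 ≤ β := CFC.rpow_nonneg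
  have hβM : β ∈ M := VonNeumannAlgebra.rpow_mem hM hb0 _
  have hpow : ∀ n : ℕ, β ^ n = b ^ (θ / l * n) := by
    intro n
    rw [← CFC.rpow_natCast β n, hβ, CFC.rpow_rpow_of_exponent_nonneg b _ _ (by positivity)
      (by positivity)]
  have hsa : star β = β := (IsSelfAdjoint.of_nonneg hβ0).star_eq
  have hβHS : τ.HS β := by
    refine ⟨hβM, ?_⟩
    rw [hsa, ← sq, hpow]
    exact hfin _ (by positivity)
  have hletter : (N⁻¹ : ℝ) • β ∈ τ.letters k := by
    refine ⟨by rw [← Complex.coe_smul]; exact hβHS.smul _, ?_⟩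
    have h1 : (star ((N⁻¹ : ℝ) • β) * ((N⁻¹ : ℝ) • β)) ^ 2 ^ k = (N⁻¹ ^ D) • b ^ (θ * D / l) := by
      rw [star_smul, hsa, star_trivial, smul_mul_smul_comm, smul_pow, ← sq, ← sq, ← pow_mul,
        ← pow_mul, ← pow_succ', hpow]
      congr 2
      ring
    rw [h1, τ.map_smul _ (by positivity) _ (VonNeumannAlgebra.rpow_mem hM hb0 _) CFC.rpow_nonneg,
      ← ENNReal.ofReal_toReal (hfin (θ * D / l) (by positivity)).ne,
      ← ENNReal.ofReal_mul (by positivity)]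
    refine ENNReal.ofReal_le_one.2 ?_
    change N⁻¹ ^ D * T ≤ 1
    have h2 : N ^ D = T + η := by
      rw [hN, ← Real.rpow_natCast, ← Real.rpow_mul hTη.le, one_div_mul_cancel hD0.ne',
        Real.rpow_one]
    rw [inv_pow, h2, inv_mul_le_iff₀ hTη]
    linarith
  refine ⟨((N⁻¹ : ℝ) • β) ^ l, by simpa using pow_mem_wordSet (mem_wordSet_one (M := M) hletter) l,
    ?_⟩
  have h3 : (T + η) ^ ((l : ℝ) / D) = N ^ l := by
    rw [hN, ← Real.rpow_natCast, ← Real.rpow_mul hTη.le]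
    congr 1
    ring
  rw [h3, smul_pow, smul_smul, ← mul_pow, mul_inv_cancel₀ hN0.ne', one_pow, one_smul, hpow]
  congr 1
  field_simp

lemma FiniteMoments.tendsto_scalar (hb : τ.FiniteMoments b) {θ : ℝ} (hθ : 0 ≤ θ) {l : ℕ → ℕ}
    (hl : Tendsto (fun k => (l k : ℝ) / (2 ^ (k + 1) : ℕ)) atTop (𝓝 θ))
    (h0 : θ = 0 → ∀ k, l k = 0) {η : ℝ} (hη : 0 < η) :
    Tendsto (fun k => (τ.moment b (θ * (2 ^ (k + 1) : ℕ) / l k) + η) ^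
      ((l k : ℝ) / (2 ^ (k + 1) : ℕ))) atTop (𝓝 ((τ.moment b 1 + η) ^ θ)) := by
  rcases hθ.eq_or_lt with h | h
  · have := h0 h.symm
    simp [this, ← h]
  · have h1 : Tendsto (fun k => θ * (2 ^ (k + 1) : ℕ) / l k) atTop (𝓝 1) := by
      have := (tendsto_const_nhds (x := θ)).div hl h.ne'
      rw [div_self h.ne'] at this
      refine this.congr fun k => ?_
      simp only [Pi.div_apply]
      rw [div_div_eq_mul_div]
    have h2 := (hb.continuousAt_moment one_pos).tendsto.comp h1
    exact (h2.add_const η).rpow hl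
      (Or.inl (add_pos_of_nonneg_of_pos (moment_nonneg _ _) hη).ne')

lemma tendsto_two_pow_succ_cast : Tendsto (fun k : ℕ => ((2 ^ (k + 1) : ℕ) : ℝ)) atTop atTop :=
  tendsto_natCast_atTop_atTop.comp
    ((tendsto_pow_atTop_atTop_of_one_lt (by norm_num : 1 < 2)).comp (tendsto_add_atTop_nat 1))

/-- Hölder's inequality for the trace of a product of three powers with bounded factors in
between, the exponents adding up to `1`. It follows from the case of `2 ^ k` equal exponents by
dyadic approximation of the exponents. -/
theorem norm_tr_mul_rpow_le {b₁ b₂ b₃ a₁ a₂ a₃ : H →L[ℂ] H} (hb₁ : τ.FiniteMoments b₁)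
    (hb₂ : τ.FiniteMoments b₂) (hb₃ : τ.FiniteMoments b₃) (ha₁ : a₁ ∈ M) (ha₂ : a₂ ∈ M)
    (ha₃ : a₃ ∈ M) (h₁ : ‖a₁‖ ≤ 1) (h₂ : ‖a₂‖ ≤ 1) (h₃ : ‖a₃‖ ≤ 1) {θ₁ θ₂ θ₃ : ℝ} (hθ₁ : 0 < θ₁)
    (hθ₂ : 0 ≤ θ₂) (hθ₃ : 0 ≤ θ₃) (hθ : θ₁ + θ₂ + θ₃ = 1) :
    ‖τ.tr (a₁ * b₁ ^ θ₁ * a₂ * b₂ ^ θ₂ * a₃ * b₃ ^ θ₃)‖ ≤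
      τ.moment b₁ 1 ^ θ₁ * τ.moment b₂ 1 ^ θ₂ * τ.moment b₃ 1 ^ θ₃ := by
  set D : ℕ → ℕ := fun k => 2 ^ (k + 1) with hD
  have hDpos : ∀ k, (0 : ℝ) < D k := fun k => by positivity
  set l₂ : ℕ → ℕ := fun k => ⌊θ₂ * D k⌋₊ with hl₂
  set l₃ : ℕ → ℕ := fun k => ⌊θ₃ * D k⌋₊ with hl₃
  have hsum : ∀ k, l₂ k + l₃ k ≤ D k := by
    intro k
    have e2 : (l₂ k : ℝ) ≤ θ₂ * D k := Nat.floor_le (by positivity)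
    have e3 : (l₃ k : ℝ) ≤ θ₃ * D k := Nat.floor_le (by positivity)
    have e4 : (θ₂ + θ₃) * D k ≤ 1 * D k := by gcongr; linarith
    have : ((l₂ k + l₃ k : ℕ) : ℝ) ≤ D k := by push_cast; linarith
    exact_mod_cast this
  set l₁ : ℕ → ℕ := fun k => D k - (l₂ k + l₃ k) with hl₁
  have t₂ : Tendsto (fun k => (l₂ k : ℝ) / D k) atTop (𝓝 θ₂) :=
    (tendsto_nat_floor_mul_div_atTop hθ₂).comp tendsto_two_pow_succ_cast
  have t₃ : Tendsto (fun k => (l₃ k : ℝ) / D k) atTop (𝓝 θ₃) :=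
    (tendsto_nat_floor_mul_div_atTop hθ₃).comp tendsto_two_pow_succ_cast
  have t₁ : Tendsto (fun k => (l₁ k : ℝ) / D k) atTop (𝓝 θ₁) := by
    have := (tendsto_const_nhds (x := (1 : ℝ))).sub (t₂.add t₃)
    rw [show 1 - (θ₂ + θ₃) = θ₁ by linarith] at this
    refine this.congr fun k => ?_
    rw [hl₁, Nat.cast_sub (hsum k), sub_div, div_self (hDpos k).ne', Nat.cast_add, add_div]
  have z₂ : θ₂ = 0 → ∀ k, l₂ k = 0 := fun h k => by simp [hl₂, h]
  have z₃ : θ₃ = 0 → ∀ k, l₃ k = 0 := fun h k => by simp [hl₃, h]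
  have ev : ∀ {θ : ℝ} {l : ℕ → ℕ}, 0 ≤ θ → (θ = 0 → ∀ k, l k = 0) →
      Tendsto (fun k => (l k : ℝ) / D k) atTop (𝓝 θ) → ∀ᶠ k in atTop, (l k = 0 ↔ θ = 0) := by
    intro θ l hθ h0 hl
    rcases hθ.eq_or_lt with h | h
    · exact Eventually.of_forall fun k => ⟨fun _ => h.symm, fun h' => h0 h' k⟩
    · filter_upwards [hl.eventually (lt_mem_nhds h)] with k hk
      refine ⟨fun h' => ?_, fun h' => absurd h' h.ne'⟩
      rw [h'] at hk
      simp at hk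
  have hη : ∀ η : ℝ, 0 < η → ‖τ.tr (a₁ * b₁ ^ θ₁ * a₂ * b₂ ^ θ₂ * a₃ * b₃ ^ θ₃)‖ ≤
      (τ.moment b₁ 1 + η) ^ θ₁ * (τ.moment b₂ 1 + η) ^ θ₂ * (τ.moment b₃ 1 + η) ^ θ₃ := by
    intro η hη
    have z₁ : θ₁ = 0 → ∀ k, l₁ k = 0 := fun h => absurd h hθ₁.ne'
    have hlim := ((hb₁.tendsto_scalar hθ₁.le t₁ z₁ hη).mul (hb₂.tendsto_scalar hθ₂ t₂ z₂ hη)).mul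
      (hb₃.tendsto_scalar hθ₃ t₃ z₃ hη)
    refine ge_of_tendsto hlim ?_
    filter_upwards [ev hθ₁.le z₁ t₁, ev hθ₂ z₂ t₂, ev hθ₃ z₃ t₃] with k e₁ e₂ e₃
    obtain ⟨w₁, hw₁, q₁⟩ := hb₁.exists_wordSet hθ₁.le e₁ k hη
    obtain ⟨w₂, hw₂, q₂⟩ := hb₂.exists_wordSet hθ₂ e₂ k hη
    obtain ⟨w₃, hw₃, q₃⟩ := hb₃.exists_wordSet hθ₃ e₃ k hη
    have hw : a₁ * w₁ * a₂ * w₂ * a₃ * w₃ ∈ wordSet M (τ.letters k) (2 ^ (k + 1)) := by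
      have := mul_mem_wordSet (mul_contraction_mem_wordSet (mul_mem_wordSet
        (mul_contraction_mem_wordSet (mul_mem_wordSet (contraction_mem_wordSet ha₁ h₁) hw₁) ha₂ h₂)
        hw₂) ha₃ h₃) hw₃
      rwa [show 0 + l₁ k + l₂ k + l₃ k = 2 ^ (k + 1) by
        have := hsum k
        simp only [hl₁, zero_add]
        change D k - (l₂ k + l₃ k) + l₂ k + l₃ k = D k
        omega] at this
    have h1 := norm_tr_le_one_of_mem_wordSet k hw
    rw [q₁, q₂, q₃]
    set c₁ := (τ.moment b₁ (θ₁ * (2 ^ (k + 1) : ℕ) / l₁ k) + η) ^ ((l₁ k : ℝ) / (2 ^ (k + 1) : ℕ))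
    set c₂ := (τ.moment b₂ (θ₂ * (2 ^ (k + 1) : ℕ) / l₂ k) + η) ^ ((l₂ k : ℝ) / (2 ^ (k + 1) : ℕ))
    set c₃ := (τ.moment b₃ (θ₃ * (2 ^ (k + 1) : ℕ) / l₃ k) + η) ^ ((l₃ k : ℝ) / (2 ^ (k + 1) : ℕ))
    have hc : 0 ≤ c₁ * c₂ * c₃ := by
      refine mul_nonneg (mul_nonneg ?_ ?_) ?_ <;>
        exact Real.rpow_nonneg (add_nonneg (moment_nonneg _ _) hη.le) _
    have h2 : a₁ * c₁ • w₁ * a₂ * c₂ • w₂ * a₃ * c₃ • w₃ =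
        ((c₁ * c₂ * c₃ : ℝ) : ℂ) • (a₁ * w₁ * a₂ * w₂ * a₃ * w₃) := by
      rw [Complex.coe_smul]
      simp only [smul_mul_assoc, mul_smul_comm, smul_smul]
      congr 1
      ring
    rw [h2, _root_.map_smul, norm_smul, Complex.norm_real, Real.norm_of_nonneg hc]
    exact mul_le_of_le_one_right hc h1
  have hc : ∀ (m : ℝ) {θ : ℝ}, 0 ≤ θ →
      Tendsto (fun η : ℝ => (m + η) ^ θ) (𝓝[>] 0) (𝓝 (m ^ θ)) := by
    intro m θ hθ
    have : Continuous fun η : ℝ => (m + η) ^ θ :=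
      (Real.continuous_rpow_const hθ).comp (continuous_const.add continuous_id)
    have h := this.tendsto 0
    simp only [add_zero] at h
    exact h.mono_left nhdsWithin_le_nhds
  exact ge_of_tendsto (((hc _ hθ₁.le).mul (hc _ hθ₂)).mul (hc _ hθ₃))
    (by filter_upwards [self_mem_nhdsWithin] with η h using hη η h)

end NFSTrace

/-! ### Cutting off an operator near the kernel of its absolute value -/

/-- `(x - δ)₊`, for a positive operator `x`. -/
def softThreshold (δ : ℝ) (x : H →L[ℂ] H) : H →L[ℂ] H := cfc (fun t : ℝ => max (t - δ) 0) x

lemma continuous_max_sub (δ : ℝ) : Continuous fun t : ℝ => max (t - δ) 0 := by fun_prop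

lemma softThreshold_nonneg (δ : ℝ) (x : H →L[ℂ] H) : 0 ≤ softThreshold δ x :=
  cfc_nonneg fun _ _ => le_max_right _ _

lemma softThreshold_rpow {δ s : ℝ} (hs : 0 ≤ s) {x : H →L[ℂ] H} (hx : 0 ≤ x) :
    softThreshold δ x ^ s = cfc (fun t : ℝ => max (t - δ) 0 ^ s) x := by
  rw [CFC.rpow_eq_cfc_real (softThreshold_nonneg δ x), softThreshold,
    ← cfc_comp (fun t : ℝ => t ^ s) (fun t : ℝ => max (t - δ) 0) x
      (IsSelfAdjoint.of_nonneg hx) (continuousOn_rpow_const_nonneg hs _)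
      (continuous_max_sub δ).continuousOn]
  rfl

lemma norm_sub_softThreshold_le {δ : ℝ} (hδ : 0 ≤ δ) {x : H →L[ℂ] H} (hx : 0 ≤ x) :
    ‖x - softThreshold δ x‖ ≤ δ := by
  have h1 : x - softThreshold δ x = cfc (fun t : ℝ => t - max (t - δ) 0) x := by
    rw [cfc_sub (fun t : ℝ => t) (fun t : ℝ => max (t - δ) 0) x continuousOn_id
      (continuous_max_sub δ).continuousOn, cfc_id' ℝ x (IsSelfAdjoint.of_nonneg hx), softThreshold]
  rw [h1]
  refine norm_cfc_le_of_nonneg hx hδ fun t ht _ => ?_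
  rw [abs_le]
  rcases max_cases (t - δ) 0 with ⟨h, _⟩ | ⟨h, _⟩ <;> rw [h] <;> constructor <;> linarith

lemma tendsto_softThreshold {x : H →L[ℂ] H} (hx : 0 ≤ x) :
    Tendsto (fun δ => softThreshold δ x) (𝓝[>] 0) (𝓝 x) := by
  rw [tendsto_iff_norm_sub_tendsto_zero]
  refine squeeze_zero' (Eventually.of_forall fun _ => norm_nonneg _) ?_
    (tendsto_nhdsWithin_of_tendsto_nhds (tendsto_id (α := ℝ)))
  filter_upwards [self_mem_nhdsWithin] with δ hδ
  rw [norm_sub_rev]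
  exact norm_sub_softThreshold_le (le_of_lt hδ) hx

lemma tendsto_rpow {ι : Type*} {l : Filter ι} {a : ι → H →L[ℂ] H} {a₀ : H →L[ℂ] H}
    (h : Tendsto a l (𝓝 a₀)) (ha : ∀ᶠ i in l, 0 ≤ a i) (ha₀ : 0 ≤ a₀) {s : ℝ} (hs : 0 ≤ s) :
    Tendsto (fun i => a i ^ s) l (𝓝 (a₀ ^ s)) := by
  have hb : ∀ᶠ i in l, ‖a i‖ ≤ ‖a₀‖ + 1 :=
    (h.norm.eventually (gt_mem_nhds (lt_add_one _))).mono fun i hi => hi.le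
  have := Filter.Tendsto.cfc (isCompact_Icc (a := (0 : ℝ)) (b := ‖a₀‖ + 1)) (fun t : ℝ => t ^ s)
    h (by
      filter_upwards [ha, hb] with i hi hi' t ht
      exact ⟨(mem_Icc_of_mem_spectrum hi ht).1, (mem_Icc_of_mem_spectrum hi ht).2.trans hi'⟩)
    (ha.mono fun i hi => IsSelfAdjoint.of_nonneg hi)
    (fun t ht => ⟨(mem_Icc_of_mem_spectrum ha₀ ht).1,
      (mem_Icc_of_mem_spectrum ha₀ ht).2.trans (by linarith)⟩)
    (IsSelfAdjoint.of_nonneg ha₀) (continuousOn_rpow_const_nonneg hs _)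
  rw [CFC.rpow_eq_cfc_real ha₀]
  refine this.congr' (ha.mono fun i hi => ?_)
  exact (CFC.rpow_eq_cfc_real hi).symm

namespace NFSTrace

variable {M : VonNeumannAlgebra H} {τ : NFSTrace M} {b x y : H →L[ℂ] H}

/-! ### Lower semicontinuity of the trace and of the `p`-norms -/

lemma toFun_star_mul_mul_self_le {h z : H →L[ℂ] H} (hh : h ∈ M) (hh1 : ‖h‖ ≤ 1) (hz : z ∈ M)
    (hz0 : 0 ≤ z) : τ.toFun (star h * z * h) ≤ τ.toFun z := by
  set s := CFC.sqrt z with hs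
  have hs0 : star s = s := (IsSelfAdjoint.of_nonneg (CFC.sqrt_nonneg z)).star_eq
  have hss : s * s = z := CFC.sqrt_mul_sqrt_self z
  have hsM : s ∈ M := by
    rw [hs, CFC.sqrt_eq_rpow]
    exact VonNeumannAlgebra.rpow_mem hz hz0 _
  have h1 : star h * z * h = star (s * h) * (s * h) := by
    rw [star_mul, hs0, ← hss]; simp only [mul_assoc]
  rw [h1, τ.tracial _ (mul_mem hsM hh)]
  have h2 : s * h * star (s * h) = star (star h * s) * (star h * s) := by
    simp only [star_mul, star_star, hs0]
  rw [h2]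
  have := toFun_star_mul_self_mul_le (τ := τ) (star_mem hh) hsM
    (show ‖star h‖ ≤ 1 by rwa [norm_star])
  simpa [hs0, hss] using this

/-- The trace is lower semicontinuous for the operator norm. If `z` is close to `y`, then
`h (y - δ) h ≤ h z h` for a function `h` of `y` that vanishes below `δ`, and the left-hand side
dominates `(y - 2δ)₊`; these operators increase to `y` as `δ` decreases to `0`. -/
lemma toFun_le_of_tendsto {ι : Type*} {l : Filter ι} [l.NeBot] {z : ι → H →L[ℂ] H}
    (h : Tendsto z l (𝓝 y)) (hz : ∀ᶠ i in l, z i ∈ M ∧ 0 ≤ z i) {K : ℝ≥0∞}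
    (hK : ∀ᶠ i in l, τ.toFun (z i) ≤ K) : τ.toFun y ≤ K := by
  have hyM : y ∈ M := M.isClosed.mem_of_tendsto h (hz.mono fun i hi => hi.1)
  have hy0 : 0 ≤ y := ge_of_tendsto h (hz.mono fun i hi => hi.2)
  have hysa := IsSelfAdjoint.of_nonneg hy0
  have hid : cfc (fun t : ℝ => t) y = y := cfc_id' ℝ y hysa
  have hsoft : ∀ δ : ℝ, 0 < δ → τ.toFun (softThreshold (2 * δ) y) ≤ K := by
    intro δ hδ
    obtain ⟨i, ⟨hziM, hzi0⟩, hziK, hzid⟩ := (hz.and (hK.and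
      (h.eventually (Metric.closedBall_mem_nhds y hδ)))).exists
    set f : ℝ → ℝ := fun t => min 1 (max (t - δ) 0 / δ) with hf
    have hfc : Continuous f := by fun_prop
    have hf0 : ∀ t, 0 ≤ f t := fun t =>
      le_min zero_le_one (div_nonneg (le_max_right _ _) hδ.le)
    set g := cfc f y with hg
    have hgM : g ∈ M := VonNeumannAlgebra.cfc_mem hyM f
    have hgsa : star g = g := (cfc_predicate f y : IsSelfAdjoint g).star_eq
    have hg1 : ‖g‖ ≤ 1 := norm_cfc_le_of_nonneg hy0 zero_le_one fun t _ _ => by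
      rw [abs_of_nonneg (hf0 t)]; exact min_le_left _ _
    have h1 : y - δ • (1 : H →L[ℂ] H) ≤ z i := by
      have h2 : y - z i ≤ ‖y - z i‖ • (1 : H →L[ℂ] H) := by
        rw [← Algebra.algebraMap_eq_smul_one]
        exact (hysa.sub (IsSelfAdjoint.of_nonneg hzi0)).le_algebraMap_norm_self
      have h3 : ‖y - z i‖ • (1 : H →L[ℂ] H) ≤ δ • 1 :=
        smul_le_smul_of_nonneg_right (by rwa [← dist_eq_norm, dist_comm]) zero_le_one
      rw [sub_le_comm]
      exact h2.trans h3
    have h4 := star_left_conjugate_le_conjugate h1 g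
    have h5 : star g * (y - δ • 1) * g = cfc (fun t => f t * (t - δ) * f t) y := by
      have e1 : y - δ • (1 : H →L[ℂ] H) = cfc (fun t : ℝ => t - δ) y := by
        rw [cfc_sub (fun t : ℝ => t) (fun _ => δ) y, hid, cfc_const δ y hysa,
          Algebra.algebraMap_eq_smul_one]
      rw [hgsa, e1, hg, ← cfc_mul f (fun t : ℝ => t - δ) y hfc.continuousOn,
        ← cfc_mul (fun t => f t * (t - δ)) f y (by fun_prop) hfc.continuousOn]
    rw [h5] at h4
    have h6 : softThreshold (2 * δ) y ≤ cfc (fun t => f t * (t - δ) * f t) y := by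
      refine cfc_mono (fun t _ => ?_) (continuous_max_sub _).continuousOn (by fun_prop)
      rcases le_total t δ with ht | ht
      · have e1 : f t = 0 := by simp [hf, ht]
        have e2 : max (t - 2 * δ) 0 = 0 := max_eq_right (by linarith)
        rw [e1, e2]; simp
      · rcases le_total t (2 * δ) with ht2 | ht2
        · rw [max_eq_right (by linarith)]
          exact mul_nonneg (mul_nonneg (hf0 t) (by linarith)) (hf0 t)
        · have e1 : f t = 1 := by
            refine min_eq_left ?_
            rw [le_div_iff₀ hδ]
            exact le_trans (by linarith) (le_max_left _ _)
          rw [e1, max_eq_left (by linarith)]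
          linarith
    calc τ.toFun (softThreshold (2 * δ) y) ≤ τ.toFun (star g * z i * g) :=
          τ.toFun_mono (VonNeumannAlgebra.cfc_mem hyM _)
            (mul_mem (mul_mem (star_mem hgM) hziM) hgM) (softThreshold_nonneg _ _) (h6.trans h4)
      _ ≤ τ.toFun (z i) := toFun_star_mul_mul_self_le hgM hg1 hziM hzi0
      _ ≤ K := hziK
  have hanti : ∀ {δ δ' : ℝ}, δ ≤ δ' → softThreshold δ' y ≤ softThreshold δ y := by
    intro δ δ' hd
    exact cfc_mono (fun t _ => max_le_max (by linarith) le_rfl)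
      (continuous_max_sub _).continuousOn (continuous_max_sub _).continuousOn
  have hlub := τ.normal ((fun δ => softThreshold δ y) '' Set.Ioi 0) y
    ((Set.nonempty_Ioi).image _) (by
      rintro _ ⟨δ, hδ, rfl⟩ _ ⟨δ', hδ', rfl⟩
      exact ⟨_, ⟨min δ δ', Set.mem_Ioi.2 (lt_min hδ hδ'), rfl⟩, hanti (min_le_left _ _),
        hanti (min_le_right _ _)⟩)
    (by
      rintro _ ⟨δ, hδ, rfl⟩
      exact ⟨VonNeumannAlgebra.cfc_mem hyM _, softThreshold_nonneg _ _⟩) hyM (by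
      constructor
      · rintro _ ⟨δ, hδ, rfl⟩
        have hδ' : (0 : ℝ) < δ := hδ
        conv_rhs => rw [← hid]
        refine cfc_mono (fun t ht => ?_) (continuous_max_sub _).continuousOn continuousOn_id
        exact max_le (by linarith) (mem_Icc_of_mem_spectrum hy0 ht).1
      · intro w hw
        refine le_of_tendsto (tendsto_softThreshold hy0) ?_
        filter_upwards [self_mem_nhdsWithin] with δ hδ using hw ⟨δ, hδ, rfl⟩)
  rw [hlub]
  refine iSup₂_le ?_
  rintro _ ⟨δ, hδ, rfl⟩
  have := hsoft (δ / 2) (half_pos hδ)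
  rwa [mul_div_cancel₀ _ (two_ne_zero' ℝ)] at this

lemma lpNorm_le_iff {p : ℝ} (hp : 0 < p) {K : ℝ≥0∞} :
    τ.lpNorm p x ≤ K ↔ τ.toFun (CFC.abs x ^ p) ≤ K ^ p := by
  rw [lpNorm, one_div, ENNReal.rpow_inv_le_iff hp]

lemma lpNorm_le_of_tendsto {ι : Type*} {l : Filter ι} [l.NeBot] {z : ι → H →L[ℂ] H} {p : ℝ}
    (hp : 0 < p) (h : Tendsto z l (𝓝 x)) (hz : ∀ᶠ i in l, z i ∈ M) {K : ℝ≥0∞}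
    (hK : ∀ᶠ i in l, τ.lpNorm p (z i) ≤ K) : τ.lpNorm p x ≤ K := by
  rw [lpNorm_le_iff hp]
  refine toFun_le_of_tendsto (l := l) (z := fun i => CFC.abs (z i) ^ p)
    (tendsto_rpow ((CFC.continuous_abs.tendsto x).comp h)
      (Eventually.of_forall fun i => CFC.abs_nonneg _) (CFC.abs_nonneg _) hp.le) ?_ ?_
  · exact hz.mono fun i hi => ⟨VonNeumannAlgebra.rpow_mem (VonNeumannAlgebra.abs_mem hi)
      (CFC.abs_nonneg _) _, CFC.rpow_nonneg⟩
  · exact hK.mono fun i hi => (lpNorm_le_iff hp).1 hi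

/-! ### Factorization through operators of finite trace -/

lemma finiteMoments_softThreshold (hx : x ∈ M) (hx0 : 0 ≤ x) {r : ℝ} (hr : 0 < r)
    (hfin : τ.toFun (x ^ r) < ∞) {δ : ℝ} (hδ : 0 < δ) : τ.FiniteMoments (softThreshold δ x) := by
  refine ⟨VonNeumannAlgebra.cfc_mem hx _, softThreshold_nonneg _ _, fun s hs => ?_⟩
  have hC : 0 ≤ ‖x‖ ^ s / δ ^ r := by positivity
  have h1 : 0 ≤ x ^ r := CFC.rpow_nonneg
  rw [CFC.rpow_eq_cfc_real hx0] at h1 hfin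
  rw [softThreshold_rpow hs.le hx0]
  refine (τ.toFun_cfc_mono hx hx0 (f := fun t => max (t - δ) 0 ^ s)
    (g := fun t => ‖x‖ ^ s / δ ^ r * t ^ r)
    ((Real.continuous_rpow_const hs.le).comp (continuous_max_sub δ))
    (continuous_const.mul (Real.continuous_rpow_const hr.le)) (fun t _ _ => by positivity)
    (fun t ht htx => ?_)).trans_lt ?_
  · rcases le_total t δ with h | h
    · simp only [max_eq_right (sub_nonpos.2 h), Real.zero_rpow hs.ne']
      positivity
    · rw [max_eq_left (sub_nonneg.2 h), div_mul_eq_mul_div, le_div_iff₀ (by positivity)]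
      have e1 : (t - δ) ^ s ≤ ‖x‖ ^ s :=
        Real.rpow_le_rpow (sub_nonneg.2 h) (by linarith) hs.le
      have e2 : δ ^ r ≤ t ^ r := Real.rpow_le_rpow hδ.le h hr.le
      gcongr
  · rw [τ.toFun_const_mul_cfc hx (Real.continuous_rpow_const hr.le) hC h1]
    exact ENNReal.mul_lt_top ENNReal.ofReal_lt_top hfin

lemma FiniteMoments.rpow (hb : τ.FiniteMoments b) {s : ℝ} (hs : 0 < s) :
    τ.FiniteMoments (b ^ s) :=
  ⟨VonNeumannAlgebra.rpow_mem hb.1 hb.2.1 s, CFC.rpow_nonneg, fun t ht => by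
    rw [CFC.rpow_rpow_of_exponent_nonneg b s t hs.le ht.le hb.2.1]
    exact hb.2.2 _ (by positivity)⟩

lemma FiniteMoments.hs_rpow (hb : τ.FiniteMoments b) {s : ℝ} (hs : 0 < s) : τ.HS (b ^ s) := by
  refine ⟨VonNeumannAlgebra.rpow_mem hb.1 hb.2.1 s, ?_⟩
  rw [(IsSelfAdjoint.of_nonneg CFC.rpow_nonneg : IsSelfAdjoint (b ^ s)).star_eq,
    rpow_add_of_nonneg hb.2.1 hs.le hs.le]
  exact hb.2.2 _ (by positivity)

/-- An element of `𝓛_p` is, up to a small error in operator norm, a contraction times `b ^ (1/p)`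
with `b` of finite trace. For `t = |x|` the two factors are the functions `x / max t δ` and
`(t - δ)₊`. -/
lemma exists_factorization {p : ℝ} (hp : 0 < p) {K : ℝ} (hK : 0 ≤ K) (hx : x ∈ M)
    (hxp : τ.lpNorm p x ≤ ENNReal.ofReal K) {δ : ℝ} (hδ : 0 < δ) :
    ∃ w ∈ M, ‖w‖ ≤ 1 ∧ ∃ b, τ.FiniteMoments b ∧ τ.moment b 1 ^ (1 / p) ≤ K ∧
      ‖x - w * b ^ (1 / p)‖ ≤ δ := by
  set X := CFC.abs x with hX
  have hX0 : 0 ≤ X := CFC.abs_nonneg x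
  have hXM : X ∈ M := VonNeumannAlgebra.abs_mem hx
  have hXsa := IsSelfAdjoint.of_nonneg hX0
  have hid : cfc (fun t : ℝ => t) X = X := cfc_id' ℝ X hXsa
  rw [lpNorm_le_iff hp, ← hX, ENNReal.ofReal_rpow_of_nonneg hK hp.le] at hxp
  have hfin : τ.toFun (X ^ p) < ∞ := hxp.trans_lt ENNReal.ofReal_lt_top
  set u := softThreshold δ X with hu
  have hfm := finiteMoments_softThreshold hXM hX0 hp hfin hδ
  set g : ℝ → ℝ := fun t => (max t δ)⁻¹ with hg
  have hmax : ∀ t : ℝ, 0 < max t δ := fun t => lt_max_of_lt_right hδ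
  have hgc : Continuous g := Continuous.inv₀ (by fun_prop) fun t => (hmax t).ne'
  have hg0 : ∀ t, 0 ≤ g t := fun t => (inv_pos.2 (hmax t)).le
  -- the norm of `x f(|x|)` is that of `|x| f(|x|)`
  have hnorm : ∀ f : ℝ → ℝ, Continuous f → ∀ C : ℝ, 0 ≤ C →
      (∀ t, 0 ≤ t → |t * f t| ≤ C) → ‖x * cfc f X‖ ≤ C := by
    intro f hf C hC h
    have h1 : ‖X * cfc f X‖ ≤ C := by
      have : X * cfc f X = cfc (fun t => t * f t) X := by
        conv_lhs => rw [← hid]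
        rw [hid, cfc_mul (fun t : ℝ => t) f X continuousOn_id hf.continuousOn, hid]
      rw [this]
      exact norm_cfc_le_of_nonneg hX0 hC fun t ht _ => h t ht
    have h2 : ‖x * cfc f X‖ * ‖x * cfc f X‖ = ‖X * cfc f X‖ * ‖X * cfc f X‖ := by
      rw [← CStarRing.norm_star_mul_self, ← CStarRing.norm_star_mul_self, star_mul, star_mul,
        hXsa.star_eq]
      congr 1
      calc star (cfc f X) * star x * (x * cfc f X) = star (cfc f X) * (star x * x) * cfc f X := by
            simp only [mul_assoc]
        _ = star (cfc f X) * (X * X) * cfc f X := by rw [hX, CFC.abs_mul_abs]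
        _ = _ := by simp only [mul_assoc]
    rw [mul_self_inj_of_nonneg (norm_nonneg _) (norm_nonneg _)] at h2
    rw [h2]
    exact h1
  refine ⟨x * cfc g X, mul_mem hx (VonNeumannAlgebra.cfc_mem hXM g),
    hnorm g hgc 1 zero_le_one fun t ht => ?_, u ^ p, hfm.rpow hp, ?_, ?_⟩
  · rw [abs_of_nonneg (mul_nonneg ht (hg0 t))]
    exact mul_inv_le_one_of_le₀ (le_max_left _ _) (hmax t).le
  · have h1 : τ.toFun (u ^ p) ≤ ENNReal.ofReal (K ^ p) := by
      refine le_trans ?_ hxp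
      rw [hu, softThreshold_rpow hp.le hX0, CFC.rpow_eq_cfc_real hX0]
      refine τ.toFun_cfc_mono hXM hX0 (f := fun t => max (t - δ) 0 ^ p)
        ((Real.continuous_rpow_const hp.le).comp (continuous_max_sub δ)) (Real.continuous_rpow_const hp.le) (fun t _ _ => by positivity)
        fun t ht _ => ?_
      exact Real.rpow_le_rpow (le_max_right _ _) (max_le (by linarith) ht) hp.le
    have h2 : τ.moment (u ^ p) 1 ≤ K ^ p := by
      rw [moment, CFC.rpow_one _ CFC.rpow_nonneg]
      exact ENNReal.toReal_le_of_le_ofReal (by positivity) h1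
    calc τ.moment (u ^ p) 1 ^ (1 / p) ≤ (K ^ p) ^ (1 / p) :=
          Real.rpow_le_rpow (moment_nonneg _ _) h2 (by positivity)
      _ = K := by rw [← Real.rpow_mul hK, mul_one_div_cancel hp.ne', Real.rpow_one]
  · rw [CFC.rpow_rpow_of_exponent_nonneg u p (1 / p) hp.le (by positivity)
      (softThreshold_nonneg _ _), mul_one_div_cancel hp.ne',
      CFC.rpow_one u (softThreshold_nonneg _ _)]
    have h1 : x - x * cfc g X * u = x * cfc (fun t => 1 - g t * max (t - δ) 0) X := by
      rw [cfc_sub (fun _ => (1 : ℝ)) (fun t => g t * max (t - δ) 0) X continuousOn_const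
        (hgc.mul (continuous_max_sub δ)).continuousOn, cfc_const_one ℝ X,
        cfc_mul g (fun t => max (t - δ) 0) X hgc.continuousOn (continuous_max_sub δ).continuousOn,
        mul_sub, mul_one, mul_assoc, hu, softThreshold]
    rw [h1]
    refine hnorm _ (by fun_prop) δ hδ.le fun t ht => ?_
    rcases le_total t δ with h | h
    · rw [max_eq_right (sub_nonpos.2 h), mul_zero, sub_zero, mul_one, abs_of_nonneg ht]
      exact h
    · have ht0 : 0 < t := hδ.trans_le h
      have : t * (1 - g t * max (t - δ) 0) = δ := by
        rw [max_eq_left (sub_nonneg.2 h), hg]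
        simp only [max_eq_left h]
        field_simp
        ring
      rw [this, abs_of_pos hδ]

end NFSTrace

namespace NFSTrace

variable {M : VonNeumannAlgebra H} {τ : NFSTrace M} {b x y : H →L[ℂ] H}

/-! ### Duality, Minkowski's and Hölder's inequalities -/

/-- The estimate of `tr (a x b ^ (1 - 1 / p))` that holds when `‖x‖_p ≤ K`, by Hölder's inequality
with exponents `p` and `q = p / (p - 1)`. -/
def DualBound (τ : NFSTrace M) (p K : ℝ) (x : H →L[ℂ] H) : Prop :=
  ∀ a ∈ M, ‖a‖ ≤ 1 → ∀ b, τ.FiniteMoments b →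
    ‖τ.tr (a * x * b ^ (1 - 1 / p))‖ ≤ K * τ.moment b 1 ^ (1 - 1 / p)

lemma DualBound.add {p K L : ℝ} (hx : τ.DualBound p K x) (hy : τ.DualBound p L y) :
    τ.DualBound p (K + L) (x + y) := by
  intro a ha ha1 b hb
  rw [mul_add, add_mul, _root_.map_add, add_mul]
  exact (norm_add_le _ _).trans (add_le_add (hx a ha ha1 b hb) (hy a ha ha1 b hb))

lemma DualBound.smul {p K : ℝ} (hx : τ.DualBound p K x) {C : ℝ} (hC : 0 ≤ C) :
    τ.DualBound p (C * K) (C • x) := by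
  intro a ha ha1 b hb
  rw [mul_smul_comm, smul_mul_assoc, ← Complex.coe_smul, _root_.map_smul, norm_smul,
    Complex.norm_real, Real.norm_of_nonneg hC, mul_assoc C]
  exact mul_le_mul_of_nonneg_left (hx a ha ha1 b hb) hC

/-- The converse of Hölder's inequality. It is tested on `b = u ^ p` with `u = (|x| - δ)₊` and on
`a = w*`, where `w = x / max |x| δ`: then `a x b ^ (1 - 1 / p) ≥ u ^ p`. -/
theorem lpNorm_le_of_dualBound {p : ℝ} (hp : 1 ≤ p) {K : ℝ} (hK : 0 ≤ K) (hx : τ.HS x)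
    (h : τ.DualBound p K x) : τ.lpNorm p x ≤ ENNReal.ofReal K := by
  have hp0 : 0 < p := by linarith
  have hp1 : 0 ≤ p - 1 := by linarith
  set X := CFC.abs x with hX
  have hX0 : 0 ≤ X := CFC.abs_nonneg x
  have hXM : X ∈ M := VonNeumannAlgebra.abs_mem hx.1
  have hXsa := IsSelfAdjoint.of_nonneg hX0
  have hid : cfc (fun t : ℝ => t) X = X := cfc_id' ℝ X hXsa
  have hXX : X * X = star x * x := CFC.abs_mul_abs x
  have hsq : cfc (fun t : ℝ => t ^ 2) X = star x * x := by
    rw [cfc_pow_id (R := ℝ) X 2, sq, hXX]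
  have hX2 : X ^ (2 : ℝ) = star x * x := by
    rw [← hXX, ← sq, ← CFC.rpow_natCast X 2]; norm_num
  have hXabs : τ.lpNorm p x = τ.lpNorm p X := by
    rw [lpNorm, lpNorm, CFC.abs_of_nonneg X hX0]
  rw [hXabs]
  refine lpNorm_le_of_tendsto hp0 (tendsto_softThreshold hX0)
    (Eventually.of_forall fun δ => VonNeumannAlgebra.cfc_mem hXM _) ?_
  filter_upwards [self_mem_nhdsWithin] with δ hδ
  have hδ : (0 : ℝ) < δ := hδ
  set u := softThreshold δ X with hu
  have hu0 : 0 ≤ u := softThreshold_nonneg _ _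
  have hfm : τ.FiniteMoments u := finiteMoments_softThreshold hXM hX0 two_pos
    (by rw [hX2]; exact hx.2) hδ
  set g : ℝ → ℝ := fun t => (max t δ)⁻¹ with hg
  have hmax : ∀ t : ℝ, 0 < max t δ := fun t => lt_max_of_lt_right hδ
  have hgc : Continuous g := Continuous.inv₀ (by fun_prop) fun t => (hmax t).ne'
  have hg0 : ∀ t, 0 ≤ g t := fun t => (inv_pos.2 (hmax t)).le
  have hgδ : ∀ t, g t ≤ δ⁻¹ := fun t => inv_anti₀ hδ (le_max_right _ _)
  set G := cfc g X with hG
  have hGM : G ∈ M := VonNeumannAlgebra.cfc_mem hXM g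
  have hGsa : star G = G := (cfc_predicate g X : IsSelfAdjoint G).star_eq
  have hw1 : ‖star (x * G)‖ ≤ 1 := by
    have e1 : star (x * G) * (x * G) = cfc (fun t => g t * t ^ 2 * g t) X := by
      calc star (x * G) * (x * G) = G * (star x * x) * G := by
            rw [star_mul, hGsa]; simp only [mul_assoc]
        _ = _ := by
            rw [← hsq, hG, ← cfc_mul g (fun t : ℝ => t ^ 2) X hgc.continuousOn (by fun_prop),
              ← cfc_mul (fun t => g t * t ^ 2) g X (by fun_prop) hgc.continuousOn]
    have e2 : ‖star (x * G) * (x * G)‖ ≤ 1 := by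
      rw [e1]
      refine norm_cfc_le_of_nonneg hX0 zero_le_one fun t ht _ => ?_
      have e3 : t * g t ≤ 1 := mul_inv_le_one_of_le₀ (le_max_left _ _) (hmax t).le
      have e4 : g t * t ^ 2 * g t = (t * g t) * (t * g t) := by ring
      rw [e4, abs_of_nonneg (mul_self_nonneg _)]
      exact mul_le_one₀ e3 (mul_nonneg ht (hg0 t)) e3
    rw [CStarRing.norm_star_mul_self] at e2
    rw [norm_star]
    nlinarith [norm_nonneg (x * G)]
  have hup : (u ^ p) ^ (1 - 1 / p) = u ^ (p - 1) := by
    rw [CFC.rpow_rpow_of_exponent_nonneg u p (1 - 1 / p) hp0.le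
      (by rw [sub_nonneg, div_le_one hp0]; exact hp) hu0]
    congr 1
    field_simp
  have hcp : Continuous fun t : ℝ => max (t - δ) 0 ^ (p - 1) :=
    (Real.continuous_rpow_const hp1).comp (continuous_max_sub δ)
  have hcpp : Continuous fun t : ℝ => max (t - δ) 0 ^ p :=
    (Real.continuous_rpow_const hp0.le).comp (continuous_max_sub δ)
  set F : ℝ → ℝ := fun t => g t * t ^ 2 * max (t - δ) 0 ^ (p - 1) with hF
  have hFc : Continuous F := (hgc.mul (continuous_pow 2)).mul hcp
  have hprod : star (x * G) * x * u ^ (p - 1) = cfc F X := by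
    calc star (x * G) * x * u ^ (p - 1) = G * (star x * x) * u ^ (p - 1) := by
          rw [star_mul, hGsa]; simp only [mul_assoc]
      _ = _ := by
          rw [← hsq, hu, softThreshold_rpow hp1 hX0, hG,
            ← cfc_mul g (fun t : ℝ => t ^ 2) X hgc.continuousOn (by fun_prop),
            ← cfc_mul (fun t => g t * t ^ 2) (fun t => max (t - δ) 0 ^ (p - 1)) X (by fun_prop)
              hcp.continuousOn]
  have hF0 : ∀ t, 0 ≤ F t := fun t =>
    mul_nonneg (mul_nonneg (hg0 t) (sq_nonneg t)) (Real.rpow_nonneg (le_max_right _ _) _)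
  have hle : τ.toFun (u ^ p) ≤ τ.toFun (cfc F X) := by
    rw [hu, softThreshold_rpow hp0.le hX0]
    refine τ.toFun_cfc_mono hXM hX0 (f := fun t => max (t - δ) 0 ^ p) hcpp hFc
      (fun t _ _ => Real.rpow_nonneg (le_max_right _ _) _) fun t ht _ => ?_
    rcases le_total t δ with h' | h'
    · rw [max_eq_right (sub_nonpos.2 h'), Real.zero_rpow hp0.ne']
      exact hF0 t
    · have ht0 : 0 < t := hδ.trans_le h'
      have e1 : (t - δ) ^ p = (t - δ) * (t - δ) ^ (p - 1) := by
        rw [← Real.rpow_one_add' (sub_nonneg.2 h') (by linarith)]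
        congr 1
        ring
      have e2 : F t = t * (t - δ) ^ (p - 1) := by
        simp only [hF, hg, max_eq_left h', max_eq_left (sub_nonneg.2 h')]
        field_simp
      rw [max_eq_left (sub_nonneg.2 h'), e1, e2]
      have := Real.rpow_nonneg (sub_nonneg.2 h') (p - 1)
      gcongr
      linarith
  have hfin : τ.toFun (cfc F X) < ∞ := by
    have hC : 0 ≤ δ⁻¹ * ‖X‖ ^ (p - 1) := by positivity
    refine (τ.toFun_cfc_mono hXM hX0 (g := fun t => δ⁻¹ * ‖X‖ ^ (p - 1) * t ^ 2) hFc
      (by fun_prop) (fun t _ _ => hF0 t) fun t ht htX => ?_).trans_lt ?_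
    · have e1 : max (t - δ) 0 ^ (p - 1) ≤ ‖X‖ ^ (p - 1) :=
        Real.rpow_le_rpow (le_max_right _ _) (max_le (by linarith) (norm_nonneg _)) hp1
      have e2 := hgδ t
      calc F t = g t * max (t - δ) 0 ^ (p - 1) * t ^ 2 := by simp only [hF]; ring
        _ ≤ δ⁻¹ * ‖X‖ ^ (p - 1) * t ^ 2 := by
          gcongr
    · have hsq0 : 0 ≤ cfc (fun t : ℝ => t ^ 2) X := hsq ▸ star_mul_self_nonneg x
      rw [τ.toFun_const_mul_cfc hXM (continuous_pow 2) hC hsq0, hsq]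
      exact ENNReal.mul_lt_top ENNReal.ofReal_lt_top hx.2
  have hmain := h (star (x * G)) (star_mem (mul_mem hx.1 hGM)) hw1 (u ^ p) (hfm.rpow hp0)
  rw [hup, hprod, τ.tr_eq (VonNeumannAlgebra.cfc_mem hXM F) (cfc_nonneg fun t _ => hF0 t) hfin,
    Complex.norm_real, Real.norm_of_nonneg ENNReal.toReal_nonneg] at hmain
  set T := τ.moment (u ^ p) 1 with hT
  have hT0 : 0 ≤ T := moment_nonneg _ _
  have hTeq : T = (τ.toFun (u ^ p)).toReal := by
    rw [hT, moment, CFC.rpow_one _ CFC.rpow_nonneg]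
  have hT1 : T ≤ K * T ^ (1 - 1 / p) := by
    rw [hTeq] at hmain ⊢
    exact (ENNReal.toReal_mono hfin.ne hle).trans hmain
  have hTK : T ≤ K ^ p := by
    rcases hT0.eq_or_lt with h0 | h0
    · rw [← h0]; positivity
    · have e1 : T ^ (1 / p) ≤ K := by
        have e2 : T = T ^ (1 / p) * T ^ (1 - 1 / p) := by
          rw [← Real.rpow_add h0, add_sub_cancel, Real.rpow_one]
        refine le_of_mul_le_mul_right ?_ (Real.rpow_pos_of_pos h0 (1 - 1 / p))
        rwa [← e2]
      calc T = (T ^ (1 / p)) ^ p := by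
            rw [← Real.rpow_mul hT0, one_div_mul_cancel hp0.ne', Real.rpow_one]
        _ ≤ K ^ p := Real.rpow_le_rpow (Real.rpow_nonneg hT0 _) e1 hp0.le
  rw [lpNorm_le_iff hp0, CFC.abs_of_nonneg u hu0, ENNReal.ofReal_rpow_of_nonneg hK hp0.le,
    ← ENNReal.ofReal_toReal (hfm.2.2 p hp0).ne, ← hTeq]
  exact ENNReal.ofReal_le_ofReal hTK

lemma lpNorm_le_of_approx {p : ℝ} (hp : 1 ≤ p) {K : ℝ} (hK : 0 ≤ K)
    (h : ∀ δ : ℝ, 0 < δ → ∃ z, τ.HS z ∧ τ.DualBound p K z ∧ ‖x - z‖ ≤ δ) :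
    τ.lpNorm p x ≤ ENNReal.ofReal K := by
  choose z hz hzd hzx using fun n : ℕ => h (1 / ((n : ℝ) + 1)) (by positivity)
  refine lpNorm_le_of_tendsto (l := atTop) (z := z) (by linarith) ?_
    (Eventually.of_forall fun n => (hz n).1)
    (Eventually.of_forall fun n => lpNorm_le_of_dualBound hp hK (hz n) (hzd n))
  rw [tendsto_iff_norm_sub_tendsto_zero]
  refine squeeze_zero (fun n => norm_nonneg _) (fun n => ?_) tendsto_one_div_add_atTop_nhds_zero_nat
  rw [norm_sub_rev]
  exact hzx n

lemma one_sub_one_div_nonneg {p : ℝ} (hp : 1 ≤ p) : 0 ≤ 1 - 1 / p := by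
  rw [sub_nonneg, div_le_one (by linarith)]; exact hp

lemma dualBound_mul_rpow_mul {p K : ℝ} (hp : 1 ≤ p) {w c : H →L[ℂ] H} (hw : w ∈ M) (hc : c ∈ M)
    (hw1 : ‖w‖ ≤ 1) (hc1 : ‖c‖ ≤ 1) (hb : τ.FiniteMoments b)
    (hbK : τ.moment b 1 ^ (1 / p) ≤ K) : τ.DualBound p K (w * b ^ (1 / p) * c) := by
  intro a ha ha1 d hd
  have hp0 : 0 < p := by linarith
  have h := norm_tr_mul_rpow_le hb hd hd (mul_mem ha hw) hc (one_mem M) (norm_mul_le_one ha1 hw1)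
    hc1 norm_one_le_one (θ₁ := 1 / p) (θ₂ := 1 - 1 / p) (θ₃ := 0) (by positivity)
    (one_sub_one_div_nonneg hp) le_rfl (by ring)
  rw [CFC.rpow_zero d hd.2.1, mul_one, mul_one, Real.rpow_zero, mul_one] at h
  calc ‖τ.tr (a * (w * b ^ (1 / p) * c) * d ^ (1 - 1 / p))‖
      = ‖τ.tr (a * w * b ^ (1 / p) * c * d ^ (1 - 1 / p))‖ := by simp only [mul_assoc]
    _ ≤ τ.moment b 1 ^ (1 / p) * τ.moment d 1 ^ (1 - 1 / p) := h
    _ ≤ K * τ.moment d 1 ^ (1 - 1 / p) :=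
      mul_le_mul_of_nonneg_right hbK (Real.rpow_nonneg (moment_nonneg _ _) _)

/-- Minkowski's inequality. -/
theorem lpNorm_add_le {p : ℝ} (hp : 1 ≤ p) {K L : ℝ} (hK : 0 ≤ K) (hL : 0 ≤ L) (hx : x ∈ M)
    (hy : y ∈ M) (hxK : τ.lpNorm p x ≤ ENNReal.ofReal K) (hyL : τ.lpNorm p y ≤ ENNReal.ofReal L) :
    τ.lpNorm p (x + y) ≤ ENNReal.ofReal (K + L) := by
  have hp0 : 0 < p := by linarith
  refine lpNorm_le_of_approx hp (by positivity) fun δ hδ => ?_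
  obtain ⟨w, hw, hw1, b, hb, hbK, hbx⟩ := exists_factorization hp0 hK hx hxK (half_pos hδ)
  obtain ⟨v, hv, hv1, c, hc, hcL, hcy⟩ := exists_factorization hp0 hL hy hyL (half_pos hδ)
  refine ⟨w * b ^ (1 / p) + v * c ^ (1 / p), ((hb.hs_rpow (by positivity)).mul_left hw).add
    ((hc.hs_rpow (by positivity)).mul_left hv), DualBound.add ?_ ?_, ?_⟩
  · simpa using dualBound_mul_rpow_mul hp hw (one_mem M) hw1 norm_one_le_one hb hbK
  · simpa using dualBound_mul_rpow_mul hp hv (one_mem M) hv1 norm_one_le_one hc hcL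
  · rw [add_sub_add_comm]
    exact (norm_add_le _ _).trans (by linarith)

/-- The `p`-norm of a multiple of `a x c`, with contractions `a` and `c`. -/
theorem lpNorm_smul_mul_mul_le {p : ℝ} (hp : 1 ≤ p) {K C : ℝ} (hK : 0 ≤ K) (hC : 0 ≤ C)
    (hx : x ∈ M) (hxK : τ.lpNorm p x ≤ ENNReal.ofReal K) {a c : H →L[ℂ] H} (ha : a ∈ M)
    (hc : c ∈ M) (ha1 : ‖a‖ ≤ 1) (hc1 : ‖c‖ ≤ 1) :
    τ.lpNorm p (C • (a * x * c)) ≤ ENNReal.ofReal (C * K) := by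
  have hp0 : 0 < p := by linarith
  refine lpNorm_le_of_approx hp (by positivity) fun δ hδ => ?_
  have hC1 : 0 < C + 1 := by linarith
  obtain ⟨w, hw, hw1, b, hb, hbK, hbx⟩ := exists_factorization hp0 hK hx hxK (div_pos hδ hC1)
  refine ⟨C • (a * w * b ^ (1 / p) * c), ?_,
    (dualBound_mul_rpow_mul hp (mul_mem ha hw) hc (norm_mul_le_one ha1 hw1) hc1 hb hbK).smul hC, ?_⟩
  · rw [← Complex.coe_smul]
    exact (((hb.hs_rpow (by positivity)).mul_left (mul_mem ha hw)).mul_right hc).smul _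
  · have e : C • (a * x * c) - C • (a * w * b ^ (1 / p) * c) =
        C • (a * (x - w * b ^ (1 / p)) * c) := by
      rw [← smul_sub, mul_sub, sub_mul]
      simp only [mul_assoc]
    rw [e, norm_smul, Real.norm_of_nonneg hC]
    have e1 : ‖a * (x - w * b ^ (1 / p)) * c‖ ≤ δ / (C + 1) := by
      calc ‖a * (x - w * b ^ (1 / p)) * c‖ ≤ ‖a‖ * ‖x - w * b ^ (1 / p)‖ * ‖c‖ := norm_mul₃_le
        _ ≤ 1 * (δ / (C + 1)) * 1 := by gcongr
        _ = _ := by ring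
    calc C * ‖a * (x - w * b ^ (1 / p)) * c‖ ≤ (C + 1) * (δ / (C + 1)) := by gcongr; linarith
      _ = δ := by field_simp

/-- An operator of norm at most `C` is `C` times a contraction, also for `C = 0`. -/
lemma exists_contraction_smul {a : H →L[ℂ] H} (ha : a ∈ M) {C : ℝ} (hC : ‖a‖ ≤ C) :
    ∃ d ∈ M, ‖d‖ ≤ 1 ∧ a = C • d := by
  rcases (norm_nonneg a |>.trans hC).eq_or_lt with h | h
  · refine ⟨0, zero_mem M, by simp, ?_⟩
    rw [smul_zero]
    exact norm_le_zero_iff.1 (by rwa [← h] at hC)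
  · refine ⟨C⁻¹ • a, VonNeumannAlgebra.real_smul_mem _ ha, ?_, by rw [smul_inv_smul₀ h.ne']⟩
    rw [norm_smul, norm_inv, Real.norm_of_nonneg h.le, inv_mul_le_iff₀ h]
    simpa using hC

lemma lpNorm_mul_le_left {p : ℝ} (hp : 1 ≤ p) {K C : ℝ} (hK : 0 ≤ K) (hx : x ∈ M)
    (hxK : τ.lpNorm p x ≤ ENNReal.ofReal K) {a : H →L[ℂ] H} (ha : a ∈ M) (hC : ‖a‖ ≤ C) :
    τ.lpNorm p (a * x) ≤ ENNReal.ofReal (C * K) := by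
  obtain ⟨d, hd, hd1, rfl⟩ := exists_contraction_smul ha hC
  have := lpNorm_smul_mul_mul_le hp hK ((norm_nonneg _).trans hC) hx hxK hd (one_mem M) hd1
    norm_one_le_one
  rwa [mul_one, ← smul_mul_assoc] at this

lemma lpNorm_mul_le_right {p : ℝ} (hp : 1 ≤ p) {K C : ℝ} (hK : 0 ≤ K) (hx : x ∈ M)
    (hxK : τ.lpNorm p x ≤ ENNReal.ofReal K) {a : H →L[ℂ] H} (ha : a ∈ M) (hC : ‖a‖ ≤ C) :
    τ.lpNorm p (x * a) ≤ ENNReal.ofReal (K * C) := by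
  obtain ⟨d, hd, hd1, rfl⟩ := exists_contraction_smul ha hC
  have := lpNorm_smul_mul_mul_le hp hK ((norm_nonneg _).trans hC) hx hxK (one_mem M) hd
    norm_one_le_one hd1
  rwa [one_mul, ← mul_smul_comm, mul_comm C] at this

/-- Hölder's inequality. -/
theorem lpNorm_mul_le {p q s : ℝ} (hp : 0 < p) (hq : 0 < q) (hs : 1 ≤ s)
    (hpqs : 1 / p + 1 / q = 1 / s) {K L : ℝ} (hK : 0 ≤ K) (hL : 0 ≤ L) (hx : x ∈ M) (hy : y ∈ M)
    (hxK : τ.lpNorm p x ≤ ENNReal.ofReal K) (hyL : τ.lpNorm q y ≤ ENNReal.ofReal L) :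
    τ.lpNorm s (x * y) ≤ ENNReal.ofReal (K * L) := by
  refine lpNorm_le_of_approx hs (by positivity) fun δ hδ => ?_
  set C := ‖x‖ + ‖y‖ + 1 with hC
  have hC0 : 0 < C := by positivity
  have hδ' : 0 < min 1 (δ / C) := lt_min one_pos (by positivity)
  obtain ⟨w, hw, hw1, b, hb, hbK, hbx⟩ := exists_factorization hp hK hx hxK hδ'
  obtain ⟨v, hv, hv1, c, hc, hcL, hcy⟩ := exists_factorization hq hL hy hyL hδ'
  have hv' : v * c ^ (1 / q) ∈ M := mul_mem hv (VonNeumannAlgebra.rpow_mem hc.1 hc.2.1 _)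
  refine ⟨w * b ^ (1 / p) * (v * c ^ (1 / q)),
    ((hb.hs_rpow (by positivity)).mul_left hw).mul_right hv', ?_, ?_⟩
  · intro a ha ha1 d hd
    have h := norm_tr_mul_rpow_le hb hc hd (mul_mem ha hw) hv (one_mem M) (norm_mul_le_one ha1 hw1)
      hv1 norm_one_le_one (θ₁ := 1 / p) (θ₂ := 1 / q) (θ₃ := 1 - 1 / s) (by positivity)
      (by positivity) (one_sub_one_div_nonneg hs) (by rw [hpqs]; ring)
    rw [mul_one] at h
    calc ‖τ.tr (a * (w * b ^ (1 / p) * (v * c ^ (1 / q))) * d ^ (1 - 1 / s))‖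
        = ‖τ.tr (a * w * b ^ (1 / p) * v * c ^ (1 / q) * d ^ (1 - 1 / s))‖ := by
          simp only [mul_assoc]
      _ ≤ τ.moment b 1 ^ (1 / p) * τ.moment c 1 ^ (1 / q) * τ.moment d 1 ^ (1 - 1 / s) := h
      _ ≤ K * L * τ.moment d 1 ^ (1 - 1 / s) :=
        mul_le_mul_of_nonneg_right
          (mul_le_mul hbK hcL (Real.rpow_nonneg (moment_nonneg _ _) _) hK)
          (Real.rpow_nonneg (moment_nonneg _ _) _)
  · set x' := w * b ^ (1 / p)
    set y' := v * c ^ (1 / q)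
    have h1 : ‖y'‖ ≤ ‖y‖ + 1 := by
      calc ‖y'‖ = ‖y - (y - y')‖ := by rw [sub_sub_cancel]
        _ ≤ ‖y‖ + ‖y - y'‖ := norm_sub_le _ _
        _ ≤ ‖y‖ + 1 := by gcongr; exact hcy.trans (min_le_left _ _)
    have h2 : ‖x - x'‖ ≤ δ / C := hbx.trans (min_le_right _ _)
    have h3 : ‖y - y'‖ ≤ δ / C := hcy.trans (min_le_right _ _)
    calc ‖x * y - x' * y'‖ = ‖x * (y - y') + (x - x') * y'‖ := by congr 1; noncomm_ring
      _ ≤ ‖x‖ * ‖y - y'‖ + ‖x - x'‖ * ‖y'‖ :=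
        (norm_add_le _ _).trans (add_le_add (norm_mul_le _ _) (norm_mul_le _ _))
      _ ≤ ‖x‖ * (δ / C) + δ / C * (‖y‖ + 1) := by gcongr
      _ = (δ / C) * C := by rw [hC]; ring
      _ = δ := by field_simp

end NFSTrace

namespace NFSTrace

variable {M : VonNeumannAlgebra H} {τ : NFSTrace M} {x y : H →L[ℂ] H}

/-! ### Operators of a given order of smallness -/

/-- Since the elements of `M` are bounded, `𝓛_r` is contained in `𝓛_s` for `r ≤ s`. -/
lemma lpNorm_lt_top_of_le {r s : ℝ} (hr : 0 < r) (hrs : r ≤ s) (hx : x ∈ M)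
    (h : τ.lpNorm r x < ∞) : τ.lpNorm s x < ∞ := by
  have hs : 0 < s := hr.trans_le hrs
  set X := CFC.abs x with hX
  have hX0 : 0 ≤ X := CFC.abs_nonneg x
  have hXM : X ∈ M := VonNeumannAlgebra.abs_mem hx
  have h1 : τ.toFun (X ^ r) < ∞ := by
    rw [lpNorm] at h
    exact (ENNReal.rpow_lt_top_iff_of_pos (by positivity)).1 h
  rw [lpNorm]
  refine (ENNReal.rpow_lt_top_iff_of_pos (by positivity)).2 ?_
  have h0 : 0 ≤ X ^ r := CFC.rpow_nonneg
  rw [← hX, CFC.rpow_eq_cfc_real hX0]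
  rw [CFC.rpow_eq_cfc_real hX0] at h1 h0
  have hC : 0 ≤ ‖X‖ ^ (s - r) := by positivity
  refine (τ.toFun_cfc_mono hXM hX0 (g := fun t => ‖X‖ ^ (s - r) * t ^ r)
    (Real.continuous_rpow_const hs.le)
    (continuous_const.mul (Real.continuous_rpow_const hr.le)) (fun t ht _ => by positivity)
    (fun t ht htx => ?_)).trans_lt ?_
  · calc t ^ s = t ^ (s - r) * t ^ r := by
          rw [← Real.rpow_add_of_nonneg ht (by linarith) hr.le, sub_add_cancel]
      _ ≤ ‖X‖ ^ (s - r) * t ^ r := by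
          have := Real.rpow_le_rpow ht htx (sub_nonneg.2 hrs)
          gcongr
  · rw [τ.toFun_const_mul_cfc hXM (Real.continuous_rpow_const hr.le) hC h0]
    exact ENNReal.mul_lt_top ENNReal.ofReal_lt_top h1

/-- The set of the operators that are bounded by `R` as a product of `k` elements of `𝓛_r` is: in
operator norm and in the norms `‖·‖_{r/j}` for `1 ≤ j ≤ k`, as far as `r / j ≥ 1`. -/
def gradedBall (τ : NFSTrace M) (r : ℝ) (k : ℕ) (R : ℝ) : Set (H →L[ℂ] H) :=
  {x | x ∈ M ∧ ‖x‖ ≤ R ∧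
    ∀ j : ℕ, 1 ≤ j → j ≤ k → (j : ℝ) ≤ r → τ.lpNorm (r / j) x ≤ ENNReal.ofReal R}

variable {r R S : ℝ} {k l : ℕ}

lemma nonneg_of_mem_gradedBall (hx : x ∈ τ.gradedBall r k R) : 0 ≤ R :=
  (norm_nonneg x).trans hx.2.1

lemma gradedBall_mono {k' : ℕ} (hk : k' ≤ k) (hR : R ≤ S) :
    τ.gradedBall r k R ⊆ τ.gradedBall r k' S :=
  fun _ hx => ⟨hx.1, hx.2.1.trans hR, fun j hj hjk hjr =>
    (hx.2.2 j hj (hjk.trans hk) hjr).trans (ENNReal.ofReal_le_ofReal hR)⟩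

lemma mem_gradedBall_zero (hx : x ∈ M) (h : ‖x‖ ≤ R) : x ∈ τ.gradedBall r 0 R :=
  ⟨hx, h, fun j hj hj0 => by omega⟩

lemma mem_gradedBall_one (hx : x ∈ M) (h : ‖x‖ ≤ R) (hr : τ.lpNorm r x ≤ ENNReal.ofReal R) :
    x ∈ τ.gradedBall r 1 R :=
  ⟨hx, h, fun j hj hj1 _ => by
    obtain rfl : j = 1 := by omega
    simpa using hr⟩

lemma one_le_div {j : ℕ} (hj : 1 ≤ j) (hjr : (j : ℝ) ≤ r) : 1 ≤ r / j := by
  rwa [le_div_iff₀ (by exact_mod_cast hj), one_mul]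

/-- Orders add up under products: in Hölder's inequality the reciprocals `j / r` of the exponents
`r / j` add up. -/
lemma mul_mem_gradedBall (hx : x ∈ τ.gradedBall r k R) (hy : y ∈ τ.gradedBall r l S) :
    x * y ∈ τ.gradedBall r (k + l) (R * S) := by
  have hR := nonneg_of_mem_gradedBall hx
  have hS := nonneg_of_mem_gradedBall hy
  refine ⟨mul_mem hx.1 hy.1, (norm_mul_le _ _).trans (mul_le_mul hx.2.1 hy.2.1 (norm_nonneg _) hR),
    fun j hj hjkl hjr => ?_⟩
  have hp := one_le_div hj hjr
  rcases le_or_gt j k with hjk | hjk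
  · exact lpNorm_mul_le_right hp hR hx.1 (hx.2.2 j hj hjk hjr) hy.1 hy.2.1
  rcases le_or_gt j l with hjl | hjl
  · exact lpNorm_mul_le_left hp hS hy.1 (hy.2.2 j hj hjl hjr) hx.1 hx.2.1
  -- both factors are needed: `j = k + (j - k)`
  obtain ⟨i, rfl⟩ := Nat.exists_eq_add_of_lt hjk
  have hk : 1 ≤ k := by omega
  have hk0 : (0 : ℝ) < k := by exact_mod_cast hk
  have hi0 : (0 : ℝ) < (i + 1 : ℕ) := by positivity
  have hr0 : 0 < r := lt_of_lt_of_le (by exact_mod_cast hj) hjr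
  have hkr : (k : ℝ) ≤ r := le_trans (by exact_mod_cast (by omega)) hjr
  have hir : ((i + 1 : ℕ) : ℝ) ≤ r := le_trans (by exact_mod_cast (by omega)) hjr
  refine lpNorm_mul_le (p := r / k) (q := r / (i + 1 : ℕ)) (by positivity) (by positivity) hp ?_
    hR hS hx.1 hy.1 (hx.2.2 k hk le_rfl hkr) (hy.2.2 (i + 1) (by omega) (by omega) hir)
  rw [one_div_div, one_div_div, one_div_div]
  push_cast
  ring

lemma add_mem_gradedBall (hx : x ∈ τ.gradedBall r k R) (hy : y ∈ τ.gradedBall r k S) :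
    x + y ∈ τ.gradedBall r k (R + S) :=
  ⟨add_mem hx.1 hy.1, (norm_add_le _ _).trans (add_le_add hx.2.1 hy.2.1), fun j hj hjk hjr =>
    lpNorm_add_le (one_le_div hj hjr) (nonneg_of_mem_gradedBall hx) (nonneg_of_mem_gradedBall hy)
      hx.1 hy.1 (hx.2.2 j hj hjk hjr) (hy.2.2 j hj hjk hjr)⟩

lemma smul_mem_gradedBall (c : ℂ) (hx : x ∈ τ.gradedBall r k R) :
    c • x ∈ τ.gradedBall r k (‖c‖ * R) := by
  have h1 : ‖c • (1 : H →L[ℂ] H)‖ ≤ ‖c‖ := by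
    rw [norm_smul]
    exact mul_le_of_le_one_right (norm_nonneg _) norm_one_le_one
  have := mul_mem_gradedBall (mem_gradedBall_zero (τ := τ) (r := r)
    (VonNeumannAlgebra.smul_mem c (one_mem M)) h1) hx
  simpa using this

lemma zero_mem_gradedBall : (0 : H →L[ℂ] H) ∈ τ.gradedBall r k 0 := by
  refine ⟨zero_mem M, by simp, fun j hj _ hjr => ?_⟩
  have h0 : 0 < r / j := by
    have := one_le_div hj hjr
    linarith
  have h1 : (0 : H →L[ℂ] H) ^ (r / j) = 0 := CFC.zero_rpow h0.ne'
  rw [lpNorm, CFC.abs_zero, h1, τ.toFun_zero, ENNReal.zero_rpow_of_pos (by positivity)]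
  simp

lemma sum_mem_gradedBall {ι : Type*} (s : Finset ι) {f : ι → H →L[ℂ] H} {g : ι → ℝ}
    (h : ∀ i ∈ s, f i ∈ τ.gradedBall r k (g i)) :
    ∑ i ∈ s, f i ∈ τ.gradedBall r k (∑ i ∈ s, g i) := by
  classical
  induction s using Finset.induction_on with
  | empty => simpa using zero_mem_gradedBall
  | insert i s hi ih =>
    rw [Finset.sum_insert hi, Finset.sum_insert hi]
    exact add_mem_gradedBall (h i (by simp)) (ih fun j hj => h j (by simp [hj]))

lemma isClosed_gradedBall (τ : NFSTrace M) (r : ℝ) (k : ℕ) (R : ℝ) :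
    IsClosed (τ.gradedBall r k R) := by
  refine IsSeqClosed.isClosed fun z x hz h => ?_
  refine ⟨M.isClosed.mem_of_tendsto h (Eventually.of_forall fun n => (hz n).1),
    le_of_tendsto h.norm (Eventually.of_forall fun n => (hz n).2.1), fun j hj hjk hjr => ?_⟩
  exact lpNorm_le_of_tendsto (lt_of_lt_of_le one_pos (one_le_div hj hjr)) h
    (Eventually.of_forall fun n => (hz n).1)
    (Eventually.of_forall fun n => (hz n).2.2 j hj hjk hjr)

lemma convex_gradedBall (τ : NFSTrace M) (r : ℝ) (k : ℕ) (R : ℝ) :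
    Convex ℝ (τ.gradedBall r k R) := by
  intro x hx y hy a b ha hb hab
  have h := add_mem_gradedBall (smul_mem_gradedBall (a : ℂ) hx) (smul_mem_gradedBall (b : ℂ) hy)
  rw [Complex.coe_smul, Complex.coe_smul, Complex.norm_real, Complex.norm_real,
    Real.norm_of_nonneg ha, Real.norm_of_nonneg hb, ← add_mul, hab, one_mul] at h
  exact h

lemma tsum_mem_gradedBall {ι : Type*} {f : ι → H →L[ℂ] H} {g : ι → ℝ} (hg : Summable g)
    (h : ∀ i, f i ∈ τ.gradedBall r k (g i)) : ∑' i, f i ∈ τ.gradedBall r k (∑' i, g i) := by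
  have hf : Summable f := hg.of_norm_bounded fun i => (h i).2.1
  refine (isClosed_gradedBall τ r k _).mem_of_tendsto hf.hasSum (Eventually.of_forall fun s => ?_)
  exact gradedBall_mono le_rfl (hg.sum_le_tsum s fun i _ => nonneg_of_mem_gradedBall (h i))
    (sum_mem_gradedBall s fun i _ => h i)

end NFSTrace

/-! ### Derivatives of ordered products -/

section OrderedProducts

variable {𝔸 : Type*} [NormedRing 𝔸]

/-- A family of conditions `P k R x`, read "`x` is of order `k` and of size at most `R`", which is
compatible with the ring operations: orders add up and sizes multiply under products. -/
structure IsGradedBound (P : ℕ → ℝ → 𝔸 → Prop) : Prop where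
  zero : ∀ k, P k 0 0
  one : P 0 1 1
  add : ∀ {k R S x y}, P k R x → P k S y → P k (R + S) (x + y)
  mul : ∀ {k l R S x y}, P k R x → P l S y → P (k + l) (R * S) (x * y)
  mono : ∀ {k R S x}, R ≤ S → P k R x → P k S x

namespace IsGradedBound

variable {P : ℕ → ℝ → 𝔸 → Prop}

lemma sum (hP : IsGradedBound P) {ι : Type*} (s : Finset ι) {k : ℕ} {R : ι → ℝ} {x : ι → 𝔸}
    (h : ∀ i ∈ s, P k (R i) (x i)) : P k (∑ i ∈ s, R i) (∑ i ∈ s, x i) := by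
  classical
  induction s using Finset.induction_on with
  | empty => simpa using hP.zero k
  | insert a s ha ih =>
    rw [Finset.sum_insert ha, Finset.sum_insert ha]
    exact hP.add (h a (Finset.mem_insert_self a s))
      (ih fun i hi => h i (Finset.mem_insert_of_mem hi))

lemma natCast_mul (hP : IsGradedBound P) {k : ℕ} {R : ℝ} {x : 𝔸} (c : ℕ) (h : P k R x) :
    P k (c * R) (c * x) := by
  simpa using hP.sum (Finset.range c) (fun _ _ => h)

lemma listProd (hP : IsGradedBound P) {ι : Type*} (L : List ι) {k : ι → ℕ} {R : ι → ℝ}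
    {x : ι → 𝔸} (h : ∀ i, P (k i) (R i) (x i)) :
    P (L.map k).sum (L.map R).prod (L.map x).prod := by
  induction L with
  | nil => simpa using hP.one
  | cons a L ih => simpa using hP.mul (h a) ih

end IsGradedBound

variable [NormedAlgebra ℝ 𝔸]

/-- `f` behaves at `t`, as far as the condition `P` can see, like a product of `N` affine functions
of size at most `ρ` and slope at most `v * ρ`. -/
def DerivBound (P : ℕ → ℝ → 𝔸 → Prop) (v ρ : ℝ) (N : ℕ) (f : ℝ → 𝔸) (t : ℝ) : Prop :=
  ∀ i : ℕ, P i ((v * N) ^ i * ρ ^ N) (iteratedDeriv i f t)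

namespace DerivBound

variable {P : ℕ → ℝ → 𝔸 → Prop} {v ρ t : ℝ} {N N' : ℕ} {f g : ℝ → 𝔸}

lemma one (hP : IsGradedBound P) : DerivBound P v ρ 0 (fun _ => (1 : 𝔸)) t := by
  intro i
  rw [iteratedDeriv_const]
  rcases eq_or_ne i 0 with rfl | hi
  · simpa using hP.one
  · simpa [hi] using hP.zero i

lemma mul (hP : IsGradedBound P) (hf : ContDiff ℝ ⊤ f) (hg : ContDiff ℝ ⊤ g)
    (h : DerivBound P v ρ N f t) (h' : DerivBound P v ρ N' g t) :
    DerivBound P v ρ (N + N') (fun s => f s * g s) t := by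
  intro n
  rw [iteratedDeriv_fun_mul ((hf.of_le le_top).contDiffAt) ((hg.of_le le_top).contDiffAt)]
  have := hP.sum (Finset.range (n + 1)) (k := n)
    (R := fun i => (n.choose i : ℝ) * (((v * N) ^ i * ρ ^ N) * ((v * N') ^ (n - i) * ρ ^ N')))
    (x := fun i => (n.choose i : 𝔸) * (iteratedDeriv i f t * iteratedDeriv (n - i) g t))
    (fun i hi => hP.natCast_mul _ (by
      have h1 := hP.mul (h i) (h' (n - i))
      rwa [Nat.add_sub_cancel' (Nat.lt_succ_iff.1 (Finset.mem_range.1 hi))] at h1))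
  convert this using 1
  · push_cast
    rw [mul_add, add_pow, Finset.sum_mul]
    refine Finset.sum_congr rfl fun i _ => ?_
    ring
  · simp only [mul_assoc]

lemma pow (hP : IsGradedBound P) (hf : ContDiff ℝ ⊤ f) (h : DerivBound P v ρ 1 f t) (k : ℕ) :
    DerivBound P v ρ k (fun s => f s ^ k) t := by
  induction k with
  | zero => simpa using one hP
  | succ k ih =>
    simp only [pow_succ]
    exact mul hP (hf.pow k) hf ih h

lemma listProd (hP : IsGradedBound P) {ι : Type*} (L : List ι) {N : ι → ℕ} {f : ι → ℝ → 𝔸}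
    (hf : ∀ i, ContDiff ℝ ⊤ (f i)) (h : ∀ i, DerivBound P v ρ (N i) (f i) t) :
    ContDiff ℝ ⊤ (fun s => (L.map fun i => f i s).prod) ∧
      DerivBound P v ρ (L.map N).sum (fun s => (L.map fun i => f i s).prod) t := by
  induction L with
  | nil => exact ⟨by simpa using contDiff_const, by simpa using one hP⟩
  | cons a L ih =>
    simp only [List.map_cons, List.prod_cons, List.sum_cons]
    exact ⟨(hf a).mul ih.1, mul hP (hf a) ih.1 (h a) ih.2⟩

end DerivBound

lemma contDiff_affine (a b : 𝔸) : ContDiff ℝ ⊤ (fun s : ℝ => a + s • b) :=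
  contDiff_const.add (contDiff_id.smul contDiff_const)

lemma deriv_affine (a b : 𝔸) : deriv (fun s : ℝ => a + s • b) = fun _ => b := by
  ext t
  have h : HasDerivAt (fun s : ℝ => a + s • b) ((1 : ℝ) • b) t :=
    ((hasDerivAt_id t).smul_const b).const_add a
  rw [h.deriv, one_smul]

lemma DerivBound.affine {P : ℕ → ℝ → 𝔸 → Prop} (hP : IsGradedBound P) {v ρ t : ℝ} {a b : 𝔸}
    (hv : 0 ≤ v) (hρ : 1 ≤ ρ) (ha : P 0 ρ (a + t • b)) (hb : P 1 v b) :
    DerivBound P v ρ 1 (fun s => a + s • b) t := by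
  intro i
  rcases i with _ | i
  · simpa using ha
  · rw [iteratedDeriv_succ', deriv_affine, iteratedDeriv_const]
    rcases eq_or_ne i 0 with rfl | hi
    · simpa using hP.mono (le_mul_of_one_le_right hv hρ) hb
    · rw [if_neg hi]
      exact hP.mono (by positivity) (hP.zero _)

lemma sum_antidiagonalTuple_succ {E : Type*} [AddCommMonoid E] (n m : ℕ)
    (F : (Fin (n + 1) → ℕ) → E) :
    ∑ α ∈ Finset.Nat.antidiagonalTuple (n + 1) m, F α =
      ∑ i ∈ Finset.range (m + 1), ∑ α ∈ Finset.Nat.antidiagonalTuple n (m - i),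
        F (Fin.cons i α) := by
  rw [Finset.sum_sigma']
  refine Finset.sum_bij' (fun α _ => ⟨α 0, Fin.tail α⟩) (fun x _ => Fin.cons x.1 x.2) ?_ ?_ ?_ ?_ ?_
  · intro α hα
    have h := Finset.Nat.mem_antidiagonalTuple.1 hα
    rw [Fin.sum_univ_succ] at h
    simp only [Finset.mem_sigma, Finset.mem_range, Finset.Nat.mem_antidiagonalTuple, Fin.tail]
    omega
  · rintro ⟨i, α⟩ h
    simp only [Finset.mem_sigma, Finset.mem_range, Finset.Nat.mem_antidiagonalTuple] at h
    rw [Finset.Nat.mem_antidiagonalTuple, Fin.sum_univ_succ]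
    simp only [Fin.cons_zero, Fin.cons_succ]
    omega
  · intro α _
    exact Fin.cons_self_tail α
  · rintro ⟨i, α⟩ _
    simp
  · intro α _
    simp

/-- The Leibniz rule for an ordered product of finitely many factors. -/
theorem iteratedDeriv_list_prod {n : ℕ} {f : Fin n → ℝ → 𝔸} (hf : ∀ q, ContDiff ℝ ⊤ (f q))
    (m : ℕ) (t : ℝ) :
    iteratedDeriv m (fun s => ((List.finRange n).map fun q => f q s).prod) t =
      ∑ α ∈ Finset.Nat.antidiagonalTuple n m, ((m ! : ℝ) / ∏ q, ((α q)! : ℝ)) •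
        ((List.finRange n).map fun q => iteratedDeriv (α q) (f q) t).prod := by
  induction n generalizing m with
  | zero =>
    simp only [List.finRange_zero, List.map_nil, List.prod_nil, iteratedDeriv_const]
    rcases m with _ | m
    · simp
    · simp
  | succ n ih =>
    have hc : ContDiff ℝ ⊤ (fun s => ((List.finRange n).map fun q => f q.succ s).prod) := by
      generalize List.finRange n = L
      induction L with
      | nil => simpa using contDiff_const
      | cons a L ihL => simpa using (hf a.succ).mul ihL
    simp only [List.finRange_succ, List.map_cons, List.prod_cons, List.map_map,
      Function.comp_def]
    rw [iteratedDeriv_fun_mul ((hf 0).of_le le_top).contDiffAt (hc.of_le le_top).contDiffAt,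
      sum_antidiagonalTuple_succ]
    refine Finset.sum_congr rfl fun i hi => ?_
    have hi' : i ≤ m := Nat.lt_succ_iff.1 (Finset.mem_range.1 hi)
    rw [ih (fun q => hf q.succ), Finset.mul_sum]
    refine Finset.sum_congr rfl fun α _ => ?_
    simp only [Fin.cons_zero, Fin.cons_succ, Fin.prod_univ_succ]
    rw [mul_smul_comm, mul_assoc, ← nsmul_eq_mul, ← Nat.cast_smul_eq_nsmul ℝ, smul_smul]
    congr 1
    rw [Nat.cast_choose ℝ hi']
    have h1 : ((m - i)! : ℝ) ≠ 0 := by positivity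
    have h2 : (i ! : ℝ) ≠ 0 := by positivity
    have h3 : (∏ q, ((α q)! : ℝ)) ≠ 0 := Finset.prod_ne_zero_iff.2 fun q _ => by positivity
    field_simp

end OrderedProducts

/-! ### Multi-indices supported on an increasing tuple -/

section MultiIndex

variable {n k m : ℕ} {j : Fin k → Fin n} {i : Fin k → ℕ}

/-- The multi-index of length `n` with the value `i l` at the position `j l`, and `0` at the
positions outside the range of `j`. -/
def extendTuple (j : Fin k → Fin n) (i : Fin k → ℕ) : Fin n → ℕ :=
  open Classical in fun q => if h : ∃ l, j l = q then i h.choose else 0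

lemma extendTuple_apply (hj : Function.Injective j) (l : Fin k) : extendTuple j i (j l) = i l := by
  have h : ∃ l', j l' = j l := ⟨l, rfl⟩
  rw [extendTuple, dif_pos h, hj h.choose_spec]

lemma extendTuple_of_notMem {q : Fin n} (hq : q ∉ Set.range j) : extendTuple j i q = 0 :=
  dif_neg hq

lemma sum_extendTuple (hj : Function.Injective j) : ∑ q, extendTuple j i q = ∑ l, i l :=
  (Fintype.sum_of_injective j hj _ _ (fun _ hq => extendTuple_of_notMem hq)
    fun l => (extendTuple_apply hj l).symm).symm

lemma prod_factorial_extendTuple (hj : Function.Injective j) :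
    ∏ q, ((extendTuple j i q)! : ℝ) = ∏ l, ((i l)! : ℝ) :=
  (Fintype.prod_of_injective j hj _ _ (fun q hq => by simp [extendTuple_of_notMem hq])
    fun l => by rw [extendTuple_apply hj l]).symm

lemma mem_increasingTuples : j ∈ increasingTuples k n ↔ StrictMono j := by
  simp [increasingTuples]

lemma mem_compositionTuples : i ∈ compositionTuples k m ↔ ∑ l, i l = m ∧ ∀ l, 1 ≤ i l := by
  simp [compositionTuples, Finset.Nat.mem_antidiagonalTuple]

lemma range_eq_support_extendTuple (hj : Function.Injective j) (hi : ∀ l, 1 ≤ i l) :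
    Set.range j = {q | extendTuple j i q ≠ 0} := by
  ext q
  refine ⟨?_, fun hq => by_contra fun h => hq (extendTuple_of_notMem h)⟩
  rintro ⟨l, rfl⟩
  have := hi l
  simp only [Set.mem_ofPred_eq, extendTuple_apply hj]
  omega

/-- Every multi-index of weight `m ≥ 1` is uniquely the extension of an increasing tuple (its
support) together with a composition of `m` (its nonzero values). -/
theorem sum_increasingTuples_compositionTuples {E : Type*} [AddCommGroup E] [Module ℝ E]
    (hm : 1 ≤ m) (G : (Fin n → ℕ) → E) :
    ∑ k ∈ Finset.Icc 1 m, ∑ j ∈ increasingTuples k n, ∑ i ∈ compositionTuples k m,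
        ((m ! : ℝ) / ∏ l, ((i l)! : ℝ)) • G (extendTuple j i) =
      ∑ α ∈ Finset.Nat.antidiagonalTuple n m, ((m ! : ℝ) / ∏ q, ((α q)! : ℝ)) • G α := by
  simp_rw [Finset.sum_sigma']
  refine Finset.sum_bij (fun x _ => extendTuple x.2.1 x.2.2) ?_ ?_ ?_ ?_
  · rintro ⟨k, j, i⟩ h
    simp only [Finset.mem_sigma, mem_increasingTuples, mem_compositionTuples] at h
    rw [Finset.Nat.mem_antidiagonalTuple, sum_extendTuple h.2.1.injective, h.2.2.1]
  · rintro ⟨k, j, i⟩ h ⟨k', j', i'⟩ h' he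
    simp only [Finset.mem_sigma, mem_increasingTuples, mem_compositionTuples] at h h' he
    have hr : Set.range j = Set.range j' := by
      rw [range_eq_support_extendTuple h.2.1.injective h.2.2.2,
        range_eq_support_extendTuple h'.2.1.injective h'.2.2.2, he]
    obtain rfl : k = k' := by
      have h1 := congrArg Set.ncard hr
      rw [← Set.image_univ, ← Set.image_univ, Set.ncard_image_of_injective _ h.2.1.injective,
        Set.ncard_image_of_injective _ h'.2.1.injective] at h1
      simpa [Set.ncard_univ] using h1
    obtain rfl : j = j' := (h.2.1.range_inj h'.2.1).1 hr
    obtain rfl : i = i' := by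
      ext l
      rw [← extendTuple_apply (i := i) h.2.1.injective l,
        ← extendTuple_apply (i := i') h.2.1.injective l, he]
    rfl
  · intro α hα
    rw [Finset.Nat.mem_antidiagonalTuple] at hα
    set S : Finset (Fin n) := Finset.univ.filter fun q => α q ≠ 0 with hS
    set j : Fin S.card → Fin n := fun l => S.orderEmbOfFin rfl l with hjdef
    have hj : StrictMono j := (S.orderEmbOfFin rfl).strictMono
    have hjr : Set.range j = S := S.range_orderEmbOfFin rfl
    have hjS : ∀ l, α (j l) ≠ 0 := fun l => (Finset.mem_filter.1 (S.orderEmbOfFin_mem rfl l)).2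
    have hext : extendTuple j (fun l => α (j l)) = α := by
      ext q
      by_cases hq : q ∈ Set.range j
      · obtain ⟨l, rfl⟩ := hq
        exact extendTuple_apply hj.injective l
      · rw [extendTuple_of_notMem hq]
        rw [hjr] at hq
        by_contra h0
        exact hq (by simp [hS, Ne.symm h0])
    have hsum : ∑ l, α (j l) = m := by
      rw [← hα, ← sum_extendTuple hj.injective, hext]
    have hcard : S.card ≤ m := by
      have h1 : ∑ _l : Fin S.card, 1 ≤ ∑ l, α (j l) :=
        Finset.sum_le_sum fun l _ => Nat.one_le_iff_ne_zero.2 (hjS l)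
      simpa [hsum] using h1
    have hpos : 1 ≤ S.card := by
      rw [Nat.one_le_iff_ne_zero, Ne, Finset.card_eq_zero]
      intro h0
      have h1 : ∀ q, α q = 0 := fun q => by
        by_contra hq
        have : q ∈ S := by simp [hS, hq]
        simp [h0] at this
      simp [h1] at hα
      omega
    refine ⟨⟨S.card, j, fun l => α (j l)⟩, ?_, hext⟩
    simp only [Finset.mem_sigma, mem_increasingTuples, mem_compositionTuples, Finset.mem_Icc]
    exact ⟨⟨hpos, hcard⟩, hj, hsum, fun l => Nat.one_le_iff_ne_zero.2 (hjS l)⟩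
  · rintro ⟨k, j, i⟩ h
    simp only [Finset.mem_sigma, mem_increasingTuples, mem_compositionTuples] at h
    rw [prod_factorial_extendTuple h.2.1.injective]

end MultiIndex

/-! ### Derivatives of monomials along the linear path -/

section Monomials

variable {n : ℕ} {A B : Fin n → H →L[ℂ] H} {t : ℝ}

lemma contDiff_linPath_pow (A B : Fin n → H →L[ℂ] H) (q : Fin n) (k : ℕ) :
    ContDiff ℝ ⊤ (fun s => linPath A B s q ^ k) :=
  (contDiff_affine (A q) (B q - A q)).pow k

lemma contDiff_opMonomial (A B : Fin n → H →L[ℂ] H) (κ : Fin n → ℕ) :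
    ContDiff ℝ ⊤ (fun s => opMonomial (linPath A B s) κ) := by
  unfold opMonomial
  generalize List.finRange n = L
  induction L with
  | nil => simpa using contDiff_const
  | cons a L ih => simpa using (contDiff_linPath_pow A B a (κ a)).mul ih

/-- The ordered product of the derivatives of order `α q` of `s ↦ X_q(s) ^ κ_q` at `t`. -/
def multiDerivMonomial (A B : Fin n → H →L[ℂ] H) (α : Fin n → ℕ) (t : ℝ) (κ : Fin n → ℕ) :
    H →L[ℂ] H :=
  ((List.finRange n).map fun q => iteratedDeriv (α q) (fun s => linPath A B s q ^ κ q) t).prod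

lemma derivMonomial_eq {k : ℕ} (j : Fin k → Fin n) (i : Fin k → ℕ) (κ : Fin n → ℕ) :
    derivMonomial A B j i t κ = multiDerivMonomial A B (extendTuple j i) t κ := by
  unfold derivMonomial multiDerivMonomial
  congr 2
  ext1 q
  by_cases h : ∃ l, j l = q
  · rw [dif_pos h, extendTuple, dif_pos h]
  · rw [dif_neg h, extendTuple, dif_neg h, iteratedDeriv_zero]

lemma iteratedDeriv_opMonomial (m : ℕ) (κ : Fin n → ℕ) :
    iteratedDeriv m (fun s => opMonomial (linPath A B s) κ) t =
      ∑ α ∈ Finset.Nat.antidiagonalTuple n m, ((m ! : ℝ) / ∏ q, ((α q)! : ℝ)) •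
        multiDerivMonomial A B α t κ :=
  iteratedDeriv_list_prod (f := fun q s => linPath A B s q ^ κ q)
    (fun q => contDiff_linPath_pow A B q (κ q)) m t

lemma bound_iteratedDeriv_opMonomial {P : ℕ → ℝ → (H →L[ℂ] H) → Prop} (hP : IsGradedBound P)
    {v ρ : ℝ} (hv : 0 ≤ v) (hρ : 1 ≤ ρ) (hX : ∀ q, P 0 ρ (linPath A B t q))
    (hV : ∀ q, P 1 v (B q - A q)) (m : ℕ) (κ : Fin n → ℕ) :
    P m ((v * (∑ q, κ q : ℕ)) ^ m * ρ ^ (∑ q, κ q))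
      (iteratedDeriv m (fun s => opMonomial (linPath A B s) κ) t) := by
  have h := (DerivBound.listProd hP (List.finRange n) (N := κ)
    (f := fun q s => linPath A B s q ^ κ q) (fun q => contDiff_linPath_pow A B q (κ q))
    (fun q => DerivBound.pow hP (contDiff_affine _ _)
      (DerivBound.affine hP hv hρ (hX q) (hV q)) (κ q))).2 m
  rwa [← Fin.sum_univ_def] at h

lemma isGradedBound_norm : IsGradedBound fun _ R (x : H →L[ℂ] H) => ‖x‖ ≤ R where
  zero _ := by simp
  one := norm_one_le_one
  add h h' := (norm_add_le _ _).trans (add_le_add h h')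
  mul h h' := (norm_mul_le _ _).trans (mul_le_mul h h' (norm_nonneg _) ((norm_nonneg _).trans h))
  mono h h' := h'.trans h

lemma isGradedBound_gradedBall {M : VonNeumannAlgebra H} (τ : NFSTrace M) (r : ℝ) :
    IsGradedBound fun k R x => x ∈ τ.gradedBall r k R where
  zero _ := NFSTrace.zero_mem_gradedBall
  one := NFSTrace.mem_gradedBall_zero (one_mem M) norm_one_le_one
  add := NFSTrace.add_mem_gradedBall
  mul := NFSTrace.mul_mem_gradedBall
  mono h h' := NFSTrace.gradedBall_mono le_rfl h h'

lemma norm_multiDerivMonomial_le {v ρ : ℝ} (hv : 0 ≤ v) (hρ : 1 ≤ ρ)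
    (hX : ∀ q, ‖linPath A B t q‖ ≤ ρ) (hV : ∀ q, ‖B q - A q‖ ≤ v) (α κ : Fin n → ℕ) :
    ‖multiDerivMonomial A B α t κ‖ ≤
      (v * (∑ q, κ q : ℕ)) ^ (∑ q, α q) * ρ ^ (∑ q, κ q) := by
  have h := isGradedBound_norm.listProd (List.finRange n) (k := α)
    (R := fun q => (v * κ q) ^ α q * ρ ^ κ q)
    (x := fun q => iteratedDeriv (α q) (fun s => linPath A B s q ^ κ q) t) (fun q =>
      DerivBound.pow isGradedBound_norm (contDiff_affine _ _)
        (DerivBound.affine isGradedBound_norm hv hρ (hX q) (hV q)) (κ q) (α q))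
  refine h.trans ?_
  rw [← Fin.prod_univ_def, Finset.prod_mul_distrib, Finset.prod_pow_eq_pow_sum,
    ← Finset.prod_pow_eq_pow_sum (a := v * _) (f := α)]
  refine mul_le_mul_of_nonneg_right (Finset.prod_le_prod (fun q _ => by positivity) fun q _ => ?_)
    (by positivity)
  gcongr
  exact Finset.single_le_sum (f := κ) (fun _ _ => Nat.zero_le _) (Finset.mem_univ q)

lemma norm_linPath_le (hA : ∀ q, ‖A q‖ ≤ 1) (hB : ∀ q, ‖B q‖ ≤ 1) (q : Fin n) :
    ‖linPath A B t q‖ ≤ |1 - t| + |t| := by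
  have h : linPath A B t q = (1 - t) • A q + t • B q := by
    simp only [linPath, smul_sub, sub_smul, one_smul]
    abel
  rw [h]
  refine (norm_add_le _ _).trans ?_
  rw [norm_smul, norm_smul, Real.norm_eq_abs, Real.norm_eq_abs]
  exact add_le_add (mul_le_of_le_one_right (abs_nonneg _) (hA q))
    (mul_le_of_le_one_right (abs_nonneg _) (hB q))

lemma norm_linPath_le_one (hA : ∀ q, ‖A q‖ ≤ 1) (hB : ∀ q, ‖B q‖ ≤ 1)
    (ht : t ∈ Set.Icc (0 : ℝ) 1) (q : Fin n) : ‖linPath A B t q‖ ≤ 1 := by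
  have h := norm_linPath_le (t := t) hA hB q
  rwa [abs_of_nonneg (sub_nonneg.2 ht.2), abs_of_nonneg ht.1, sub_add_cancel] at h

lemma norm_sub_le_two (hA : ∀ q, ‖A q‖ ≤ 1) (hB : ∀ q, ‖B q‖ ≤ 1) (q : Fin n) :
    ‖B q - A q‖ ≤ 2 :=
  (norm_sub_le _ _).trans (by linarith [hA q, hB q])

end Monomials

/-! ### Termwise differentiation of the operator power series -/

section Series

variable {n : ℕ} {f : (Fin n → ℂ) → ℂ} {c : (Fin n → ℕ) → ℂ} {A B : Fin n → H →L[ℂ] H} {t : ℝ}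

/-- The coefficients of a power series converging on the polydisc of radius `R'` remain summable
when multiplied by `ρ ^ |κ|`, `ρ < R'`, and by any power of the degree `|κ|`. -/
lemma summable_coeff {R' ρ : ℝ} (hc : HasPowerSeriesOnPolydisc f c R') (hρ : 0 ≤ ρ) (hρR : ρ < R')
    (w : ℝ) (m : ℕ) :
    Summable fun κ : Fin n → ℕ => ‖c κ‖ * ((w * (∑ q, κ q : ℕ)) ^ m * ρ ^ (∑ q, κ q)) := by
  obtain ⟨R, hR1, hR2⟩ := exists_between hρR
  have hR : 0 < R := hρ.trans_lt hR1
  have h1 : Summable fun κ : Fin n → ℕ => ‖c κ‖ * R ^ (∑ q, κ q) := by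
    have h := (hc (fun _ => (R : ℂ)) fun j => by
      rwa [Complex.norm_real, Real.norm_of_nonneg hR.le]).summable.norm
    refine h.congr fun κ => ?_
    rw [norm_mul, Finset.prod_pow_eq_pow_sum, norm_pow, Complex.norm_real,
      Real.norm_of_nonneg hR.le]
  have h2 : Tendsto (fun N : ℕ => (N : ℝ) ^ m * (ρ / R) ^ N) atTop (𝓝 0) :=
    tendsto_pow_const_mul_const_pow_of_abs_lt_one m (by
      rw [abs_of_nonneg (by positivity), div_lt_one hR]; exact hR1)
  obtain ⟨C, hC⟩ := h2.bddAbove_range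
  refine Summable.of_norm_bounded (h1.mul_left (|w| ^ m * C)) fun κ => ?_
  generalize (∑ q, κ q) = N
  have h3 : (N : ℝ) ^ m * (ρ / R) ^ N ≤ C := hC ⟨N, rfl⟩
  have h4 : ρ ^ N = (ρ / R) ^ N * R ^ N := by rw [← mul_pow, div_mul_cancel₀ _ hR.ne']
  have h5 : ‖‖c κ‖ * ((w * (N : ℝ)) ^ m * ρ ^ N)‖ =
      |w| ^ m * ((N : ℝ) ^ m * (ρ / R) ^ N) * (‖c κ‖ * R ^ N) := by
    rw [norm_mul, norm_mul, norm_norm, norm_pow, norm_mul, Real.norm_eq_abs, Real.norm_natCast,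
      norm_pow, Real.norm_of_nonneg hρ, h4]
    ring
  rw [h5]
  gcongr

/-- The series of the termwise derivatives of order `m`. -/
def termwiseDeriv (c : (Fin n → ℕ) → ℂ) (A B : Fin n → H →L[ℂ] H) (m : ℕ) (t : ℝ) : H →L[ℂ] H :=
  ∑' κ : Fin n → ℕ, c κ • iteratedDeriv m (fun s => opMonomial (linPath A B s) κ) t

lemma termwiseDeriv_zero :
    termwiseDeriv c A B 0 = fun s : ℝ => opFun c (linPath A B s) := by
  ext1 s
  simp [termwiseDeriv, opFun]

lemma hasDerivAt_termwiseDeriv {ε : ℝ} (hε : 0 < ε) (hc : HasPowerSeriesOnPolydisc f c (1 + ε))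
    (hA : ∀ q, ‖A q‖ ≤ 1) (hB : ∀ q, ‖B q‖ ≤ 1) (m : ℕ) (ht : t ∈ Set.Icc (0 : ℝ) 1) :
    HasDerivAt (termwiseDeriv c A B m) (termwiseDeriv c A B (m + 1) t) t := by
  -- On `(-ε/4, 1 + ε/4)` the path has norm at most `1 + ε/2`, still inside the polydisc, so that
  -- differentiation is two-sided also at the endpoints of `[0, 1]`.
  have key : ∀ s ∈ Set.Ioo (-(ε / 4)) (1 + ε / 4), ∀ (l : ℕ) (κ : Fin n → ℕ),
      ‖c κ • iteratedDeriv l (fun s => opMonomial (linPath A B s) κ) s‖ ≤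
        ‖c κ‖ * ((2 * (∑ q, κ q : ℕ)) ^ l * (1 + ε / 2) ^ (∑ q, κ q)) := by
    intro s hs l κ
    rw [norm_smul]
    refine mul_le_mul_of_nonneg_left ?_ (norm_nonneg _)
    refine bound_iteratedDeriv_opMonomial isGradedBound_norm zero_le_two (by linarith)
      (fun q => (norm_linPath_le hA hB q).trans ?_) (norm_sub_le_two hA hB) l κ
    rcases abs_cases (1 - s) with h | h <;> rcases abs_cases s with h' | h' <;>
      linarith [hs.1, hs.2]
  have hmem : t ∈ Set.Ioo (-(ε / 4)) (1 + ε / 4) := ⟨by linarith [ht.1], by linarith [ht.2]⟩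
  have hsum : ∀ l, Summable fun κ : Fin n → ℕ =>
      ‖c κ‖ * ((2 * (∑ q, κ q : ℕ)) ^ l * (1 + ε / 2) ^ (∑ q, κ q)) := fun l =>
    summable_coeff hc (by linarith) (by linarith) 2 l
  refine hasDerivAt_tsum_of_isPreconnected (hsum (m + 1)) isOpen_Ioo isPreconnected_Ioo
    (fun κ s hs => ?_) (fun κ s hs => key s hs (m + 1) κ) hmem
    ((hsum m).of_norm_bounded fun κ => key t hmem m κ) hmem
  rw [iteratedDeriv_succ]
  have h := ((contDiff_opMonomial A B κ).of_le (m := ((m + 1 : ℕ) : WithTop ℕ∞))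
    le_top).differentiable_iteratedDeriv m (by exact_mod_cast Nat.lt_succ_self m)
  exact (h s).hasDerivAt.const_smul (c κ)

section

variable {E : Type*} [NormedAddCommGroup E] [NormedSpace ℝ E] {G : ℕ → ℝ → E}

/-- If every `G m` has the derivative `G (m + 1)`, the `G m` are the iterated derivatives of
`G 0`. -/
lemma iteratedDerivWithin_eq_of_hasDerivAt
    (hG : ∀ m, ∀ t ∈ Set.Icc (0 : ℝ) 1, HasDerivAt (G m) (G (m + 1) t) t) (m : ℕ) :
    ∀ t ∈ Set.Icc (0 : ℝ) 1, iteratedDerivWithin m (G 0) (Set.Icc 0 1) t = G m t := by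
  induction m with
  | zero => intro t _; simp
  | succ m ih =>
    intro t ht
    rw [iteratedDerivWithin_succ, derivWithin_congr ih (ih t ht)]
    exact (hG m t ht).hasDerivWithinAt.derivWithin (uniqueDiffOn_Icc zero_lt_one t ht)

lemma contDiffOn_of_hasDerivAt
    (hG : ∀ m, ∀ t ∈ Set.Icc (0 : ℝ) 1, HasDerivAt (G m) (G (m + 1) t) t) (m : ℕ) :
    ContDiffOn ℝ m (G 0) (Set.Icc 0 1) := by
  refine contDiffOn_of_differentiableOn_deriv fun l _ => ?_
  have h : DifferentiableOn ℝ (G l) (Set.Icc 0 1) := fun t ht =>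
    (hG l t ht).differentiableAt.differentiableWithinAt
  exact h.congr (iteratedDerivWithin_eq_of_hasDerivAt hG l)

/-- **Mean value theorem**: the difference quotients of a curve lie in any closed convex set that
contains its derivatives. -/
lemma slope_mem_of_hasDerivAt [CompleteSpace E] {S : Set E} (hS : Convex ℝ S) (hc : IsClosed S)
    {g g' : ℝ → E} {a b : ℝ} (hab : a ≠ b) (hg : ∀ u ∈ Set.uIcc a b, HasDerivAt g (g' u) u)
    (hg' : ContinuousOn g' (Set.uIcc a b)) (hmem : ∀ u ∈ Set.uIcc a b, g' u ∈ S) :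
    (b - a)⁻¹ • (g b - g a) ∈ S := by
  have hi : IntervalIntegrable g' MeasureTheory.volume a b := hg'.intervalIntegrable
  rw [← intervalIntegral.integral_eq_sub_of_hasDerivAt hg hi, ← interval_average_eq]
  refine hS.set_average_mem hc ?_ ?_ ?_ hi.def'
  · simpa [Set.uIoc, Real.volume_Ioc] using fun h => lt_of_le_of_ne h hab.symm
  · simp [Set.uIoc, Real.volume_Ioc]
  · exact (MeasureTheory.ae_restrict_iff' measurableSet_uIoc).2
      (Eventually.of_forall fun u hu => hmem u (Set.uIoc_subset_uIcc hu))

end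

lemma summable_multiDerivMonomial {ε : ℝ} (hε : 0 < ε) (hc : HasPowerSeriesOnPolydisc f c (1 + ε))
    (hA : ∀ q, ‖A q‖ ≤ 1) (hB : ∀ q, ‖B q‖ ≤ 1) (ht : t ∈ Set.Icc (0 : ℝ) 1) (α : Fin n → ℕ) :
    Summable fun κ => ‖c κ • multiDerivMonomial A B α t κ‖ := by
  refine Summable.of_nonneg_of_le (fun _ => norm_nonneg _) (fun κ => ?_)
    (summable_coeff hc zero_le_one (by linarith) 2 (∑ q, α q))
  rw [norm_smul]
  exact mul_le_mul_of_nonneg_left (norm_multiDerivMonomial_le zero_le_two le_rfl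
    (norm_linPath_le_one hA hB ht) (norm_sub_le_two hA hB) α κ) (norm_nonneg _)

/-- Leibniz' rule for the monomials, summed over the series. -/
lemma termwiseDeriv_eq_sum {ε : ℝ} (hε : 0 < ε) (hc : HasPowerSeriesOnPolydisc f c (1 + ε))
    (hA : ∀ q, ‖A q‖ ≤ 1) (hB : ∀ q, ‖B q‖ ≤ 1) (ht : t ∈ Set.Icc (0 : ℝ) 1) (m : ℕ) :
    termwiseDeriv c A B m t = ∑ α ∈ Finset.Nat.antidiagonalTuple n m,
      ((m ! : ℝ) / ∏ q, ((α q)! : ℝ)) • ∑' κ, c κ • multiDerivMonomial A B α t κ := by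
  have hs := fun α => (summable_multiDerivMonomial hε hc hA hB ht α).of_norm
  simp_rw [termwiseDeriv, iteratedDeriv_opMonomial, Finset.smul_sum, smul_comm (c _) (_ : ℝ)]
  rw [Summable.tsum_finsetSum fun α _ => (hs α).const_smul _]
  exact Finset.sum_congr rfl fun α _ => (hs α).tsum_const_smul _

/-! ### Differentiability in the noncommutative `L_p` norms -/

variable {M : VonNeumannAlgebra H} {τ : NFSTrace M}

lemma linPath_mem (hAM : ∀ q, A q ∈ M) (hBM : ∀ q, B q ∈ M) (q : Fin n) : linPath A B t q ∈ M :=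
  add_mem (hAM q) (VonNeumannAlgebra.real_smul_mem t (sub_mem (hBM q) (hAM q)))

/-- If the directions `V_j` lie in `𝓛_r`, the derivatives of order `m` of the operator function are
uniformly of order `m` along the path. -/
lemma exists_termwiseDeriv_mem_gradedBall {ε : ℝ} (hε : 0 < ε)
    (hc : HasPowerSeriesOnPolydisc f c (1 + ε)) (hAM : ∀ q, A q ∈ M) (hBM : ∀ q, B q ∈ M)
    (hA : ∀ q, ‖A q‖ ≤ 1) (hB : ∀ q, ‖B q‖ ≤ 1) {r : ℝ} (hV : ∀ q, τ.lpNorm r (B q - A q) < ∞)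
    (m : ℕ) : ∃ R, ∀ t ∈ Set.Icc (0 : ℝ) 1, termwiseDeriv c A B m t ∈ τ.gradedBall r m R := by
  set v : ℝ := 2 + ∑ q, (τ.lpNorm r (B q - A q)).toReal with hv
  have h0 : ∀ q, 0 ≤ (τ.lpNorm r (B q - A q)).toReal := fun q => ENNReal.toReal_nonneg
  have hv2 : 2 ≤ v := le_add_of_nonneg_right (Finset.sum_nonneg fun q _ => h0 q)
  have hvq : ∀ q, τ.lpNorm r (B q - A q) ≤ ENNReal.ofReal v := fun q => by
    rw [← ENNReal.ofReal_toReal (hV q).ne]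
    refine ENNReal.ofReal_le_ofReal ?_
    have := Finset.single_le_sum (fun q _ => h0 q) (Finset.mem_univ q)
    linarith
  refine ⟨_, fun t ht => NFSTrace.tsum_mem_gradedBall
    (summable_coeff hc zero_le_one (by linarith) v m) fun κ => ?_⟩
  refine NFSTrace.smul_mem_gradedBall (c κ) ?_
  exact bound_iteratedDeriv_opMonomial (isGradedBound_gradedBall τ r) (by linarith) le_rfl
    (fun q => NFSTrace.mem_gradedBall_zero (linPath_mem hAM hBM q)
      (norm_linPath_le_one hA hB ht q))
    (fun q => NFSTrace.mem_gradedBall_one (sub_mem (hBM q) (hAM q))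
      ((norm_sub_le_two hA hB q).trans hv2) (hvq q)) m κ

lemma NFSTrace.lpNorm_le_of_mem_gradedBall {r R : ℝ} {m : ℕ} {x : H →L[ℂ] H} (hm : 1 ≤ m)
    (hmr : (m : ℝ) ≤ r) (hx : x ∈ τ.gradedBall r m R) :
    τ.lpNorm (r / m) x ≤ ENNReal.ofReal R :=
  hx.2.2 m hm le_rfl hmr

lemma tendsto_ofReal_abs_sub_mul (t R : ℝ) (s : Set ℝ) :
    Tendsto (fun u : ℝ => ENNReal.ofReal (|u - t| * R)) (𝓝[s] t) (𝓝 0) := by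
  have h : Continuous fun u : ℝ => ENNReal.ofReal (|u - t| * R) :=
    ENNReal.continuous_ofReal.comp (by fun_prop)
  have := (h.tendsto t).mono_left (nhdsWithin_le_nhds (s := s))
  simpa using this

/-- The case `p = r / m` with `r ≥ m` of the differentiability in `‖·‖_p`. -/
lemma hasLpDerivAt_termwiseDeriv {ε : ℝ} (hε : 0 < ε)
    (hc : HasPowerSeriesOnPolydisc f c (1 + ε)) (hAM : ∀ q, A q ∈ M) (hBM : ∀ q, B q ∈ M)
    (hA : ∀ q, ‖A q‖ ≤ 1) (hB : ∀ q, ‖B q‖ ≤ 1) {r : ℝ} (hV : ∀ q, τ.lpNorm r (B q - A q) < ∞)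
    {m : ℕ} (hmr : ((m + 1 : ℕ) : ℝ) ≤ r) :
    (∀ t ∈ Set.Icc (0 : ℝ) 1, τ.HasLpDerivAt (r / (m + 1 : ℕ)) (termwiseDeriv c A B m)
        (termwiseDeriv c A B (m + 1) t) t) ∧
      τ.LpContinuous (r / (m + 1 : ℕ)) (termwiseDeriv c A B (m + 1)) := by
  set G := termwiseDeriv c A B with hGdef
  have hG : ∀ l, ∀ t ∈ Set.Icc (0 : ℝ) 1, HasDerivAt (G l) (G (l + 1) t) t := fun l t ht =>
    hasDerivAt_termwiseDeriv hε hc hA hB l ht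
  have hcont : ∀ l, ContinuousOn (G l) (Set.Icc 0 1) := fun l t ht =>
    (hG l t ht).continuousAt.continuousWithinAt
  have hsub : ∀ {s t : ℝ}, s ∈ Set.Icc (0 : ℝ) 1 → t ∈ Set.Icc (0 : ℝ) 1 →
      Set.uIcc t s ⊆ Set.Icc 0 1 := fun hs ht => Set.uIcc_subset_Icc ht hs
  obtain ⟨R₀, hR₀⟩ := exists_termwiseDeriv_mem_gradedBall hε hc hAM hBM hA hB hV (m + 1)
  obtain ⟨R, hR⟩ := exists_termwiseDeriv_mem_gradedBall hε hc hAM hBM hA hB hV (m + 1 + 1)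
  -- By the mean value theorem `G (m + 1)` is Lipschitz for the gauge of the graded balls.
  have h1 : ∀ s ∈ Set.Icc (0 : ℝ) 1, ∀ t ∈ Set.Icc (0 : ℝ) 1,
      G (m + 1) s - G (m + 1) t ∈ τ.gradedBall r (m + 1) (|s - t| * R) := by
    intro s hs t ht
    rcases eq_or_ne t s with rfl | hts
    · simpa using NFSTrace.zero_mem_gradedBall
    have h := slope_mem_of_hasDerivAt (NFSTrace.convex_gradedBall τ r (m + 1) R)
      (NFSTrace.isClosed_gradedBall τ r (m + 1) R) hts
      (fun u hu => hG (m + 1) u (hsub hs ht hu)) ((hcont (m + 1 + 1)).mono (hsub hs ht))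
      (fun u hu => NFSTrace.gradedBall_mono (Nat.le_succ _) le_rfl (hR u (hsub hs ht hu)))
    have h' := NFSTrace.smul_mem_gradedBall ((s - t : ℝ) : ℂ) h
    rwa [Complex.coe_smul, smul_smul, mul_inv_cancel₀ (sub_ne_zero.2 hts.symm), one_smul,
      Complex.norm_real, Real.norm_eq_abs] at h'
  have hRnn : 0 ≤ R := NFSTrace.nonneg_of_mem_gradedBall (hR 0 ⟨le_rfl, zero_le_one⟩)
  refine ⟨fun t ht => ⟨⟨(hR₀ t ht).1, lt_of_le_of_lt
    (NFSTrace.lpNorm_le_of_mem_gradedBall (Nat.succ_pos m) hmr (hR₀ t ht))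
    ENNReal.ofReal_lt_top⟩, ?_⟩, fun t ht => ?_⟩
  · refine tendsto_of_tendsto_of_tendsto_of_le_of_le' tendsto_const_nhds
      (tendsto_ofReal_abs_sub_mul t R _) (Eventually.of_forall fun _ => bot_le) ?_
    filter_upwards [self_mem_nhdsWithin] with s hs
    refine NFSTrace.lpNorm_le_of_mem_gradedBall (Nat.succ_pos m) hmr ?_
    have hne : t ≠ s := fun h => hs.2 h.symm
    -- The mean value theorem for `u ↦ G m u - u • G (m + 1) t`, whose derivative is
    -- `G (m + 1) u - G (m + 1) t`.
    have hd : ∀ u ∈ Set.uIcc t s, HasDerivAt (fun u => G m u - u • G (m + 1) t)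
        (G (m + 1) u - G (m + 1) t) u := fun u hu => by
      have h := (hG m u (hsub hs.1 ht hu)).sub ((hasDerivAt_id u).smul_const (G (m + 1) t))
      rwa [one_smul] at h
    have h := slope_mem_of_hasDerivAt (NFSTrace.convex_gradedBall τ r (m + 1) (|s - t| * R))
      (NFSTrace.isClosed_gradedBall τ r (m + 1) _) hne hd
      (((hcont (m + 1)).mono (hsub hs.1 ht)).sub continuousOn_const) (fun u hu => ?_)
    · convert h using 1
      have h2 : s - t ≠ 0 := sub_ne_zero.2 hne.symm
      rw [sub_sub_sub_comm, ← sub_smul, smul_sub _ (G m s - G m t), smul_smul,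
        inv_mul_cancel₀ h2, one_smul]
    · refine NFSTrace.gradedBall_mono le_rfl ?_ (h1 u (hsub hs.1 ht hu) t ht)
      have h3 : |u - t| ≤ |s - t| := Set.abs_sub_left_of_mem_uIcc hu
      gcongr
  · refine tendsto_of_tendsto_of_tendsto_of_le_of_le' tendsto_const_nhds
      (tendsto_ofReal_abs_sub_mul t R _) (Eventually.of_forall fun _ => bot_le) ?_
    filter_upwards [self_mem_nhdsWithin] with s hs
    exact NFSTrace.lpNorm_le_of_mem_gradedBall (Nat.succ_pos m) hmr (h1 s hs t ht)

end Series

/-! ### Power series of holomorphic functions on polydiscs -/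

section PowerSeries

open Real in
/-- Cauchy's integral formula on the torus of radius `R`. -/
lemma torusIntegral_cauchy {n : ℕ} {ρ R : ℝ} (hR : 0 < R) (hRρ : R < ρ) {f : (Fin n → ℂ) → ℂ}
    (hf : DifferentiableOn ℂ f (polydisc n ρ)) {z : Fin n → ℂ} (hz : z ∈ polydisc n R) :
    torusIntegral (fun w => (∏ j, (w j - z j)⁻¹) * f w) 0 (fun _ => R) =
      (2 * π * Complex.I) ^ n * f z := by
  induction n with
  | zero => simp [Subsingleton.elim z 0]
  | succ n ih =>
    have hnorm : ∀ θ : Fin (n + 1) → ℝ, ∀ j, ‖torusMap 0 (fun _ => R) θ j‖ = R := fun θ j => by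
      simp [torusMap, Complex.norm_exp_ofReal_mul_I, abs_of_pos hR]
    have hint : TorusIntegrable (fun w => (∏ j, (w j - z j)⁻¹) * f w) 0 (fun _ => R) := by
      refine ContinuousOn.integrableOn_compact isCompact_Icc ?_
      have hcm : Continuous (torusMap (0 : Fin (n + 1) → ℂ) fun _ => R) := by
        unfold torusMap
        fun_prop
      refine ContinuousOn.mul (continuousOn_finsetProd _ fun j _ => ContinuousOn.inv₀ ?_ ?_) ?_
      · exact (((continuous_apply j).comp hcm).sub continuous_const).continuousOn
      · intro θ _ h0
        have h1 := hnorm θ j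
        rw [sub_eq_zero.1 h0] at h1
        exact (hz j).ne h1
      · refine hf.continuousOn.comp hcm.continuousOn fun θ _ j => ?_
        rw [hnorm]
        exact hRρ
    have hz' : Fin.tail z ∈ polydisc n R := fun j => hz j.succ
    rw [torusIntegral_succ hint]
    -- The inner integral is evaluated by the induction hypothesis, the outer one by the Cauchy
    -- formula in one variable.
    have hcons : ∀ x : ℂ, ‖x‖ ≤ R → DifferentiableOn ℂ (fun y => f (Fin.cons x y))
        (polydisc n ρ) := fun x hx => by
      refine hf.comp (f := fun y : Fin n → ℂ => (Fin.cons x y : Fin (n + 1) → ℂ)) ?_ ?_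
      · refine (differentiable_pi.2 fun j => ?_).differentiableOn
        refine Fin.cases ?_ (fun j => ?_) j
        · simp
        · simp only [Fin.cons_succ]
          fun_prop
      · intro y hy j
        refine Fin.cases ?_ (fun j => ?_) j
        · simpa using hx.trans_lt hRρ
        · simpa using hy j
    have h1 : ∀ x ∈ Metric.sphere (0 : ℂ) R,
        torusIntegral (fun y : Fin n → ℂ =>
          (∏ j, ((Fin.cons x y : Fin (n + 1) → ℂ) j - z j)⁻¹) * f (Fin.cons x y))
            0 (fun _ => R) =
          (x - z 0)⁻¹ • ((2 * π * Complex.I) ^ n * f (Fin.cons x (Fin.tail z))) := by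
      intro x hx
      have h2 := ih (hcons x (le_of_eq (by simpa using hx))) hz'
      rw [← h2, smul_eq_mul, ← torusIntegral_const_mul]
      congr 1
      ext y
      rw [Fin.prod_univ_succ]
      simp only [Fin.cons_zero, Fin.cons_succ, Fin.tail]
      ring
    have h2 := circleIntegral.integral_congr (c := 0) hR.le h1
    have hd : DifferentiableOn ℂ (fun x : ℂ => (2 * π * Complex.I) ^ n *
        f (Fin.cons x (Fin.tail z))) (Metric.ball 0 ρ) := by
      refine DifferentiableOn.const_mul ?_ _
      refine hf.comp (f := fun x : ℂ => (Fin.cons x (Fin.tail z) : Fin (n + 1) → ℂ)) ?_ ?_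
      · refine (differentiable_pi.2 fun j => ?_).differentiableOn
        refine Fin.cases ?_ (fun j => ?_) j
        · simp
        · simp
      · intro x hx j
        refine Fin.cases ?_ (fun j => ?_) j
        · simpa using hx
        · simpa using (hz' j).trans hRρ
    have h3 := (DifferentiableOn.diffContOnCl_ball hd
      (Metric.closedBall_subset_ball hRρ)).circleIntegral_sub_inv_smul
        (w := z 0) (by simpa using hz 0)
    rw [Fin.cons_self_tail, smul_eq_mul] at h3
    rw [pow_succ', mul_assoc, ← h3, ← h2]
    rfl

/-- The geometric series in several variables. -/
lemma hasSum_prod_geometric {n : ℕ} {x : Fin n → ℂ} (hx : ∀ j, ‖x j‖ < 1) :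
    HasSum (fun κ : Fin n → ℕ => ∏ j, x j ^ κ j) (∏ j, (1 - x j)⁻¹) := by
  have key : Summable (fun κ : Fin n → ℕ => ‖∏ j, x j ^ κ j‖) ∧
      HasSum (fun κ : Fin n → ℕ => ∏ j, x j ^ κ j) (∏ j, (1 - x j)⁻¹) := by
    induction n with
    | zero =>
      exact ⟨Summable.of_finite, by simp⟩
    | succ n ih =>
      obtain ⟨h1, h2⟩ := ih (x := fun j => x j.succ) fun j => hx j.succ
      have h3 : Summable fun k : ℕ => ‖x 0 ^ k‖ := by
        simpa using summable_geometric_of_lt_one (norm_nonneg _) (hx 0)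
      have h4 : HasSum (fun k : ℕ => x 0 ^ k) (1 - x 0)⁻¹ := hasSum_geometric_of_norm_lt_one (hx 0)
      have hn : Summable fun p : ℕ × (Fin n → ℕ) => ‖x 0 ^ p.1 * ∏ j, x j.succ ^ p.2 j‖ := by
        simpa using h3.mul_norm h1
      have hs := h4.mul h2 hn.of_norm
      constructor
      · rw [← (Fin.consEquiv (fun _ : Fin (n + 1) => ℕ)).summable_iff]
        refine hn.congr fun p => ?_
        simp [Fin.prod_univ_succ, Fin.consEquiv]
      · rw [← (Fin.consEquiv (fun _ : Fin (n + 1) => ℕ)).hasSum_iff]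
        rw [Fin.prod_univ_succ]
        refine hs.congr_fun ?_
        intro p
        simp [Fin.prod_univ_succ, Fin.consEquiv]
  exact key.2

open Real MeasureTheory in
/-- Expanding the Cauchy kernel gives the power series on any smaller polydisc. -/
lemma exists_hasPowerSeriesOnPolydisc_of_lt {n : ℕ} {ρ R : ℝ} (hR : 0 < R) (hRρ : R < ρ)
    {f : (Fin n → ℂ) → ℂ} (hf : DifferentiableOn ℂ f (polydisc n ρ)) :
    ∃ c, HasPowerSeriesOnPolydisc f c R := by
  set T : (Fin n → ℝ) → Fin n → ℂ := torusMap 0 fun _ => R with hT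
  have hnorm : ∀ θ j, ‖T θ j‖ = R := fun θ j => by
    simp [hT, torusMap, Complex.norm_exp_ofReal_mul_I, abs_of_pos hR]
  have hT0 : ∀ θ j, T θ j ≠ 0 := fun θ j h => by
    have := hnorm θ j
    rw [h, norm_zero] at this
    exact hR.ne this
  have hTc : Continuous T := by
    rw [hT]
    unfold torusMap
    fun_prop
  have hfc : Continuous fun θ => f (T θ) :=
    hf.continuousOn.comp_continuous hTc fun θ j => by rw [hnorm]; exact hRρ
  set J : (Fin n → ℝ) → ℂ := fun θ => ∏ i, ((R : ℂ) * Complex.exp (θ i * Complex.I) * Complex.I)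
    with hJ
  have hJc : Continuous J := by
    rw [hJ]
    fun_prop
  have hK : IsCompact (Set.Icc (0 : Fin n → ℝ) fun _ => 2 * π) := isCompact_Icc
  obtain ⟨C, hC⟩ := hK.exists_bound_of_continuousOn (hJc.mul hfc).continuousOn
  set a : ℂ := (2 * π * Complex.I) ^ n with ha
  have ha0 : a ≠ 0 := pow_ne_zero _ (by simp [Real.pi_ne_zero])
  refine ⟨fun κ => a⁻¹ * torusIntegral (fun w => (∏ j, (w j)⁻¹ ^ (κ j + 1)) * f w) 0 fun _ => R,
    fun z hz => ?_⟩
  set K : Set (Fin n → ℝ) := Set.Icc (0 : Fin n → ℝ) fun _ => 2 * π with hKdef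
  set q : Fin n → ℝ := fun j => ‖z j‖ / R with hq
  have hq1 : ∀ j, ‖((q j : ℝ) : ℂ)‖ < 1 := fun j => by
    rw [Complex.norm_real, Real.norm_of_nonneg (by positivity), div_lt_one hR]
    exact hz j
  have hqs : Summable fun κ : Fin n → ℕ => C * R⁻¹ ^ n * ∏ j, q j ^ κ j := by
    refine Summable.mul_left _ ?_
    have h := (hasSum_prod_geometric hq1).summable
    exact_mod_cast h
  have hsum : HasSum (fun κ : Fin n → ℕ => ∫ θ in K, J θ *
      ((∏ j, (T θ j)⁻¹ ^ (κ j + 1)) * f (T θ) * ∏ j, z j ^ κ j))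
      (∫ θ in K, J θ * ((∏ j, (T θ j - z j)⁻¹) * f (T θ))) := by
    refine hasSum_integral_of_dominated_convergence
      (fun κ _ => C * R⁻¹ ^ n * ∏ j, q j ^ κ j) (fun κ => ?_) (fun κ => ?_)
      (Eventually.of_forall fun θ => hqs) ?_ (Eventually.of_forall fun θ => ?_)
    · refine ContinuousOn.aestronglyMeasurable ?_ measurableSet_Icc
      refine (hJc.mul (((continuous_finsetProd _ fun j _ => ?_).mul hfc).mul
        continuous_const)).continuousOn
      exact (((continuous_apply j).comp hTc).inv₀ fun θ => hT0 θ j).pow _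
    · refine (ae_restrict_iff' measurableSet_Icc).2 (Eventually.of_forall fun θ hθ => ?_)
      have h1 : ‖∏ j, (T θ j)⁻¹ ^ (κ j + 1)‖ * ‖∏ j, z j ^ κ j‖ = R⁻¹ ^ n * ∏ j, q j ^ κ j := by
        rw [norm_prod, norm_prod, ← Finset.prod_mul_distrib]
        simp only [norm_pow, norm_inv, hnorm, hq]
        rw [← Fin.prod_const, ← Finset.prod_mul_distrib]
        refine Finset.prod_congr rfl fun j _ => ?_
        rw [div_pow, pow_succ, inv_pow]
        ring
      have h2 := hC θ hθ
      calc ‖J θ * ((∏ j, (T θ j)⁻¹ ^ (κ j + 1)) * f (T θ) * ∏ j, z j ^ κ j)‖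
          = ‖J θ * f (T θ)‖ * (‖∏ j, (T θ j)⁻¹ ^ (κ j + 1)‖ * ‖∏ j, z j ^ κ j‖) := by
            simp only [norm_mul]
            ring
        _ ≤ C * (‖∏ j, (T θ j)⁻¹ ^ (κ j + 1)‖ * ‖∏ j, z j ^ κ j‖) :=
            mul_le_mul_of_nonneg_right h2 (by positivity)
        _ = _ := by rw [h1, mul_assoc]
    · exact integrableOn_const hK.measure_lt_top.ne
    · have h1 : ∀ j, ‖z j / T θ j‖ < 1 := fun j => by
        rw [norm_div, hnorm, div_lt_one hR]
        exact hz j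
      have h2 := (hasSum_prod_geometric h1).mul_left (J θ * ((∏ j, (T θ j)⁻¹) * f (T θ)))
      have h3 : ∏ j, (T θ j - z j)⁻¹ = (∏ j, (T θ j)⁻¹) * ∏ j, (1 - z j / T θ j)⁻¹ := by
        rw [← Finset.prod_mul_distrib]
        refine Finset.prod_congr rfl fun j _ => ?_
        rw [← mul_inv, mul_sub, mul_one, mul_div_cancel₀ _ (hT0 θ j)]
      have h4 : J θ * ((∏ j, (T θ j - z j)⁻¹) * f (T θ)) =
          J θ * ((∏ j, (T θ j)⁻¹) * f (T θ)) * ∏ j, (1 - z j / T θ j)⁻¹ := by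
        rw [h3]
        ring
      rw [h4]
      refine h2.congr_fun fun κ => ?_
      simp only [pow_succ, Finset.prod_mul_distrib, mul_pow, div_eq_mul_inv]
      ring
  have hcauchy : ∫ θ in K, J θ * ((∏ j, (T θ j - z j)⁻¹) * f (T θ)) = a * f z :=
    torusIntegral_cauchy hR hRρ hf hz
  rw [hcauchy] at hsum
  have h4 := hsum.mul_left a⁻¹
  rw [inv_mul_cancel_left₀ ha0] at h4
  refine h4.congr_fun fun κ => ?_
  rw [mul_assoc]
  congr 1
  rw [torusIntegral, ← integral_mul_const]
  refine integral_congr_ae (Eventually.of_forall fun θ => ?_)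
  simp only [smul_eq_mul]
  ring

/-- The coefficients of a power series vanishing on a polydisc are zero. -/
lemma eq_zero_of_hasSum_zero {n : ℕ} {δ : ℝ} (hδ : 0 < δ) {c : (Fin n → ℕ) → ℂ}
    (h : HasPowerSeriesOnPolydisc 0 c δ) : c = 0 := by
  induction n with
  | zero =>
    have h1 := h 0 fun j => j.elim0
    have h2 := (hasSum_unique (fun κ : Fin 0 → ℕ => c κ * ∏ j, (0 : Fin 0 → ℂ) j ^ κ j)).unique h1
    ext κ
    refine Eq.trans ?_ h2
    rw [Finset.univ_eq_empty, Finset.prod_empty, mul_one]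
    exact congrArg c (Subsingleton.elim _ _)
  | succ n ih =>
    set d : ℕ → (Fin n → ℕ) → ℂ := fun k κ => c (Fin.cons k κ) with hd
    have hsum : ∀ (x : ℂ) (y : Fin n → ℂ), ‖x‖ < δ → y ∈ polydisc n δ →
        HasSum (fun p : ℕ × (Fin n → ℕ) => x ^ p.1 * (d p.1 p.2 * ∏ j, y j ^ p.2 j)) 0 := by
      intro x y hx hy
      have h1 := h (Fin.cons x y) fun j => by
        refine Fin.cases ?_ (fun j => ?_) j
        · simpa using hx
        · simpa using hy j
      rw [← (Fin.consEquiv (fun _ : Fin (n + 1) => ℕ)).hasSum_iff] at h1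
      refine h1.congr_fun fun p => ?_
      simp only [Function.comp, Fin.consEquiv, Equiv.coe_fn_mk, Fin.prod_univ_succ, Fin.cons_zero,
        Fin.cons_succ, hd]
      ring
    have hd0 : ∀ k, d k = 0 := by
      intro k
      refine ih fun y hy => ?_
      -- The power `x ^ l` cancels at any `x ≠ 0`, so the inner series converge already at
      -- `x = δ / 2`; their sums are the coefficients of a power series in `x` alone.
      have hδ2 : ‖((δ / 2 : ℝ) : ℂ)‖ < δ := by
        rw [Complex.norm_real, Real.norm_of_nonneg (by positivity)]
        linarith
      have hinner : ∀ l, Summable fun κ => d l κ * ∏ j, y j ^ κ j := fun l => by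
        have h1 := (hsum _ y hδ2 hy).summable.prod_factor l
        have h2 : (((δ / 2 : ℝ) : ℂ) ^ l) ≠ 0 :=
          pow_ne_zero l (Complex.ofReal_ne_zero.2 (half_pos hδ).ne')
        exact (summable_mul_left_iff h2).1 h1
      set s : ℕ → ℂ := fun l => ∑' κ, d l κ * ∏ j, y j ^ κ j with hs
      have hx : ∀ x : ℂ, ‖x‖ < δ → HasSum (fun l => x ^ l * s l) 0 := fun x hx =>
        (hsum x y hx hy).prod_fiberwise fun l => (hinner l).hasSum.mul_left (x ^ l)
      set p : FormalMultilinearSeries ℂ ℂ ℂ := fun l =>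
        ContinuousMultilinearMap.mkPiRing ℂ (Fin l) (s l) with hp
      have hcoeff : ∀ l, p.coeff l = s l := fun l => by simp [hp, FormalMultilinearSeries.coeff]
      have hps : HasFPowerSeriesAt (0 : ℂ → ℂ) p 0 := by
        rw [hasFPowerSeriesAt_iff]
        filter_upwards [Metric.ball_mem_nhds (0 : ℂ) hδ] with x hxb
        simp only [hcoeff, smul_eq_mul]
        exact hx x (by simpa using hxb)
      have hp0 := hps.eq_zero
      have hs0 : s k = 0 := by
        rw [← hcoeff, hp0]
        simp [FormalMultilinearSeries.coeff]
      have := (hinner k).hasSum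
      rwa [show ∑' κ, d k κ * ∏ j, y j ^ κ j = 0 from hs0] at this
    ext κ
    have := congrFun (hd0 (κ 0)) (Fin.tail κ)
    simpa [hd, Fin.cons_self_tail] using this

/-- A holomorphic function on a polydisc is the sum of a power series on the whole polydisc. -/
theorem exists_hasPowerSeriesOnPolydisc {n : ℕ} {ρ : ℝ} (hρ : 0 < ρ) {f : (Fin n → ℂ) → ℂ}
    (hf : DifferentiableOn ℂ f (polydisc n ρ)) : ∃ c, HasPowerSeriesOnPolydisc f c ρ := by
  obtain ⟨c, hc⟩ := exists_hasPowerSeriesOnPolydisc_of_lt (half_pos hρ) (half_lt_self hρ) hf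
  refine ⟨c, fun z hz => ?_⟩
  obtain ⟨R, hR1, hR2⟩ := exists_between (max_lt ((pi_norm_lt_iff hρ).2 hz) (half_lt_self hρ))
  have hR0 : ρ / 2 < R := (le_max_right _ _).trans_lt hR1
  obtain ⟨c', hc'⟩ := exists_hasPowerSeriesOnPolydisc_of_lt ((half_pos hρ).trans hR0) hR2 hf
  -- Both coefficient families represent `f` near `0`, so they agree.
  have heq : c' - c = 0 := by
    refine eq_zero_of_hasSum_zero (half_pos hρ) fun w hw => ?_
    have h := (hc' w fun j => (hw j).trans hR0).sub (hc w hw)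
    rw [sub_self] at h
    exact h.congr_fun fun κ => by simp [sub_mul]
  rw [← sub_eq_zero.1 heq]
  exact hc' z fun j => (norm_le_pi_norm z j).trans_lt ((le_max_left _ _).trans_lt hR1)

end PowerSeries

end

theorem lemma3p4 {H : Type*} [NormedAddCommGroup H] [InnerProductSpace ℂ H] [CompleteSpace H]
    [TopologicalSpace.SeparableSpace H] (M : VonNeumannAlgebra H) (τ : NFSTrace M)
    (n : ℕ) (A B : Fin n → H →L[ℂ] H)
    (hAM : ∀ j, A j ∈ M) (hBM : ∀ j, B j ∈ M)
    (hA : ∀ j, ‖A j‖ ≤ 1) (hB : ∀ j, ‖B j‖ ≤ 1)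
    (ε : ℝ) (hε : 0 < ε) (f : (Fin n → ℂ) → ℂ)
    (hf : DifferentiableOn ℂ f (polydisc n (1 + ε))) :
    (∃ c : (Fin n → ℕ) → ℂ, HasPowerSeriesOnPolydisc f c (1 + ε)) ∧
    ∀ c : (Fin n → ℕ) → ℂ, HasPowerSeriesOnPolydisc f c (1 + ε) →
      (∀ s ∈ Set.Icc (0 : ℝ) 1, Summable fun κ => ‖c κ • opMonomial (linPath A B s) κ‖) ∧
      ∀ m : ℕ, 1 ≤ m →
        ContDiffOn ℝ m (fun s : ℝ => opFun c (linPath A B s)) (Set.Icc 0 1) ∧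
        (∀ k ∈ Finset.Icc 1 m, ∀ j ∈ increasingTuples k n, ∀ i ∈ compositionTuples k m,
          ∀ t ∈ Set.Icc (0 : ℝ) 1, Summable fun κ => ‖c κ • derivMonomial A B j i t κ‖) ∧
        (∀ t ∈ Set.Icc (0 : ℝ) 1,
          iteratedDerivWithin m (fun s : ℝ => opFun c (linPath A B s)) (Set.Icc 0 1) t =
            ∑ k ∈ Finset.Icc 1 m, ∑ j ∈ increasingTuples k n, ∑ i ∈ compositionTuples k m,
              ((m ! : ℝ) / ∏ l, ((i l)! : ℝ)) • derivSeries c A B j i t) ∧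
        ∀ r : ℝ, 1 ≤ r → (∀ j, τ.MemLp r (B j - A j)) →
          ∀ p : ℝ, ((m : ℝ) < r ∧ p = r / m ∨ r ≤ m ∧ p = 1) →
            (∀ t ∈ Set.Icc (0 : ℝ) 1, τ.HasLpDerivAt p
              (iteratedDerivWithin (m - 1) (fun s : ℝ => opFun c (linPath A B s)) (Set.Icc 0 1))
              (iteratedDerivWithin m (fun s : ℝ => opFun c (linPath A B s)) (Set.Icc 0 1) t) t) ∧
            τ.LpContinuous p
              (iteratedDerivWithin m (fun s : ℝ => opFun c (linPath A B s)) (Set.Icc 0 1)) := by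
  refine ⟨exists_hasPowerSeriesOnPolydisc (by linarith) hf, fun c hc => ?_⟩
  have hchain := fun (m : ℕ) (t : ℝ) (ht : t ∈ Set.Icc (0 : ℝ) 1) =>
    hasDerivAt_termwiseDeriv hε hc hA hB m ht
  have hiter : ∀ m, ∀ t ∈ Set.Icc (0 : ℝ) 1, iteratedDerivWithin m
      (fun s : ℝ => opFun c (linPath A B s)) (Set.Icc 0 1) t = termwiseDeriv c A B m t := by
    rw [← termwiseDeriv_zero]
    exact iteratedDerivWithin_eq_of_hasDerivAt hchain
  refine ⟨fun s hs => ?_, fun m hm => ⟨?_, fun k _ j _ i _ t ht => ?_, fun t ht => ?_, ?_⟩⟩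
  · refine (summable_multiDerivMonomial hε hc hA hB hs 0).congr fun κ => ?_
    simp [multiDerivMonomial, opMonomial]
  · rw [← termwiseDeriv_zero]
    exact contDiffOn_of_hasDerivAt hchain m
  · simp_rw [derivMonomial_eq]
    exact summable_multiDerivMonomial hε hc hA hB ht _
  · rw [hiter m t ht, termwiseDeriv_eq_sum hε hc hA hB ht,
      ← sum_increasingTuples_compositionTuples hm]
    simp_rw [derivSeries, derivMonomial_eq]
  · intro r hr hV p hp
    obtain ⟨m, rfl⟩ : ∃ l, m = l + 1 := ⟨m - 1, by omega⟩
    -- In the second case `r` is replaced by `m`: the `V_j` are bounded, hence lie in `𝓛_m`.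
    obtain ⟨r', hmr, hV', rfl⟩ : ∃ r' : ℝ, ((m + 1 : ℕ) : ℝ) ≤ r' ∧
        (∀ j, τ.lpNorm r' (B j - A j) < ∞) ∧ p = r' / (m + 1 : ℕ) := by
      rcases hp with ⟨h, rfl⟩ | ⟨h, rfl⟩
      · exact ⟨r, h.le, fun j => (hV j).2, rfl⟩
      · exact ⟨(m + 1 : ℕ), le_rfl, fun j => NFSTrace.lpNorm_lt_top_of_le (by linarith) h
          (hV j).1 (hV j).2, (div_self (by positivity)).symm⟩
    obtain ⟨h1, h2⟩ := hasLpDerivAt_termwiseDeriv hε hc hAM hBM hA hB hV' hmr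
    refine ⟨fun t ht => ?_, fun t ht => ?_⟩
    · refine ⟨by rw [hiter _ t ht]; exact (h1 t ht).1, (h1 t ht).2.congr' ?_⟩
      filter_upwards [self_mem_nhdsWithin] with s hs
      rw [Nat.add_sub_cancel, hiter _ t ht, hiter _ t ht, hiter _ s hs.1]
    · refine (h2 t ht).congr' ?_
      filter_upwards [self_mem_nhdsWithin] with s hs
      rw [hiter _ t ht, hiter _ s hs]
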